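/- Let $p$ be a prime. A \emph{discrete $p$-toral group} is a group $S$ with a normal subgroup $T\cong(\mathbb{Z}/p^\infty)^r$, $r\ge 0$ finite, such that $S/T$ is a finite $p$-group; then $T$ is unique, every subgroup of $S$ is again discrete $p$-toral, and the \emph{order} of $S$ is the pair $|S|=(r,|S/T|)$, such pairs being compared lexicographically. A \emph{fusion system} $\mathcal{F}$ over $S$ is a category whose objects are the subgroups of $S$, whose morphism sets $\operatorname{Hom}_{\mathcal F}(P,Q)$ consist of injective homomorphisms $P\to Q$ (with composition of maps) and contain all those induced by conjugation by elements of $S$, and in which every morphism is an isomorphism of $\mathcal F$ followed by an inclusion. Subgroups (elements $x,y$) are \emph{$\mathcal F$-conjugate} if they are isomorphic in $\mathcal F$ (if some $\varphi\in\operatorname{Hom}_{\mathcal F}(\langle x\rangle,\langle y\rangle)$ has $\varphi(x)=y$). A subgroup $P\le S$ is \emph{fully centralized} (\emph{fully normalized}) in $\mathcal F$ if $|C_S(P)|\ge|C_S(Q)|$ (respectively $|N_S(P)|\ge|N_S(Q)|$) for all $Q$ that are $\mathcal F$-conjugate to $P$. Write $\operatorname{Aut}_S(P)$ for the group of automorphisms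 of $P$ induced by conjugation by elements of $N_S(P)$, $\operatorname{Out}_S(P)=\operatorname{Aut}_S(P)/\operatorname{Inn}(P)$ and $\operatorname{Out}_{\mathcal F}(P)=\operatorname{Aut}_{\mathcal F}(P)/\operatorname{Inn}(P)$. The fusion system $\mathcal F$ is \emph{saturated} if: (I) every $P\le S$ that is fully normalized in $\mathcal F$ is fully centralized in $\mathcal F$, $\operatorname{Out}_{\mathcal F}(P)$ is finite, and $\operatorname{Out}_S(P)$ is a Sylow $p$-subgroup of $\operatorname{Out}_{\mathcal F}(P)$; (II) if $P\le S$ and $\varphi\in\operatorname{Hom}_{\mathcal F}(P,S)$ are such that $\varphi(P)$ is fully centralized, then $\varphi$ extends to a morphism in $\operatorname{Hom}_{\mathcal F}(N_\varphi,S)$, where $N_\varphi=\{g\in N_S(P)\mid \varphi c_g\varphi^{-1}\in\operatorname{Aut}_S(\varphi(P))\}$; (III) if $P_1\le P_2\le\cdots$ are subgroups of $S$ with union $P_\infty$, and $\varphi\colon P_\infty\to S$ is a homomorphism with $\varphi|_{P_n}\in\operatorname{Hom}_{\mathcal F}(P_n,S)$ for all $n$, then $\varphi\in\operatorname{Hom}_{\mathcal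 F}(P_\infty,S)$. For $x\in S$, the \emph{centralizer fusion system} $C_{\mathcal F}(x)$ over $C_S(x)$ has as morphisms $P\to Q$, for $P,Q\le C_S(x)$, the homomorphisms that extend to a morphism $P\langle x\rangle\to Q\langle x\rangle$ of $\mathcal F$ sending $x$ to $x$. \textbf{Proposition.} Let $\mathcal F$ be a fusion system over a discrete $p$-toral group $S$. Then $\mathcal F$ is saturated if and only if the following two conditions hold. (a) $\mathcal F$ satisfies axiom (III). (b) There is a set $\mathfrak X$ of elements of order $p$ in $S$ such that (i) each $x\in S$ of order $p$ is $\mathcal F$-conjugate to some $y\in\mathfrak X$; (ii) if $x,y\in S$ are $\mathcal F$-conjugate and $y\in\mathfrak X$, then there is $\rho\in\operatorname{Hom}_{\mathcal F}(C_S(x),C_S(y))$ with $\rho(x)=y$; and (iii) for each $x\in\mathfrak X$, $C_{\mathcal F}(x)$ is a saturated fusion system over $C_S(x)$. -/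

import Mathlib

/-- The quasicyclic group `ℤ/p^∞`, realized as the group of complex roots of unity of
`p`-power order. -/
abbrev PruferGroup (p : ℕ) : Type := CommGroup.primaryComponent Circle p

/-- A discrete `p`-toral group: a group with a normal subgroup `T ≅ (ℤ/p^∞)^r`, for some finite
`r ≥ 0`, such that the quotient by `T` is a finite `p`-group. -/
def IsDiscretePToral (p : ℕ) (G : Type*) [Group G] : Prop :=
  ∃ (T : Subgroup G) (_ : T.Normal) (r : ℕ),
    Nonempty (T ≃* (Fin r → PruferGroup p)) ∧ Finite (G ⧸ T) ∧ IsPGroup p (G ⧸ T)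

/-- The identity component of a discrete `p`-toral group: its smallest subgroup of finite index.
If `T` is as in the definition of a discrete `p`-toral group, this is `T`. -/
def identityComponent (G : Type*) [Group G] : Subgroup G :=
  sInf {H : Subgroup G | H.FiniteIndex}

/-- The rank of a discrete `p`-toral group: the (unique) `r` such that the identity component is
isomorphic to `(ℤ/p^∞)^r`. -/
noncomputable def toralRank (p : ℕ) (G : Type*) [Group G] : ℕ :=
  sInf {r : ℕ | Nonempty (identityComponent G ≃* (Fin r → PruferGroup p))}

/-- The order of a discrete `p`-toral group: the pair formed by the rank and the number of
components, in the lexicographic order. -/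
noncomputable def toralOrder (p : ℕ) (G : Type*) [Group G] : ℕ ×ₗ ℕ :=
  toLex (toralRank p G, (identityComponent G).index)

/-- A fusion system over `S`: a category whose objects are the subgroups of `S` and whose morphism
sets are sets of injective homomorphisms (composed as maps), which contain all the homomorphisms
induced by conjugation in `S` (in particular identities and inclusions), and such that each
morphism is an isomorphism of the category followed by an inclusion. -/
structure FusionSystem (S : Type*) [Group S] where
  Hom : (P Q : Subgroup S) → Set (P →* Q)
  injective_of_mem : ∀ {P Q : Subgroup S} {φ : P →* Q}, φ ∈ Hom P Q → Function.Injective φ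
  conj_mem : ∀ {P Q : Subgroup S} (φ : P →* Q),
    (∃ g : S, ∀ x : P, (φ x : S) = g * x * g⁻¹) → φ ∈ Hom P Q
  comp_mem : ∀ {P Q R : Subgroup S} {φ : P →* Q} {ψ : Q →* R},
    φ ∈ Hom P Q → ψ ∈ Hom Q R → ψ.comp φ ∈ Hom P R
  factor : ∀ {P Q : Subgroup S} {φ : P →* Q}, φ ∈ Hom P Q →
    ∃ (R : Subgroup S) (hR : R ≤ Q) (e : P ≃* R),
      e.toMonoidHom ∈ Hom P R ∧ e.symm.toMonoidHom ∈ Hom R P ∧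
        φ = (Subgroup.inclusion hR).comp e.toMonoidHom

/-- The image in `S` of a homomorphism between subgroups of `S`. -/
def homImage {S : Type*} [Group S] {P Q : Subgroup S} (φ : P →* Q) : Subgroup S :=
  φ.range.map Q.subtype

/-- The group `Inn(G)` of inner automorphisms. -/
def innerAut (G : Type*) [Group G] : Subgroup (MulAut G) :=
  (MulAut.conj : G →* MulAut G).range

instance innerAut_normal (G : Type*) [Group G] : (innerAut G).Normal := by
  constructor
  rintro _ ⟨g, rfl⟩ α
  refine ⟨α g, ?_⟩
  ext x
  simp [MulAut.conj_apply]

/-- The group `Out(G) = Aut(G) / Inn(G)`. -/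
abbrev OuterAut (G : Type*) [Group G] : Type _ := MulAut G ⧸ innerAut G

/-- `Aut_S(P)`: the automorphisms of `P` induced by conjugation by elements of `N_S(P)`. -/
def autBy {S : Type*} [Group S] (P : Subgroup S) : Subgroup (MulAut P) :=
  P.normalizerMonoidHom.range

/-- `Out_S(P) = Aut_S(P) / Inn(P)`, as a subgroup of `Out(P)`. -/
def outBy {S : Type*} [Group S] (P : Subgroup S) : Subgroup (OuterAut P) :=
  (autBy P).map (QuotientGroup.mk' (innerAut P))

/-- For `φ : P → S`, the subgroup `N_φ` of those `g ∈ N_S(P)` such that `φ ∘ c_g ∘ φ⁻¹` is the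
automorphism `c_h` of `φ(P)` for some `h ∈ N_S(φ(P))`. -/
def extensionDomain {S : Type*} [Group S] {P : Subgroup S} (φ : P →* (⊤ : Subgroup S)) :
    Subgroup S where
  carrier := {g | g ∈ Subgroup.normalizer (P : Set S) ∧
    ∃ h ∈ Subgroup.normalizer (homImage φ : Set S),
      ∀ x y : P, (y : S) = g * x * g⁻¹ → (φ y : S) = h * φ x * h⁻¹}
  one_mem' := by
    refine ⟨one_mem _, 1, one_mem _, fun x y hxy => ?_⟩
    have : y = x := Subtype.ext (by simpa using hxy)
    simp [this]
  mul_mem' := by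
    rintro a b ⟨ha, h, hh, Ha⟩ ⟨hb, k, hk, Hb⟩
    refine ⟨mul_mem ha hb, h * k, mul_mem hh hk, fun x y hxy => ?_⟩
    have hz : b * x * b⁻¹ ∈ P := (hb x).1 x.2
    rw [Ha ⟨_, hz⟩ y (by simp [hxy, mul_assoc]), Hb x ⟨_, hz⟩ rfl]
    simp [mul_assoc]
  inv_mem' := by
    rintro a ⟨ha, h, hh, Ha⟩
    refine ⟨inv_mem ha, h⁻¹, inv_mem hh, fun x y hxy => ?_⟩
    rw [Ha y x (by simp [hxy, mul_assoc])]
    simp [mul_assoc]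

theorem le_extensionDomain {S : Type*} [Group S] {P : Subgroup S}
    (φ : P →* (⊤ : Subgroup S)) : P ≤ extensionDomain φ := by
  intro g hg
  refine ⟨Subgroup.le_normalizer hg, φ ⟨g, hg⟩, Subgroup.le_normalizer ?_, fun x y hxy => ?_⟩
  · exact ⟨φ ⟨g, hg⟩, ⟨_, rfl⟩, rfl⟩
  · have : y = ⟨g, hg⟩ * x * (⟨g, hg⟩ : P)⁻¹ := Subtype.ext (by simpa using hxy)
    simp [this]

namespace FusionSystem

/-- `P` and `Q` are `F`-conjugate: they are isomorphic in the category `F`. -/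
def IsConjugate {S : Type*} [Group S] (F : FusionSystem S) (P Q : Subgroup S) : Prop :=
  ∃ e : P ≃* Q, e.toMonoidHom ∈ F.Hom P Q ∧ e.symm.toMonoidHom ∈ F.Hom Q P

/-- The elements `x` and `y` are `F`-conjugate: some morphism `⟨x⟩ → ⟨y⟩` in `F` sends
`x` to `y`. -/
def IsConjugateElement {S : Type*} [Group S] (F : FusionSystem S) (x y : S) : Prop :=
  ∃ φ ∈ F.Hom (Subgroup.zpowers x) (Subgroup.zpowers y),
    (φ ⟨x, Subgroup.mem_zpowers x⟩ : S) = y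

/-- `|C_S(P)| ≥ |C_S(Q)|` for all `Q` that are `F`-conjugate to `P`. -/
def FullyCentralized {S : Type*} [Group S] (p : ℕ) (F : FusionSystem S) (P : Subgroup S) : Prop :=
  ∀ Q : Subgroup S, F.IsConjugate P Q →
    toralOrder p (Subgroup.centralizer (Q : Set S)) ≤
      toralOrder p (Subgroup.centralizer (P : Set S))

/-- `|N_S(P)| ≥ |N_S(Q)|` for all `Q` that are `F`-conjugate to `P`. -/
def FullyNormalized {S : Type*} [Group S] (p : ℕ) (F : FusionSystem S) (P : Subgroup S) : Prop :=
  ∀ Q : Subgroup S, F.IsConjugate P Q →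
    toralOrder p (Subgroup.normalizer (Q : Set S)) ≤
      toralOrder p (Subgroup.normalizer (P : Set S))

theorem id_mem {S : Type*} [Group S] (F : FusionSystem S) (P : Subgroup S) :
    MonoidHom.id P ∈ F.Hom P P :=
  F.conj_mem _ ⟨1, fun x => by simp⟩

/-- `Aut_F(P)`: the automorphisms of `P` in the category `F`. -/
def aut {S : Type*} [Group S] (F : FusionSystem S) (P : Subgroup S) : Subgroup (MulAut P) where
  carrier := {α | MulEquiv.toMonoidHom α ∈ F.Hom P P ∧
    MulEquiv.toMonoidHom (MulEquiv.symm α) ∈ F.Hom P P}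
  one_mem' := ⟨F.id_mem P, F.id_mem P⟩
  mul_mem' := fun ha hb => ⟨F.comp_mem hb.1 ha.1, F.comp_mem ha.2 hb.2⟩
  inv_mem' := fun ha => ⟨ha.2, ha.1⟩

/-- `Out_F(P) = Aut_F(P) / Inn(P)`, as a subgroup of `Out(P)`. -/
def out {S : Type*} [Group S] (F : FusionSystem S) (P : Subgroup S) : Subgroup (OuterAut P) :=
  (F.aut P).map (QuotientGroup.mk' (innerAut P))

/-- Axiom (I): a fully normalized subgroup `P` is fully centralized, `Out_F(P)` is finite, and
`Out_S(P)` is a Sylow `p`-subgroup of `Out_F(P)`. -/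
def SylowAxiom {S : Type*} [Group S] (p : ℕ) (F : FusionSystem S) : Prop :=
  ∀ P : Subgroup S, F.FullyNormalized p P →
    F.FullyCentralized p P ∧ Finite (F.out P) ∧
      ∃ R : Sylow p (F.out P), (R : Subgroup (F.out P)) = (outBy P).subgroupOf (F.out P)

/-- Axiom (II): a morphism `φ : P → S` with fully centralized image extends to `N_φ`. -/
def ExtensionAxiom {S : Type*} [Group S] (p : ℕ) (F : FusionSystem S) : Prop :=
  ∀ (P : Subgroup S), ∀ φ ∈ F.Hom P ⊤, F.FullyCentralized p (homImage φ) →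
    ∃ ψ ∈ F.Hom (extensionDomain φ) ⊤,
      ψ.comp (Subgroup.inclusion (le_extensionDomain φ)) = φ

/-- Axiom (III): a homomorphism to `S` from the union of an increasing sequence of subgroups is in
`F` if its restriction to each of these subgroups is. -/
def ContinuityAxiom {S : Type*} [Group S] (F : FusionSystem S) : Prop :=
  ∀ (P : ℕ → Subgroup S), Monotone P → ∀ φ : (⨆ n, P n : Subgroup S) →* (⊤ : Subgroup S),
    (∀ n, φ.comp (Subgroup.inclusion (le_iSup P n)) ∈ F.Hom (P n) ⊤) →
      φ ∈ F.Hom (⨆ n, P n) ⊤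

/-- A saturated fusion system over a discrete `p`-toral group `S`. -/
structure IsSaturated {S : Type*} [Group S] (p : ℕ) (F : FusionSystem S) : Prop where
  sylowAxiom : F.SylowAxiom p
  extensionAxiom : F.ExtensionAxiom p
  continuityAxiom : F.ContinuityAxiom

end FusionSystem

/-- The centralizer `C_S(x)`. -/
abbrev elemCentralizer {S : Type*} [Group S] (x : S) : Subgroup S := Subgroup.centralizer {x}

theorem mem_elemCentralizer_self {S : Type*} [Group S] (x : S) : x ∈ elemCentralizer x :=
  Subgroup.mem_centralizer_singleton_iff.2 rfl

/-- For `P ≤ C_S(x)`, the subgroup `P⟨x⟩` of `S`. -/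
def joinElem {S : Type*} [Group S] {x : S} (P : Subgroup (elemCentralizer x)) : Subgroup S :=
  P.map (elemCentralizer x).subtype ⊔ Subgroup.zpowers x

theorem elem_mem_joinElem {S : Type*} [Group S] {x : S} (P : Subgroup (elemCentralizer x)) :
    x ∈ joinElem P :=
  (le_sup_right : Subgroup.zpowers x ≤ joinElem P) (Subgroup.mem_zpowers x)

theorem coe_mem_joinElem {S : Type*} [Group S] {x : S} {P : Subgroup (elemCentralizer x)}
    (a : P) : ((a : elemCentralizer x) : S) ∈ joinElem P :=
  (le_sup_left : P.map (elemCentralizer x).subtype ≤ joinElem P) ⟨a, a.2, rfl⟩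

namespace FusionSystem

/-- The centralizer fusion system `C_F(x)` over `C_S(x)`: for `P, Q ≤ C_S(x)`, its morphisms
`P → Q` are the homomorphisms that extend to a morphism `P⟨x⟩ → Q⟨x⟩` of `F` sending `x`
to `x`. -/
def centralizer {S : Type*} [Group S] (F : FusionSystem S) (x : S) :
    FusionSystem (elemCentralizer x) where
  Hom P Q := {φ | ∃ ψ ∈ F.Hom (joinElem P) (joinElem Q),
    (ψ ⟨x, elem_mem_joinElem P⟩ : S) = x ∧
      ∀ a : P, (ψ ⟨a, coe_mem_joinElem a⟩ : S) = (φ a : elemCentralizer x)}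
  injective_of_mem := by
    rintro P Q φ ⟨ψ, hψ, -, h⟩ a b hab
    have h1 : ψ ⟨a, coe_mem_joinElem a⟩ = ψ ⟨b, coe_mem_joinElem b⟩ :=
      Subtype.ext (by rw [h, h, hab])
    have h2 := F.injective_of_mem hψ h1
    exact Subtype.ext (Subtype.ext (Subtype.mk.inj h2))
  conj_mem := by
    rintro P Q φ ⟨g, hg⟩
    have hgx : (g : S) * x * (g : S)⁻¹ = x := by
      have := Subgroup.mem_centralizer_singleton_iff.1 g.2
      rw [mul_inv_eq_iff_eq_mul]
      exact this
    have hle : joinElem P ≤ (joinElem Q).comap (MulAut.conj (g : S)).toMonoidHom := by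
      refine sup_le ?_ ?_
      · rintro _ ⟨a, ha, rfl⟩
        have := coe_mem_joinElem (φ ⟨a, ha⟩)
        rw [hg] at this
        simpa using this
      · rw [Subgroup.zpowers_le]
        simpa [hgx] using elem_mem_joinElem Q
    refine ⟨((MulAut.conj (g : S)).toMonoidHom.comp (joinElem P).subtype).codRestrict _
      (fun a => hle a.2), F.conj_mem _ ⟨g, fun a => rfl⟩, by simpa using hgx, fun a => ?_⟩
    simp [hg]
  comp_mem := by
    rintro P Q R φ φ' ⟨ψ, hψ, hx, h⟩ ⟨ψ', hψ', hx', h'⟩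
    refine ⟨ψ'.comp ψ, F.comp_mem hψ hψ', ?_, fun a => ?_⟩
    · have : ψ ⟨x, elem_mem_joinElem P⟩ = ⟨x, elem_mem_joinElem Q⟩ := Subtype.ext hx
      simp [this, hx']
    · have : ψ ⟨a, coe_mem_joinElem a⟩ = ⟨φ a, coe_mem_joinElem (φ a)⟩ := Subtype.ext (h a)
      simp [this, h']
  factor := by
    rintro P Q φ ⟨ψ, hψ, hx, h⟩
    have hinj : Function.Injective φ := by
      intro a b hab
      have h1 : ψ ⟨a, coe_mem_joinElem a⟩ = ψ ⟨b, coe_mem_joinElem b⟩ :=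
        Subtype.ext (by rw [h, h, hab])
      have h2 := F.injective_of_mem hψ h1
      exact Subtype.ext (Subtype.ext (Subtype.mk.inj h2))
    obtain ⟨R', hR', e', he', he'', rfl⟩ := F.factor hψ
    let R : Subgroup (elemCentralizer x) := homImage φ
    have hR : R ≤ Q := by
      rintro _ ⟨b, -, rfl⟩
      exact b.2
    let e : P ≃* R := (MonoidHom.ofInjective hinj).trans
      (φ.range.equivMapOfInjective Q.subtype Q.subtype_injective)
    have he : ∀ a : P, ((e a : elemCentralizer x)) = φ a := fun a => rfl
    have hRR : R' = joinElem R := by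
      have hR1 : R' = (R'.subtype.comp e'.toMonoidHom).range := by
        have htop : e'.toMonoidHom.range = ⊤ := MonoidHom.range_eq_top.2 e'.surjective
        rw [MonoidHom.range_comp, htop, ← MonoidHom.range_eq_map, Subgroup.range_subtype]
      apply le_antisymm
      · have key : joinElem P ≤ ((joinElem R).comap
            (R'.subtype.comp e'.toMonoidHom)).map (joinElem P).subtype := by
          refine sup_le ?_ ?_
          · rintro _ ⟨a, ha, rfl⟩
            refine ⟨⟨a, coe_mem_joinElem ⟨a, ha⟩⟩, ?_, rfl⟩
            have h1 := h ⟨a, ha⟩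
            have h2 := coe_mem_joinElem (e ⟨a, ha⟩)
            rw [he, ← h1] at h2
            exact h2
          · rw [Subgroup.zpowers_le]
            refine ⟨⟨x, elem_mem_joinElem P⟩, ?_, rfl⟩
            have h2 := elem_mem_joinElem R
            have h3 : ((e' ⟨x, elem_mem_joinElem P⟩ : R') : S) = x := hx
            change ((e' ⟨x, elem_mem_joinElem P⟩ : R') : S) ∈ joinElem R
            rw [h3]
            exact h2
        rw [hR1]
        rintro _ ⟨a, rfl⟩
        obtain ⟨b, hb, hba⟩ := key a.2
        have : b = a := Subtype.ext hba
        rw [← this]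
        exact hb
      · refine sup_le ?_ ?_
        · rintro _ ⟨b, hb, rfl⟩
          obtain ⟨a, ha⟩ := e.surjective ⟨b, hb⟩
          have h1 := h a
          rw [← he, ha] at h1
          change (b : S) ∈ R'
          rw [← h1]
          exact (e' _).2
        · rw [Subgroup.zpowers_le]
          have h3 : ((e' ⟨x, elem_mem_joinElem P⟩ : R') : S) = x := hx
          rw [← h3]
          exact (e' _).2
    subst hRR
    have hx' : e' ⟨x, elem_mem_joinElem P⟩ = ⟨x, elem_mem_joinElem R⟩ := Subtype.ext hx
    have h' : ∀ a : P, e' ⟨a, coe_mem_joinElem a⟩ = ⟨e a, coe_mem_joinElem (e a)⟩ :=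
      fun a => Subtype.ext (h a)
    refine ⟨R, hR, e, ⟨e'.toMonoidHom, he', hx, h⟩, ⟨e'.symm.toMonoidHom, he'', ?_, ?_⟩, rfl⟩
    · change ((e'.symm ⟨x, elem_mem_joinElem R⟩ : joinElem P) : S) = x
      rw [← hx', e'.symm_apply_apply]
    · intro b
      obtain ⟨a, rfl⟩ := e.surjective b
      change ((e'.symm ⟨e a, coe_mem_joinElem (e a)⟩ : joinElem P) : S) = ((e.symm (e a) : P) : _)
      rw [← h', e'.symm_apply_apply, e.symm_apply_apply]

end FusionSystem

/-! Both implications compare a subgroup `P` of `S` with subgroups of centralizers of elements of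
order `p`. Call `y` receptive if every morphism sending some `x` to `y` can be replaced by one
defined on all of `C_S(x)` that still sends `x` to `y`; condition (ii) says that the elements of the
given set are receptive.

Local to global. Let `P ≠ 1`. Since `Aut_S(P)` is a `p`-group acting on the finite group of elements
of order dividing `p` in `Z(P)`, there is `x` of order `p` in `Z(P)` fixed by `Aut_S(P)` whose
stabilizer in `Aut_F(P)` has index prime to `p` (`IsPToral.exists_fixed_orderOf_eq`). Then `N_S(P) ≤
C_S(x)`, and receptivity moves the whole situation into `C_S(y)` with `C_F(y)` saturated. Axiom (I)
for `P` follows from axiom (I) in `C_F(y)`, because stabilizers of `y` are automorphism groups in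
`C_F(y)` (`HasSylowAut.of_centralizer`). For axiom (II) such an element is chosen in the fully
centralized target, both source and target are moved into `C_S(y)`, the morphism is extended there,
and the extension is pulled back (`IsLocallySaturated.extensionAxiom`).

Global to local. The elements of order `p` generating a fully centralized subgroup form the required
set: axiom (II) makes them receptive (`ExtensionAxiom.isReceptive`). Axioms (II) and (III) pass to
`C_F(x)` because a morphism of `C_F(x)` on `P` is a morphism of `F` on `P⟨x⟩` fixing `x`. For axiom
(I) it suffices, by `FullyNormalized.of_isIso_hasSylowAut`, to find one good `C_F(x)`-conjugate of
each `P`; it comes from a fully normalized `F`-conjugate of `P⟨x⟩` by a Sylow argument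
(`IsSaturated.exists_isIso_centralizer`).

Two facts about discrete `p`-toral groups replace counting in finite groups. An injective
homomorphism into a group of no larger order is onto (`IsPToral.surjective_of_toralOrder_le`). The
orders of the normalizers of the conjugates of `P` form a finite set
(`IsPToral.exists_index_normalizer_le`), so fully normalized conjugates exist. -/

/-- An abelian `p`-group which is `p`-divisible and has finite `p`-torsion. -/
structure IsPTorus (p : ℕ) (D : Type*) [Group D] : Prop where
  comm : ∀ a b : D, a * b = b * a
  isPGroup : IsPGroup p D
  divisible : ∀ a : D, ∃ b, b ^ p = a
  finite_torsion : {a : D | a ^ p = 1}.Finite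

/-! ### Divisible abelian `p`-groups are classified by their `p`-torsion -/

section Classification

variable {p : ℕ}

theorem exists_pow_eq_of_coprime {D : Type*} [Group D] (hD : IsPGroup p D) {m : ℕ}
    (hm : m.Coprime p) (a : D) : ∃ b, b ^ m = a :=
  (hD.powEquiv hm.symm).surjective a

theorem exists_pow_prime_pow_eq {D : Type*} [Group D] (hdiv : ∀ a : D, ∃ b, b ^ p = a) (k : ℕ)
    (a : D) : ∃ b, b ^ p ^ k = a := by
  induction k generalizing a with
  | zero => exact ⟨a, by simp⟩
  | succ k ih =>
    obtain ⟨b, rfl⟩ := hdiv a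
    obtain ⟨c, rfl⟩ := ih b
    exact ⟨c, by rw [pow_succ, pow_mul]⟩

/-- Split `n` into a power of `p`, handled by divisibility, and a factor prime to `p`, for which the
power map is bijective on a `p`-group. -/
theorem exists_pow_eq_of_ne_zero [Fact p.Prime] {D : Type*} [Group D] (hD : IsPGroup p D)
    (hdiv : ∀ a : D, ∃ b, b ^ p = a) {n : ℕ} (hn : n ≠ 0) (a : D) : ∃ b, b ^ n = a := by
  obtain ⟨k, m, hm, rfl⟩ := Nat.exists_eq_pow_mul_and_not_dvd hn p (Fact.out : p.Prime).ne_one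
  obtain ⟨b, rfl⟩ := exists_pow_eq_of_coprime hD
    ((Nat.Prime.coprime_iff_not_dvd Fact.out).2 hm).symm a
  obtain ⟨c, rfl⟩ := exists_pow_prime_pow_eq hdiv k b
  exact ⟨c, by rw [pow_mul]⟩

/-- A homomorphism from a subgroup of an abelian group to a divisible abelian `p`-group extends. -/
theorem exists_extension_of_divisible [Fact p.Prime] {A B D : Type*} [CommGroup A] [CommGroup B] [CommGroup D]
    (hD : IsPGroup p D) (hdiv : ∀ a : D, ∃ b, b ^ p = a) (i : A →* B)
    (hi : Function.Injective i) (f : A →* D) : ∃ g : B →* D, g.comp i = f := by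
  have hsurj : ∀ {n : ℤ}, n ≠ 0 → Function.Surjective fun a : Additive D => n • a := by
    intro n hn a
    obtain ⟨b, hb⟩ := exists_pow_eq_of_ne_zero hD hdiv (Int.natAbs_ne_zero.2 hn) a.toMul
    rcases Int.natAbs_eq n with h | h
    · refine ⟨Additive.ofMul b, ?_⟩
      change n • Additive.ofMul b = a
      rw [h, natCast_zsmul, ← ofMul_pow, hb]
      rfl
    · refine ⟨Additive.ofMul b⁻¹, ?_⟩
      change n • Additive.ofMul b⁻¹ = a
      rw [h, neg_smul, natCast_zsmul, ← ofMul_pow, inv_pow, hb, ofMul_inv, neg_neg]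
      rfl
  -- A divisible abelian group is an injective `ℤ`-module by Baer's criterion.
  let : DivisibleBy (Additive D) ℤ := divisibleByOfSMulRightSurj _ _ hsurj
  obtain ⟨g, hg⟩ := (Module.Baer.of_divisible (Additive D)).extension_property_addMonoidHom
    (MonoidHom.toAdditive i) hi (MonoidHom.toAdditive f)
  refine ⟨MonoidHom.toAdditive.symm g, ?_⟩
  ext a
  exact congrArg Additive.toMul (DFunLike.congr_fun hg (Additive.ofMul a))

theorem nonempty_mulEquiv_of_pow_eq_one [Fact p.Prime] {A B : Type*} [CommGroup A] [CommGroup B] [Finite A]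
    [Finite B] (hA : ∀ a : A, a ^ p = 1) (hB : ∀ b : B, b ^ p = 1)
    (h : Nat.card A = Nat.card B) : Nonempty (A ≃* B) := by
  let : Module (ZMod p) (Additive A) := AddCommGroup.zmodModule (n := p) hA
  let : Module (ZMod p) (Additive B) := AddCommGroup.zmodModule (n := p) hB
  have hA' := Module.natCard_eq_pow_finrank (K := ZMod p) (V := Additive A)
  have hB' := Module.natCard_eq_pow_finrank (K := ZMod p) (V := Additive B)
  have e : Module.finrank (ZMod p) (Additive A) = Module.finrank (ZMod p) (Additive B) := by
    have h' : Nat.card (Additive A) = Nat.card (Additive B) := h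
    rw [hA', hB', Nat.card_zmod] at h'
    exact Nat.pow_right_injective (Fact.out : p.Prime).two_le h'
  exact ⟨MulEquiv.toAdditive.symm (LinearEquiv.ofFinrankEq _ _ e).toAddEquiv⟩

/-- An injective homomorphism to an abelian `p`-group from a `p`-divisible group, whose image
contains the `p`-torsion, is surjective. -/
theorem surjective_of_torsion_le_range {H G : Type*} [Group H] [Group G]
    (hcomm : ∀ a b : G, a * b = b * a) (hG : IsPGroup p G) (hdiv : ∀ a : H, ∃ b, b ^ p = a)
    (f : H →* G) (hf : ∀ g : G, g ^ p = 1 → g ∈ f.range) : Function.Surjective f := by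
  have key : ∀ (k : ℕ) (g : G), g ^ p ^ k = 1 → g ∈ f.range := by
    intro k
    induction k with
    | zero => intro g hg; rw [pow_zero, pow_one] at hg; rw [hg]; exact one_mem _
    | succ k ih =>
      intro g hg
      obtain ⟨h, hh⟩ := ih (g ^ p) (by rw [← pow_mul, ← pow_succ', hg])
      obtain ⟨h', rfl⟩ := hdiv h
      have h2 : (g * (f h')⁻¹) ^ p = 1 := by
        rw [(show Commute g (f h')⁻¹ from hcomm _ _).mul_pow, inv_pow, ← map_pow, hh,
          mul_inv_cancel]
      have := mul_mem (hf _ h2) (⟨h', rfl⟩ : f h' ∈ f.range)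
      simpa using this
  intro g
  obtain ⟨k, hk⟩ := hG g
  exact key k g hk

/-- A nontrivial kernel in a `p`-group contains an element of order `p`. -/
theorem injective_of_injOn_torsion {H G : Type*} [Group H] [Group G] (hH : IsPGroup p H)
    (f : H →* G) (hf : ∀ h : H, h ^ p = 1 → f h = 1 → h = 1) : Function.Injective f := by
  rw [injective_iff_map_eq_one]
  have key : ∀ (k : ℕ) (h : H), h ^ p ^ k = 1 → f h = 1 → h = 1 := by
    intro k
    induction k with
    | zero => intro h hh _; simpa using hh
    | succ k ih =>
      intro h hh h1
      have := ih (h ^ p) (by rw [← pow_mul, ← pow_succ', hh]) (by rw [map_pow, h1, one_pow])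
      exact hf h this h1
  intro h h1
  obtain ⟨k, hk⟩ := hH h
  exact key k h hk h1

/-- The `p`-torsion subgroups are `𝔽_p`-vector spaces of the same finite size. An isomorphism
between them extends to `D → E` because `E` is divisible; the extension is injective as it is so on
torsion, and onto since its image is divisible and contains the torsion of `E`. -/
theorem IsPTorus.nonempty_mulEquiv [Fact p.Prime] {D E : Type*} [Group D] [Group E] (hD : IsPTorus p D)
    (hE : IsPTorus p E) (h : Nat.card {a : D | a ^ p = 1} = Nat.card {a : E | a ^ p = 1}) :
    Nonempty (D ≃* E) := by
  let : CommGroup D := { (inferInstance : Group D) with mul_comm := hD.comm }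
  let : CommGroup E := { (inferInstance : Group E) with mul_comm := hE.comm }
  let A := (powMonoidHom p : D →* D).ker
  let B := (powMonoidHom p : E →* E).ker
  have : Finite A := hD.finite_torsion
  have : Finite B := hE.finite_torsion
  obtain ⟨e⟩ : Nonempty (A ≃* B) := nonempty_mulEquiv_of_pow_eq_one (p := p)
    (fun a => Subtype.ext a.2) (fun a => Subtype.ext a.2) h
  obtain ⟨g, hg⟩ := exists_extension_of_divisible hE.isPGroup hE.divisible A.subtype
    A.subtype_injective (B.subtype.comp e.toMonoidHom)
  have hg' : ∀ a : A, g a = e a := fun a => DFunLike.congr_fun hg a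
  refine ⟨MulEquiv.ofBijective g ⟨?_, ?_⟩⟩
  · refine injective_of_injOn_torsion hD.isPGroup g fun a ha h1 => ?_
    have h2 := hg' ⟨a, ha⟩
    rw [h1] at h2
    have h3 : e ⟨a, ha⟩ = 1 := Subtype.ext h2.symm
    rw [map_eq_one_iff _ e.injective] at h3
    exact congrArg Subtype.val h3
  · refine surjective_of_torsion_le_range hE.comm hE.isPGroup hD.divisible g fun b hb => ?_
    refine ⟨e.symm ⟨b, hb⟩, ?_⟩
    rw [hg', e.apply_symm_apply]

theorem IsPTorus.of_mulEquiv {D E : Type*} [Group D] [Group E] (hE : IsPTorus p E) (e : D ≃* E) :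
    IsPTorus p D where
  comm a b := e.injective (by rw [map_mul, map_mul, hE.comm])
  isPGroup := hE.isPGroup.of_injective e.toMonoidHom e.injective
  divisible a := by
    obtain ⟨b, hb⟩ := hE.divisible (e a)
    exact ⟨e.symm b, e.injective (by rw [map_pow, e.apply_symm_apply, hb])⟩
  finite_torsion := by
    refine (hE.finite_torsion.preimage (f := e) e.injective.injOn).subset fun a ha => ?_
    change e a ^ p = 1
    rw [← map_pow, show a ^ p = 1 from ha, map_one]

theorem isPGroup_pruferGroup : IsPGroup p (PruferGroup p) := by
  rintro ⟨a, n, hn⟩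
  exact ⟨n, Subtype.ext hn⟩

theorem natCard_torsion_pruferGroup [Fact p.Prime] : Nat.card {a : PruferGroup p | a ^ p = 1} = p := by
  have hc := HasEnoughRootsOfUnity.natCard_rootsOfUnity Circle p
  refine Eq.trans (Nat.card_congr ?_) hc
  refine
    { toFun := fun a => ⟨Units.mk (a : PruferGroup p) (a : PruferGroup p)⁻¹ (by simp) (by simp), ?_⟩
      invFun := fun u => ⟨⟨((u : Circleˣ) : Circle), ?_⟩, ?_⟩
      left_inv := fun a => rfl
      right_inv := fun u => by ext; rfl }
  · rw [mem_rootsOfUnity']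
    exact congrArg Subtype.val a.2
  · have := (mem_rootsOfUnity' _ _).1 u.2
    exact ⟨1, by simpa using this⟩
  · exact Subtype.ext ((mem_rootsOfUnity' _ _).1 u.2)

theorem exists_pow_eq_pruferGroup [Fact p.Prime] (a : PruferGroup p) : ∃ b, b ^ p = a := by
  obtain ⟨n, hn⟩ := isPGroup_pruferGroup a
  obtain ⟨t, ht⟩ := Circle.exp_surjective (a : Circle)
  have hp : (p : ℝ) ≠ 0 := Nat.cast_ne_zero.2 (Fact.out : p.Prime).ne_zero
  have h1 : Circle.exp (t / p) ^ p = a := by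
    rw [← ht, ← Circle.exp_natCast_mul]
    congr 1
    field_simp
  refine ⟨⟨Circle.exp (t / p), n + 1, ?_⟩, Subtype.ext h1⟩
  rw [pow_succ', pow_mul, h1]
  exact congrArg Subtype.val hn

theorem natCard_torsion_pi_pruferGroup [Fact p.Prime] (r : ℕ) :
    Nat.card {a : Fin r → PruferGroup p | a ^ p = 1} = p ^ r := by
  have e : {a : Fin r → PruferGroup p | a ^ p = 1} ≃ (Fin r → {a : PruferGroup p | a ^ p = 1}) :=
    { toFun := fun a i => ⟨a.1 i, congrFun a.2 i⟩
      invFun := fun a => ⟨fun i => a i, funext fun i => (a i).2⟩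
      left_inv := fun a => rfl
      right_inv := fun a => rfl }
  rw [Nat.card_congr e, Nat.card_pi]
  simp only [natCard_torsion_pruferGroup, Finset.prod_const, Finset.card_univ, Fintype.card_fin]

theorem isPTorus_pi_pruferGroup [Fact p.Prime] (r : ℕ) : IsPTorus p (Fin r → PruferGroup p) where
  comm := mul_comm
  isPGroup a := by
    choose n hn using fun i => isPGroup_pruferGroup (a i)
    refine ⟨∑ i, n i, funext fun i => ?_⟩
    obtain ⟨c, hc⟩ := pow_dvd_pow p (Finset.single_le_sum (f := n) (fun _ _ => Nat.zero_le _)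
      (Finset.mem_univ i))
    rw [Pi.pow_apply, hc, pow_mul, hn, one_pow]
    rfl
  divisible a := by
    choose b hb using fun i => exists_pow_eq_pruferGroup (a i)
    exact ⟨b, funext hb⟩
  finite_torsion := by
    refine Set.finite_coe_iff.1 (Nat.finite_of_card_ne_zero ?_)
    rw [natCard_torsion_pi_pruferGroup]
    exact pow_ne_zero _ (Fact.out : p.Prime).ne_zero

theorem IsPTorus.exists_natCard_torsion [Fact p.Prime] {D : Type*} [Group D] (hD : IsPTorus p D) :
    ∃ r, Nat.card {a : D | a ^ p = 1} = p ^ r := by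
  let : CommGroup D := { (inferInstance : Group D) with mul_comm := hD.comm }
  let A := (powMonoidHom p : D →* D).ker
  have : Finite A := hD.finite_torsion
  exact (IsPGroup.iff_card (p := p) (G := A)).1 (hD.isPGroup.to_subgroup A)

theorem natCard_torsion_of_mulEquiv {D E : Type*} [Group D] [Group E] (e : D ≃* E) :
    Nat.card {a : D | a ^ p = 1} = Nat.card {a : E | a ^ p = 1} := by
  refine Nat.card_congr (e.toEquiv.subtypeEquiv fun a => ?_)
  change a ^ p = 1 ↔ e a ^ p = 1
  rw [← map_pow, map_eq_one_iff _ e.injective]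

theorem IsPTorus.natCard_torsion_eq_iff [Fact p.Prime] {D : Type*} [Group D] (hD : IsPTorus p D) (r : ℕ) :
    Nonempty (D ≃* (Fin r → PruferGroup p)) ↔ Nat.card {a : D | a ^ p = 1} = p ^ r := by
  refine ⟨fun ⟨e⟩ => ?_, fun h => hD.nonempty_mulEquiv (isPTorus_pi_pruferGroup r) ?_⟩
  · rw [natCard_torsion_of_mulEquiv e, natCard_torsion_pi_pruferGroup]
  · rw [h, natCard_torsion_pi_pruferGroup]

end Classification

/-! ### Identity components, ranks and orders of discrete `p`-toral groups -/

section Toral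

variable {p : ℕ}

/-- The intrinsic form of `IsDiscretePToral`: a `p`-group whose identity component is a `p`-torus
of finite index. -/
structure IsPToral (p : ℕ) (G : Type*) [Group G] : Prop where
  isPGroup : IsPGroup p G
  finiteIndex : (identityComponent G).FiniteIndex
  isPTorus : IsPTorus p (identityComponent G)

/-- The normal core of `K` has index `p ^ k` for some `k`, so it contains every `p ^ k`-th power,
hence every element of a `p`-divisible subgroup. -/
theorem le_of_divisible_of_finiteIndex [Fact p.Prime] {G : Type*} [Group G] (hG : IsPGroup p G)
    {D : Subgroup G} (hD : ∀ a ∈ D, ∃ b ∈ D, b ^ p = a) (K : Subgroup G) [K.FiniteIndex] :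
    D ≤ K := by
  intro d hd
  have hfi : (K.normalCore).FiniteIndex := inferInstance
  obtain ⟨k, hk⟩ := hG.index K.normalCore
  obtain ⟨b, hb⟩ := exists_pow_prime_pow_eq (D := D) (p := p)
    (fun a => let ⟨b, hb, h⟩ := hD a a.2; ⟨⟨b, hb⟩, Subtype.ext h⟩) k ⟨d, hd⟩
  have h1 : (b : G) ^ p ^ k = d := congrArg Subtype.val hb
  refine K.normalCore_le ?_
  rw [← h1, ← hk]
  exact Subgroup.pow_index_mem _ _

theorem identityComponent_eq [Fact p.Prime] {G : Type*} [Group G] (hG : IsPGroup p G)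
    {D : Subgroup G} (hfi : D.FiniteIndex) (hD : ∀ a ∈ D, ∃ b ∈ D, b ^ p = a) :
    identityComponent G = D := by
  refine le_antisymm (sInf_le hfi) (le_sInf fun K hK => ?_)
  have : K.FiniteIndex := hK
  exact le_of_divisible_of_finiteIndex hG hD K

theorem identityComponent_le {G : Type*} [Group G] (K : Subgroup G) [h : K.FiniteIndex] :
    identityComponent G ≤ K :=
  sInf_le h

theorem finiteIndex_comap {H G : Type*} [Group H] [Group G] (f : H →* G) (K : Subgroup G)
    [h : K.FiniteIndex] : (K.comap f).FiniteIndex := ⟨by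
  rw [Subgroup.index_comap]
  refine fun h0 => h.index_ne_zero ?_
  rw [← Subgroup.relIndex_top_right]
  exact Subgroup.relIndex_eq_zero_of_le_right le_top h0⟩

theorem map_identityComponent_le {H G : Type*} [Group H] [Group G] (f : H →* G) :
    (identityComponent H).map f ≤ identityComponent G := by
  rw [Subgroup.map_le_iff_le_comap]
  intro h hh
  rw [Subgroup.mem_comap, identityComponent, Subgroup.mem_sInf]
  intro K hK
  have : K.FiniteIndex := hK
  have := finiteIndex_comap f K
  exact identityComponent_le (K.comap f) hh

theorem identityComponent_normal (G : Type*) [Group G] : (identityComponent G).Normal := by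
  refine ⟨fun a ha g => ?_⟩
  exact map_identityComponent_le (MulAut.conj g).toMonoidHom ⟨a, ha, rfl⟩

theorem IsPToral.of_isDiscretePToral [Fact p.Prime] {G : Type*} [Group G]
    (hG : IsDiscretePToral p G) : IsPToral p G := by
  obtain ⟨T, hT, r, ⟨e⟩, hfin, hp⟩ := hG
  have hfi : T.FiniteIndex := Subgroup.finiteIndex_of_finite_quotient
  have hTt : IsPTorus p T := (isPTorus_pi_pruferGroup r).of_mulEquiv e
  have hGp : IsPGroup p G := by
    intro g
    obtain ⟨k, hk⟩ := hp (g : G ⧸ T)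
    have h1 : g ^ p ^ k ∈ T := by
      rw [← QuotientGroup.eq_one_iff, QuotientGroup.mk_pow, hk]
    obtain ⟨l, hl⟩ := hTt.isPGroup ⟨_, h1⟩
    exact ⟨k + l, by rw [pow_add, pow_mul]; exact congrArg Subtype.val hl⟩
  have h0 : identityComponent G = T := identityComponent_eq hGp hfi fun a ha => by
    obtain ⟨b, hb⟩ := hTt.divisible ⟨a, ha⟩
    exact ⟨b, b.2, congrArg Subtype.val hb⟩
  exact ⟨hGp, h0 ▸ hfi, h0 ▸ hTt⟩

/-- Each fibre of `a ↦ a ^ p` is empty or a coset of the finite `p`-torsion. -/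
theorem finite_ker_powMonoidHom {A : Type*} [CommGroup A] (hfin : {a : A | a ^ p = 1}.Finite)
    (n : ℕ) : {a : A | a ^ p ^ n = 1}.Finite := by
  induction n with
  | zero => simp
  | succ n ih =>
    refine (ih.preimage' (f := fun a : A => a ^ p) fun b _ => ?_).subset fun a ha => ?_
    · by_cases hb : ∃ c : A, c ^ p = b
      · obtain ⟨c, rfl⟩ := hb
        refine (hfin.image fun a => a * c).subset fun a ha => ?_
        refine ⟨a * c⁻¹, ?_, by simp⟩
        have ha' : a ^ p = c ^ p := ha
        change (a * c⁻¹) ^ p = 1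
        rw [mul_pow, ha', inv_pow, mul_inv_cancel]
      · exact Set.finite_empty.subset fun a ha => (hb ⟨a, ha⟩).elim
    · change (a ^ p) ^ p ^ n = 1
      rw [← pow_mul, ← pow_succ']
      exact ha

/-- The subgroups of `p ^ n`-th powers decrease, and their intersections with the finite `p`-torsion
stabilize at some `n`. From there on the subgroup is divisible, and it has finite index because its
cosets are represented by the finitely many solutions of `a ^ p ^ n = 1`. -/
theorem exists_divisible_finiteIndex {A : Type*} [CommGroup A] (hA : IsPGroup p A)
    (hfin : {a : A | a ^ p = 1}.Finite) :
    ∃ D : Subgroup A, D.FiniteIndex ∧ ∀ a ∈ D, ∃ b ∈ D, b ^ p = a := by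
  let R : ℕ → Subgroup A := fun n => (powMonoidHom (p ^ n) : A →* A).range
  have hR : Antitone R := antitone_nat_of_succ_le fun n => by
    rintro _ ⟨a, rfl⟩
    exact ⟨a ^ p, by simp [← pow_mul, ← pow_succ']⟩
  let W : Subgroup A := (powMonoidHom p : A →* A).ker
  have : Finite W := hfin
  have : Finite (Subgroup W) := inferInstance
  obtain ⟨n, hn⟩ : ∃ n, ∀ m, n ≤ m → (R m).subgroupOf W = (R n).subgroupOf W := by
    obtain ⟨n, hn⟩ := WellFoundedGT.monotone_chain_condition
      (α := (Subgroup W)ᵒᵈ) ⟨fun m => OrderDual.toDual ((R m).subgroupOf W),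
        fun a b hab => OrderDual.toDual_le_toDual.2 (Subgroup.comap_mono (hR hab))⟩
    exact ⟨n, fun m hm => (OrderDual.toDual.injective (hn m hm)).symm⟩
  have hdiv : ∀ a ∈ R n, ∃ b ∈ R n, b ^ p = a := by
    have key : ∀ (k : ℕ) (a : A), a ^ p ^ k = 1 → a ∈ R n → ∃ b ∈ R n, b ^ p = a := by
      intro k
      induction k with
      | zero => intro a ha _; exact ⟨1, one_mem _, by simpa using ha.symm⟩
      | succ k ih =>
        intro a ha haR
        have h1 : a ^ p ^ k ∈ W := by
          change (a ^ p ^ k) ^ p = 1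
          rw [← pow_mul, ← pow_succ, ha]
        have h2 : (⟨_, h1⟩ : W) ∈ (R n).subgroupOf W := pow_mem haR _
        -- Stability makes the torsion element `a ^ p ^ k` a power of much higher exponent. Dividing
        -- `a` by the `p`-th power of `c ^ p ^ n` then lowers its order, and induction applies.
        rw [← hn (n + (k + 1)) (Nat.le_add_right _ _)] at h2
        obtain ⟨c, hc⟩ := h2
        have hc' : c ^ p ^ (n + (k + 1)) = a ^ p ^ k := hc
        have hd : c ^ p ^ n ∈ R n := ⟨c, rfl⟩
        obtain ⟨b, hb, hb'⟩ := ih (a * ((c ^ p ^ n) ^ p)⁻¹) (by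
            rw [mul_pow, inv_pow, ← hc', ← pow_mul, ← pow_mul, ← pow_succ', ← pow_add,
              mul_inv_cancel]) (mul_mem haR (inv_mem (pow_mem hd _)))
        exact ⟨b * c ^ p ^ n, mul_mem hb hd, by rw [mul_pow, hb', inv_mul_cancel_right]⟩
    intro a ha
    obtain ⟨k, hk⟩ := hA a
    exact key k a hk ha
  refine ⟨R n, ?_, hdiv⟩
  have hker : Finite {a : A | a ^ p ^ n = 1} := finite_ker_powMonoidHom hfin n
  have hs : Function.Surjective fun a : {a : A | a ^ p ^ n = 1} => (a.1 : A ⧸ R n) := by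
    intro q
    obtain ⟨a, rfl⟩ := QuotientGroup.mk_surjective q
    obtain ⟨b, hb⟩ := exists_pow_prime_pow_eq (D := R n) (p := p)
      (fun a => let ⟨b, hb, h⟩ := hdiv a a.2; ⟨⟨b, hb⟩, Subtype.ext h⟩) n ⟨a ^ p ^ n, ⟨a, rfl⟩⟩
    have hb' : (b : A) ^ p ^ n = a ^ p ^ n := congrArg Subtype.val hb
    refine ⟨⟨a * (b : A)⁻¹, ?_⟩, ?_⟩
    · change (a * (b : A)⁻¹) ^ p ^ n = 1
      rw [mul_pow, inv_pow, hb', mul_inv_cancel]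
    · refine QuotientGroup.eq.2 ?_
      simp
  have : Finite (A ⧸ R n) := Finite.of_surjective _ hs
  exact Subgroup.finiteIndex_of_finite_quotient

/-- The preimage of the identity component is abelian with finite `p`-torsion and has finite index.
Its divisible subgroup of finite index is the identity component of `H`. -/
theorem IsPToral.of_injective [Fact p.Prime] {H G : Type*} [Group H] [Group G]
    (hG : IsPToral p G) {f : H →* G} (hf : Function.Injective f) : IsPToral p H := by
  have hH : IsPGroup p H := hG.isPGroup.of_injective f hf
  have := hG.finiteIndex
  let A : Subgroup H := (identityComponent G).comap f
  have hAc : ∀ a b : A, a * b = b * a := fun a b => Subtype.ext (hf (by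
    have := congrArg Subtype.val (hG.isPTorus.comm ⟨f a, a.2⟩ ⟨f b, b.2⟩)
    simpa using this))
  let : CommGroup A := { (inferInstance : Group A) with mul_comm := hAc }
  have hAt : {a : A | a ^ p = 1}.Finite := by
    refine (hG.isPTorus.finite_torsion.preimage
      (f := fun a : A => (⟨f a, a.2⟩ : identityComponent G)) fun a _ b _ hab => ?_).subset
        fun a ha => ?_
    · exact Subtype.ext (hf (Subtype.mk.inj hab))
    · refine Subtype.ext ?_
      change f a ^ p = 1
      rw [← map_pow, ← Subgroup.coe_pow, show a ^ p = 1 from ha]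
      simp
  obtain ⟨D, hDfi, hD⟩ := exists_divisible_finiteIndex (hH.to_subgroup A) hAt
  have hfi : (D.map A.subtype).FiniteIndex := ⟨by
    rw [Subgroup.index_map_subtype]
    have : A.FiniteIndex := finiteIndex_comap f _
    exact mul_ne_zero hDfi.index_ne_zero Subgroup.FiniteIndex.index_ne_zero⟩
  have hdiv : ∀ a ∈ D.map A.subtype, ∃ b ∈ D.map A.subtype, b ^ p = a := by
    rintro _ ⟨a, ha, rfl⟩
    obtain ⟨b, hb, rfl⟩ := hD a ha
    exact ⟨b, ⟨b, hb, rfl⟩, rfl⟩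
  have h0 := identityComponent_eq hH hfi hdiv
  refine ⟨hH, h0 ▸ hfi, ?_⟩
  rw [h0]
  refine IsPTorus.of_mulEquiv (E := D) ?_ (D.equivMapOfInjective _ A.subtype_injective).symm
  refine ⟨mul_comm, (hH.to_subgroup A).to_subgroup D, fun a => ?_, ?_⟩
  · obtain ⟨b, hb, h⟩ := hD a a.2
    exact ⟨⟨b, hb⟩, Subtype.ext h⟩
  · exact (hAt.preimage D.subtype_injective.injOn).subset fun a ha => congrArg Subtype.val ha

theorem IsPToral.subgroup [Fact p.Prime] {G : Type*} [Group G] (hG : IsPToral p G)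
    (H : Subgroup G) : IsPToral p H :=
  hG.of_injective H.subtype_injective

theorem IsPToral.pow_toralRank [Fact p.Prime] {G : Type*} [Group G] (hG : IsPToral p G) :
    p ^ toralRank p G = Nat.card {a : identityComponent G | a ^ p = 1} := by
  obtain ⟨r, hr⟩ := hG.isPTorus.exists_natCard_torsion
  have hne : {r : ℕ | Nonempty (identityComponent G ≃* (Fin r → PruferGroup p))}.Nonempty :=
    ⟨r, (hG.isPTorus.natCard_torsion_eq_iff r).2 hr⟩
  exact ((hG.isPTorus.natCard_torsion_eq_iff _).1 (Nat.sInf_mem hne)).symm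

/-- The restriction of a homomorphism to identity components. -/
def identityComponentMap {H G : Type*} [Group H] [Group G] (f : H →* G) :
    identityComponent H →* identityComponent G :=
  (f.comp (identityComponent H).subtype).codRestrict _
    fun a => map_identityComponent_le f ⟨a, a.2, rfl⟩

theorem identityComponentMap_injective {H G : Type*} [Group H] [Group G] {f : H →* G}
    (hf : Function.Injective f) : Function.Injective (identityComponentMap f) := fun _ _ hab =>
  Subtype.ext (hf (congrArg Subtype.val hab))

theorem IsPToral.toralRank_le [Fact p.Prime] {H G : Type*} [Group H] [Group G]
    (hG : IsPToral p G) {f : H →* G} (hf : Function.Injective f) :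
    toralRank p H ≤ toralRank p G := by
  have hH := hG.of_injective hf
  have : Finite {a : identityComponent G | a ^ p = 1} := hG.isPTorus.finite_torsion
  rw [← Nat.pow_le_pow_iff_right (Fact.out : p.Prime).one_lt, hH.pow_toralRank, hG.pow_toralRank]
  refine Nat.card_le_card_of_injective
    (fun a => ⟨identityComponentMap f a, ?_⟩) fun a b hab => ?_
  · change identityComponentMap f a ^ p = 1
    rw [← map_pow, show (a : identityComponent H) ^ p = 1 from a.2, map_one]
  · exact Subtype.ext (identityComponentMap_injective hf (Subtype.mk.inj hab))

/-- Equal ranks mean equally many `p`-torsion elements, so the injection of torsion subgroups is a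
bijection, and divisibility does the rest. -/
theorem IsPToral.map_identityComponent_eq [Fact p.Prime] {H G : Type*} [Group H] [Group G]
    (hG : IsPToral p G) {f : H →* G} (hf : Function.Injective f)
    (hr : toralRank p G ≤ toralRank p H) :
    (identityComponent H).map f = identityComponent G := by
  have hH := hG.of_injective hf
  have : Finite {a : identityComponent G | a ^ p = 1} := hG.isPTorus.finite_torsion
  let u : {a : identityComponent H | a ^ p = 1} → {a : identityComponent G | a ^ p = 1} :=
    fun a => ⟨identityComponentMap f a, by
      change identityComponentMap f a ^ p = 1
      rw [← map_pow, show (a : identityComponent H) ^ p = 1 from a.2, map_one]⟩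
  have hu : Function.Injective u := fun a b hab =>
    Subtype.ext (identityComponentMap_injective hf (Subtype.mk.inj hab))
  have hcard := le_antisymm (hG.toralRank_le hf) hr
  have hu' : Function.Surjective u := ((Nat.bijective_iff_injective_and_card u).2
    ⟨hu, by rw [← hH.pow_toralRank, ← hG.pow_toralRank, hcard]⟩).2
  have hs : Function.Surjective (identityComponentMap f) :=
    surjective_of_torsion_le_range hG.isPTorus.comm hG.isPTorus.isPGroup hH.isPTorus.divisible _
      fun g hg => by
        obtain ⟨a, ha⟩ := hu' ⟨g, hg⟩
        exact ⟨a, congrArg Subtype.val ha⟩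
  refine le_antisymm (map_identityComponent_le f) fun g hg => ?_
  obtain ⟨a, ha⟩ := hs ⟨g, hg⟩
  exact ⟨a, a.2, congrArg Subtype.val ha⟩

theorem index_identityComponent_mul {H G : Type*} [Group H] [Group G] {f : H →* G}
    (hf : Function.Injective f) (h : (identityComponent H).map f = identityComponent G) :
    (identityComponent H).index * f.range.index = (identityComponent G).index := by
  rw [← h, Subgroup.index_map_of_injective _ hf]

theorem toralOrder_le_iff {H G : Type*} [Group H] [Group G] :
    toralOrder p H ≤ toralOrder p G ↔ toralRank p H < toralRank p G ∨
      toralRank p H = toralRank p G ∧ (identityComponent H).index ≤ (identityComponent G).index :=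
  Prod.Lex.toLex_le_toLex

theorem IsPToral.toralOrder_le [Fact p.Prime] {H G : Type*} [Group H] [Group G]
    (hG : IsPToral p G) {f : H →* G} (hf : Function.Injective f) :
    toralOrder p H ≤ toralOrder p G := by
  rw [toralOrder_le_iff]
  rcases (hG.toralRank_le hf).lt_or_eq with h | h
  · exact Or.inl h
  · refine Or.inr ⟨h, ?_⟩
    have h1 := index_identityComponent_mul hf (hG.map_identityComponent_eq hf h.ge)
    have := hG.finiteIndex
    exact Nat.le_of_dvd (Nat.pos_of_ne_zero Subgroup.FiniteIndex.index_ne_zero) ⟨_, h1.symm⟩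

/-- The ranks must agree, so the identity components correspond. The index of the image is then the
ratio of the two numbers of components, which is at most 1. -/
theorem IsPToral.surjective_of_toralOrder_le [Fact p.Prime] {H G : Type*} [Group H] [Group G]
    (hG : IsPToral p G) {f : H →* G} (hf : Function.Injective f)
    (h : toralOrder p G ≤ toralOrder p H) : Function.Surjective f := by
  rw [toralOrder_le_iff] at h
  have hr := hG.toralRank_le hf
  obtain ⟨h2, h3⟩ := h.resolve_left hr.not_gt
  have h1 := index_identityComponent_mul hf (hG.map_identityComponent_eq hf h2.le)
  have := hG.finiteIndex
  have hpos : 0 < (identityComponent G).index :=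
    Nat.pos_of_ne_zero Subgroup.FiniteIndex.index_ne_zero
  rw [← MonoidHom.range_eq_top, ← Subgroup.index_eq_one]
  have h4 : f.range.index ≠ 0 := fun h0 => by rw [h0, mul_zero] at h1; omega
  have h5 : (identityComponent H).index ≠ 0 := fun h0 => by rw [h0, zero_mul] at h1; omega
  by_contra h6
  have h7 : 2 ≤ f.range.index := by omega
  nlinarith [Nat.pos_of_ne_zero h5]

end Toral

/-! ### Fixed points of `p`-groups and Sylow-type arguments for infinite groups -/

section Actions

variable {p : ℕ}

/-- `L` acts through `u` on the cosets of `A` in `B`. Their number is prime to `p`, so some orbit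
has size prime to `p`, and the stabilizer of `γA` is the preimage of `γAγ⁻¹`. -/
theorem exists_conj_not_dvd_index {L G : Type*} [Group L] [Group G] (u : L →* G)
    {A B : Subgroup G} (hu : u.range ≤ B) (h : ¬ p ∣ A.relIndex B) :
    ∃ γ ∈ B, ¬ p ∣ ((A.comap (MulAut.conj γ⁻¹).toMonoidHom).comap u).index := by
  let u' : L →* B := u.codRestrict B fun l => hu ⟨l, rfl⟩
  let : MulAction L (B ⧸ A.subgroupOf B) := MulAction.compHom _ u'
  -- An infinite index is recorded as 0, which `p` divides, so the hypothesis includes finiteness.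
  have hfin : Finite (B ⧸ A.subgroupOf B) :=
    Nat.finite_of_card_ne_zero fun h0 => h (by
      rw [Subgroup.relIndex, Subgroup.index, h0]; exact dvd_zero p)
  by_contra! hcon
  refine h ?_
  have : Fintype (MulAction.orbitRel.Quotient L (B ⧸ A.subgroupOf B)) := Fintype.ofFinite _
  rw [Subgroup.relIndex, Subgroup.index,
    Nat.card_congr (MulAction.selfEquivSigmaOrbits L (B ⧸ A.subgroupOf B)), Nat.card_sigma]
  refine Finset.dvd_sum fun ω _ => ?_
  obtain ⟨γ, hγ⟩ := QuotientGroup.mk_surjective (Quotient.out ω)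
  rw [← hγ]
  have h1 := hcon γ γ.2
  have h2 : (A.comap (MulAut.conj (γ : G)⁻¹).toMonoidHom).comap u =
      MulAction.stabilizer L (γ : B ⧸ A.subgroupOf B) := by
    ext l
    have h3 : l • (γ : B ⧸ A.subgroupOf B) = ((u' l * γ : B) : B ⧸ A.subgroupOf B) := rfl
    rw [MulAction.mem_stabilizer_iff, h3, eq_comm, QuotientGroup.eq, Subgroup.mem_subgroupOf]
    simp [u', mul_assoc]
  rw [h2, MulAction.index_stabilizer, ← Nat.card_coe_set_eq] at h1
  exact h1

/-- The `p`-group `H` has a fixed point on a set of size prime to `p`, here the cosets of `A` in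
`B`. -/
theorem exists_conj_le_of_isPGroup [Fact p.Prime] {G : Type*} [Group G] {A B H : Subgroup G}
    (hH : IsPGroup p H) (hHB : H ≤ B) (h : ¬ p ∣ A.relIndex B) :
    ∃ γ ∈ B, ∀ g ∈ H, γ⁻¹ * g * γ ∈ A := by
  let : MulAction H (B ⧸ A.subgroupOf B) := MulAction.compHom _ (Subgroup.inclusion hHB)
  obtain ⟨q, hq⟩ := hH.nonempty_fixed_point_of_prime_not_dvd_card (B ⧸ A.subgroupOf B) h
  obtain ⟨γ, rfl⟩ := QuotientGroup.mk_surjective q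
  refine ⟨γ, γ.2, fun g hg => ?_⟩
  have h1 : ((Subgroup.inclusion hHB ⟨g, hg⟩ * γ : B) : B ⧸ A.subgroupOf B) = γ := hq ⟨g, hg⟩
  rw [eq_comm, QuotientGroup.eq, Subgroup.mem_subgroupOf] at h1
  simpa [mul_assoc] using h1

theorem exists_ne_one_mem_center [Fact p.Prime] {G : Type*} [Group G] (hG : IsPGroup p G)
    (W : Subgroup G) [W.Normal] [Finite W] (hW : W ≠ ⊥) :
    ∃ x ∈ Subgroup.center G, x ≠ 1 := by
  have hpW : p ∣ Nat.card W := by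
    have := (Subgroup.nontrivial_iff_ne_bot W).2 hW
    obtain ⟨n, hn, h⟩ := (hG.to_subgroup W).nontrivial_iff_card.1 this
    rw [h]
    exact dvd_pow_self p hn.ne'
  let : MulAction G W := MulAction.compHom W (MulAut.conjNormal (H := W))
  obtain ⟨b, hb, hb1⟩ := hG.exists_fixed_point_of_prime_dvd_card_of_fixed_point W hpW (a := 1)
    (fun g => map_one (MulAut.conjNormal (H := W) g))
  refine ⟨b, Subgroup.mem_center_iff.2 fun g => ?_, fun h => hb1 (Subtype.ext h.symm)⟩
  have := congrArg Subtype.val (hb g)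
  change ((MulAut.conjNormal (H := W) g b : W) : G) = b at this
  rw [MulAut.conjNormal_apply] at this
  rw [← mul_inv_eq_iff_eq_mul]
  exact this

/-- The elements of order dividing `p` in the center. -/
def centerTorsion (p : ℕ) (G : Type*) [Group G] : Subgroup G where
  carrier := {g | g ∈ Subgroup.center G ∧ g ^ p = 1}
  one_mem' := ⟨one_mem _, one_pow _⟩
  mul_mem' := fun {a b} ha hb => ⟨mul_mem ha.1 hb.1, by
    rw [(show Commute a b from (Subgroup.mem_center_iff.1 hb.1 a)).mul_pow, ha.2, hb.2, one_mul]⟩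
  inv_mem' := fun ha => ⟨inv_mem ha.1, by rw [inv_pow, ha.2, inv_one]⟩

/-- The identity component of a group of exponent dividing `p` is both divisible and killed by `p`,
hence trivial; and it has finite index. -/
theorem IsPToral.finite_centerTorsion [Fact p.Prime] {G : Type*} [Group G] (hG : IsPToral p G) :
    Finite (centerTorsion p G) := by
  have h := hG.subgroup (centerTorsion p G)
  have hb : identityComponent (centerTorsion p G) = ⊥ := by
    rw [eq_bot_iff]
    intro a ha
    obtain ⟨b, hb⟩ := h.isPTorus.divisible ⟨a, ha⟩
    have h1 : (b : centerTorsion p G) ^ p = a := congrArg Subtype.val hb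
    rw [Subgroup.mem_bot, ← h1]
    exact Subtype.ext (b : centerTorsion p G).2.2
  have h1 := h.finiteIndex.index_ne_zero
  rw [hb, Subgroup.index_bot] at h1
  exact Nat.finite_of_card_ne_zero h1

theorem IsPGroup.exists_pow_ne_one_pow_eq_one {G : Type*} [Group G] (hG : IsPGroup p G) {g : G}
    (hg : g ≠ 1) : ∃ k : ℕ, g ^ k ≠ 1 ∧ (g ^ k) ^ p = 1 := by
  have h := hG g
  classical
  refine ⟨p ^ (Nat.find h - 1), fun h0 => ?_, ?_⟩
  · have hpos : Nat.find h ≠ 0 := fun h1 => by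
      have := Nat.find_spec h
      rw [h1] at this
      exact hg (by simpa using this)
    exact Nat.find_min h (by omega) h0
  · have hpos : Nat.find h ≠ 0 := fun h1 => by
      have := Nat.find_spec h
      rw [h1] at this
      exact hg (by simpa using this)
    rw [← pow_mul, ← pow_succ, Nat.sub_add_cancel (Nat.pos_of_ne_zero hpos)]
    exact Nat.find_spec h

/-- A `p`-group meets its center nontrivially in any finite nontrivial normal subgroup. Such a
subgroup is the `p`-torsion of the identity component, or the whole group if that component is
trivial. -/
theorem IsPToral.centerTorsion_ne_bot [Fact p.Prime] {G : Type*} [Group G] (hG : IsPToral p G)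
    [Nontrivial G] : centerTorsion p G ≠ ⊥ := by
  obtain ⟨x, hx, hx1⟩ : ∃ x ∈ Subgroup.center G, x ≠ 1 := by
    have hnorm := identityComponent_normal G
    by_cases h0 : identityComponent G = ⊥
    · have h1 := hG.finiteIndex.index_ne_zero
      rw [h0, Subgroup.index_bot] at h1
      have : Finite G := Nat.finite_of_card_ne_zero h1
      exact exists_ne_one_mem_center hG.isPGroup ⊤ bot_ne_top.symm
    · let W : Subgroup G :=
        { carrier := {g | g ∈ identityComponent G ∧ g ^ p = 1}
          one_mem' := ⟨one_mem _, one_pow _⟩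
          mul_mem' := fun {a b} ha hb => ⟨mul_mem ha.1 hb.1, by
            rw [(show Commute a b from congrArg Subtype.val
              (hG.isPTorus.comm ⟨a, ha.1⟩ ⟨b, hb.1⟩)).mul_pow, ha.2, hb.2, one_mul]⟩
          inv_mem' := fun ha => ⟨inv_mem ha.1, by rw [inv_pow, ha.2, inv_one]⟩ }
      have hWn : W.Normal := ⟨fun a ha g => ⟨hnorm.conj_mem a ha.1 g, by
        rw [conj_pow, ha.2, mul_one, mul_inv_cancel]⟩⟩
      have hWf : Finite W := by
        have : Finite {a : identityComponent G | a ^ p = 1} := hG.isPTorus.finite_torsion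
        refine Finite.of_injective (β := {a : identityComponent G | a ^ p = 1})
          (fun a => ⟨⟨a, a.2.1⟩, Subtype.ext a.2.2⟩) fun a b hab => ?_
        exact Subtype.ext (congrArg (fun z => ((z.1 : identityComponent G) : G)) hab)
      refine exists_ne_one_mem_center hG.isPGroup W fun hW => h0 ?_
      rw [eq_bot_iff]
      intro a ha
      by_contra ha1
      obtain ⟨k, hk, hk'⟩ := hG.isPGroup.exists_pow_ne_one_pow_eq_one ha1
      have : a ^ k ∈ W := ⟨pow_mem ha k, hk'⟩
      rw [hW] at this
      exact hk this
  obtain ⟨k, hk, hk'⟩ := hG.isPGroup.exists_pow_ne_one_pow_eq_one hx1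
  intro hb
  have : x ^ k ∈ centerTorsion p G := ⟨pow_mem hx k, hk'⟩
  rw [hb] at this
  exact hk this

theorem mulAut_mem_centerTorsion {G : Type*} [Group G] (α : MulAut G) {g : G}
    (hg : g ∈ centerTorsion p G) : α g ∈ centerTorsion p G := by
  refine ⟨Subgroup.mem_center_iff.2 fun h => ?_, by rw [← map_pow, hg.2, map_one]⟩
  obtain ⟨k, rfl⟩ := α.surjective h
  rw [← map_mul, ← map_mul, Subgroup.mem_center_iff.1 hg.1]

/-- For a group `B` of automorphisms of a nontrivial group `G`, and a `p`-subgroup `A` of `B`, there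
is a central element of order `p` fixed by `A` whose stabilizer in `B` has index prime to `p`. -/
theorem IsPToral.exists_fixed_orderOf_eq [Fact p.Prime] {G : Type*} [Group G] (hG : IsPToral p G)
    [Nontrivial G] {A B : Subgroup (MulAut G)} (hA : IsPGroup p A) (hAB : A ≤ B) :
    ∃ x ∈ Subgroup.center G, orderOf x = p ∧ (∀ α ∈ A, α x = x) ∧
      ¬ p ∣ (MulAction.stabilizer (MulAut G) x).relIndex B := by
  let V := centerTorsion p G
  have hVf : Finite V := hG.finite_centerTorsion
  have hpV : p ∣ Nat.card V := by
    have := (Subgroup.nontrivial_iff_ne_bot V).2 hG.centerTorsion_ne_bot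
    obtain ⟨n, hn, h⟩ := (hG.isPGroup.to_subgroup V).nontrivial_iff_card.1 this
    rw [h]
    exact dvd_pow_self p hn.ne'
  let act : MulAction (MulAut G) V :=
    { smul := fun α v => ⟨α v, mulAut_mem_centerTorsion α v.2⟩
      one_smul := fun v => rfl
      mul_smul := fun α β v => rfl }
  let π : MulAut G →* Equiv.Perm V := MulAction.toPermHom (MulAut G) V
  have hπ : ∀ α v, ((π α v : V) : G) = α v := fun α v => rfl
  have hfin : Finite (B.map π) := inferInstance
  have hAp : IsPGroup p ((A.map π).subgroupOf (B.map π)) :=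
    (hA.map π).of_injective ((Subgroup.subgroupOfEquivOfLe (Subgroup.map_mono hAB)).toMonoidHom)
      (MulEquiv.injective _)
  -- The image of `B` in the permutations of the finite set `V` is finite. A Sylow subgroup `Γ` of
  -- it containing the image of `A` fixes some `x ≠ 1`, and the stabilizer of `x` contains the
  -- preimage of `Γ`.
  obtain ⟨Γ, hΓ⟩ := hAp.exists_le_sylow
  let : MulAction Γ V := MulAction.compHom V ((B.map π).subtype.comp Γ.toSubgroup.subtype)
  have hact : ∀ (γ : Γ) (v : V), γ • v = ((γ : B.map π) : Equiv.Perm V) v := fun γ v => rfl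
  obtain ⟨x, hx, hx1⟩ := Γ.isPGroup'.exists_fixed_point_of_prime_dvd_card_of_fixed_point V hpV
    (a := 1) (by
      rintro ⟨⟨_, β, hβ, rfl⟩, hγ⟩
      exact Subtype.ext ((hπ β 1).trans (map_one β)))
  refine ⟨x, x.2.1, orderOf_eq_prime x.2.2 fun h => hx1 (Subtype.ext h.symm), fun α hα => ?_, ?_⟩
  · have h1 : (⟨π α, α, hAB hα, rfl⟩ : B.map π) ∈ Γ.toSubgroup := hΓ ⟨α, hα, rfl⟩
    exact congrArg Subtype.val (hx ⟨_, h1⟩)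
  · intro hdvd
    have hle : (Γ.toSubgroup.map (B.map π).subtype).comap π ≤
        MulAction.stabilizer (MulAut G) (x : G) := by
      rintro α ⟨γ, hγ, hγα⟩
      have := congrArg Subtype.val (hx ⟨γ, hγ⟩)
      rw [hact] at this
      change ((((B.map π).subtype γ) x : V) : G) = x at this
      rw [hγα] at this
      exact this
    have h1 := hdvd.trans (Subgroup.relIndex_dvd_of_le_left B hle)
    rw [Subgroup.relIndex_comap, Subgroup.relIndex, Subgroup.subgroupOf,
      Subgroup.comap_map_eq_self_of_injective (Subgroup.subtype_injective _)] at h1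
    exact Γ.not_dvd_index h1

end Actions

/-! ### Bounding the number of components of normalizers -/

section NormalizerBound

variable {p : ℕ}

/-- The norm map of a finite group acting on an abelian group takes values in the fixed points. -/
theorem prod_mulAut_fixed {Γ T : Type*} [Group Γ] [Fintype Γ] [CommGroup T] (g : Γ →* MulAut T)
    (c : Γ) (t : T) : g c (∏ d, g d t) = ∏ d, g d t := by
  rw [map_prod]
  exact Fintype.prod_equiv (Equiv.mulLeft c) _ _ fun d => by simp

/-- Let `T` be the identity component of `S` and `ν` the norm of the finite group `Q/(Q ∩ T)` acting
on `T`. The image of `ν` is divisible and centralizes `Q`, so it lies in the identity component of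
`N_S(Q)`. As `a` normalizes `Q`, the elements `ν(a)` and `a ^ |Q/(Q ∩ T)|` differ by a product of
commutators in `Q`, and a further power brings this into the identity component of `Q`. -/
theorem IsPToral.exists_pow_index_mem [Fact p.Prime] {S : Type*} [Group S] (hS : IsPToral p S)
    (Q : Subgroup S) {a : S} (ha : a ∈ Subgroup.normalizer (Q : Set S))
    (haT : a ∈ identityComponent S) :
    a ^ ((identityComponent S).index * (identityComponent Q).index) ∈
      (identityComponent (Subgroup.normalizer (Q : Set S))).map (Subgroup.subtype _) := by
  set N := Subgroup.normalizer (Q : Set S) with hN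
  have hNt := hS.subgroup N
  have hQt := hS.subgroup Q
  have hQN : Q ≤ N := Subgroup.le_normalizer
  have hdivle : ∀ D : Subgroup S, D ≤ N → (∀ a ∈ D, ∃ b ∈ D, b ^ p = a) →
      D ≤ (identityComponent N).map N.subtype := by
    intro D hDN hD
    have := hNt.finiteIndex
    have h1 : D.subgroupOf N ≤ identityComponent N :=
      le_of_divisible_of_finiteIndex hNt.isPGroup (fun a ha => by
        obtain ⟨b, hb, hba⟩ := hD a ha
        exact ⟨⟨b, hDN hb⟩, hb, Subtype.ext hba⟩) _
    intro d hd
    exact ⟨⟨d, hDN hd⟩, h1 hd, rfl⟩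
  let T := identityComponent S
  let : CommGroup T := { (inferInstance : Group T) with mul_comm := hS.isPTorus.comm }
  have hTn : T.Normal := identityComponent_normal S
  have hTfi : T.FiniteIndex := hS.finiteIndex
  let Γ := Q ⧸ T.subgroupOf Q
  let g : Γ →* MulAut T := QuotientGroup.lift (T.subgroupOf Q)
    ((MulAut.conjNormal (H := T)).comp Q.subtype) (by
      intro q hq
      ext t
      have := congrArg Subtype.val (hS.isPTorus.comm ⟨q, hq⟩ t)
      simp only [MonoidHom.comp_apply, MulAut.conjNormal_apply, Subgroup.coe_subtype,
        MulAut.one_apply, mul_inv_eq_iff_eq_mul]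
      exact this)
  have hg : ∀ (q : Q) (t : T), ((g (q : Γ) t : T) : S) = q * t * (q : S)⁻¹ := fun q t =>
    MulAut.conjNormal_apply (H := T) (q : S) t
  have hfiQ : (T.subgroupOf Q).FiniteIndex := finiteIndex_comap Q.subtype T
  let : Fintype Γ := Fintype.ofFinite _
  have hcard : Fintype.card Γ = T.relIndex Q := by
    rw [Subgroup.relIndex, Subgroup.index, Nat.card_eq_fintype_card]
  let ν : T →* T :=
    { toFun := fun t => ∏ c, g c t
      map_one' := by simp
      map_mul' := fun a b => by simp [Finset.prod_mul_distrib] }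
  have hν : ν.range.map T.subtype ≤ (identityComponent N).map N.subtype := by
    refine hdivle _ ?_ ?_
    · rintro _ ⟨_, ⟨t, rfl⟩, rfl⟩
      refine (?_ : Subgroup.centralizer (Q : Set S) ≤ N) (Subgroup.mem_centralizer_iff.2 ?_)
      · exact Subgroup.centralizer_le_normalizer _
      · intro q hq
        have h1 := congrArg Subtype.val (prod_mulAut_fixed g ((⟨q, hq⟩ : Q) : Γ) t)
        rw [hg] at h1
        rwa [mul_inv_eq_iff_eq_mul] at h1
    · rintro _ ⟨_, ⟨t, rfl⟩, rfl⟩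
      obtain ⟨s, rfl⟩ := hS.isPTorus.divisible t
      refine ⟨ν s, ⟨ν s, ⟨s, rfl⟩, rfl⟩, ?_⟩
      rw [map_pow]
      rfl
  have hQ0 : (identityComponent Q).map Q.subtype ≤ (identityComponent N).map N.subtype := by
    refine hdivle _ ((Subgroup.map_subtype_le _).trans hQN) ?_
    rintro _ ⟨a, ha, rfl⟩
    obtain ⟨b, hb⟩ := hQt.isPTorus.divisible ⟨a, ha⟩
    exact ⟨(b : Q), ⟨b, b.2, rfl⟩, congrArg (fun z : identityComponent Q => ((z : Q) : S)) hb⟩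
  let t : T := ⟨a, haT⟩
  have hb : ν t * (t ^ T.relIndex Q)⁻¹ ∈ Q.subgroupOf T := by
    have h1 : ν t * (t ^ T.relIndex Q)⁻¹ = ∏ c, (g c t * t⁻¹) := by
      rw [Finset.prod_mul_distrib, Finset.prod_const, Finset.card_univ, hcard, inv_pow]
      rfl
    rw [h1]
    refine Subgroup.prod_mem _ fun c _ => ?_
    obtain ⟨q, rfl⟩ := QuotientGroup.mk_surjective c
    rw [Subgroup.mem_subgroupOf]
    have h2 : ((g (q : Γ) t * t⁻¹ : T) : S) = q * (a * (q : S)⁻¹ * a⁻¹) := by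
      rw [Subgroup.coe_mul, hg]
      simp [t, mul_assoc]
    change ((g (q : Γ) t * t⁻¹ : T) : S) ∈ Q
    rw [h2]
    exact mul_mem q.2 ((Subgroup.mem_normalizer_iff.1 ha _).1 (inv_mem q.2))
  obtain ⟨w, hw⟩ := Subgroup.relIndex_dvd_index_of_normal T Q
  set b : T := ν t * (t ^ T.relIndex Q)⁻¹ with hbdef
  have hbj : (b : S) ^ (identityComponent Q).index ∈ (identityComponent Q).map Q.subtype := by
    have hn := identityComponent_normal Q
    exact ⟨_, Subgroup.pow_index_mem (identityComponent Q) ⟨b, hb⟩, rfl⟩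
  have hpow : t ^ (T.index * (identityComponent Q).index) =
      ν t ^ (w * (identityComponent Q).index) * ((b ^ (identityComponent Q).index) ^ w)⁻¹ := by
    have h3 : t ^ T.relIndex Q = ν t * b⁻¹ := by rw [hbdef]; simp
    rw [hw, mul_assoc, pow_mul, h3, mul_pow, inv_pow, ← pow_mul, mul_comm w]
  have h4 := congrArg Subtype.val hpow
  rw [Subgroup.coe_mul, Subgroup.coe_inv, Subgroup.coe_pow, Subgroup.coe_pow, Subgroup.coe_pow,
    Subgroup.coe_pow] at h4
  change a ^ (T.index * (identityComponent Q).index) = _ at h4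
  rw [h4]
  exact mul_mem (pow_mem (hν ⟨_, ⟨t, rfl⟩, rfl⟩) _) (inv_mem (pow_mem (hQ0 hbj) _))

/-- The bound depends on `Q` only through its number `j` of components, which conjugate subgroups
share. With `m = |S : T| j`, each coset of the identity component in `N ∩ T` is represented by an
element killed by `m`, and `|N : N ∩ T|` is at most `|S : T|`. -/
theorem IsPToral.exists_index_normalizer_le [Fact p.Prime] {S : Type*} [Group S]
    (hS : IsPToral p S) (j : ℕ) : ∃ B : ℕ, ∀ Q : Subgroup S, (identityComponent Q).index = j →
      (identityComponent (Subgroup.normalizer (Q : Set S))).index ≤ B := by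
  let T := identityComponent S
  have hTn : T.Normal := identityComponent_normal S
  let : CommGroup T := { (inferInstance : Group T) with mul_comm := hS.isPTorus.comm }
  refine ⟨Nat.card {t : T | t ^ (T.index * j) = 1} * T.index, ?_⟩
  rintro Q rfl
  set N := Subgroup.normalizer (Q : Set S) with hN
  have hNt := hS.subgroup N
  have hQt := hS.subgroup Q
  have hTfi : T.FiniteIndex := hS.finiteIndex
  have hQfi := hQt.finiteIndex
  have hQn := identityComponent_normal Q
  obtain ⟨k, hk⟩ := hS.isPGroup.index T
  obtain ⟨l, hl⟩ := hQt.isPGroup.index (identityComponent Q)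
  have he : T.index * (identityComponent Q).index = p ^ (k + l) := by rw [hk, hl, pow_add]
  have hfin : Finite {t : T | t ^ (T.index * (identityComponent Q).index) = 1} := by
    rw [he]
    exact finite_ker_powMonoidHom hS.isPTorus.finite_torsion _
  let M := (identityComponent N).map N.subtype
  have hMT : M ≤ T := map_identityComponent_le N.subtype
  have hMN : M ≤ N := Subgroup.map_subtype_le _
  have h1 : (identityComponent N).index = M.relIndex (T ⊓ N) * (T ⊓ N).relIndex N := by
    rw [Subgroup.relIndex_mul_relIndex M (T ⊓ N) N (le_inf hMT hMN) inf_le_right,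
      Subgroup.relIndex, Subgroup.subgroupOf,
      Subgroup.comap_map_eq_self_of_injective N.subtype_injective]
  rw [h1]
  refine Nat.mul_le_mul ?_ ?_
  · have hs : Function.Surjective
        fun t : {t : {t : T | t ^ (T.index * (identityComponent Q).index) = 1} // (t : S) ∈ N} =>
          ((⟨((t : {t : T | t ^ (T.index * (identityComponent Q).index) = 1}) : S),
            (t.1 : T).2, t.2⟩ : (T ⊓ N : Subgroup S)) :
              (T ⊓ N : Subgroup S) ⧸ M.subgroupOf (T ⊓ N)) := by
      intro q
      obtain ⟨a, rfl⟩ := QuotientGroup.mk_surjective q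
      obtain ⟨b, hb, hba⟩ := hS.exists_pow_index_mem Q a.2.2 a.2.1
      -- Divisibility gives `c` in the identity component of `N` with the same `m`-th power as `a`,
      -- so `a * c⁻¹` is a representative killed by `m`.
      obtain ⟨c, hc⟩ := exists_pow_prime_pow_eq hNt.isPTorus.divisible (k + l) ⟨b, hb⟩
      have hc' : ((c : N) : S) ^ (T.index * (identityComponent Q).index) =
          (a : S) ^ (T.index * (identityComponent Q).index) := by
        rw [← hba, he]
        exact congrArg (fun z : identityComponent N => ((z : N) : S)) hc
      have hcM : ((c : N) : S) ∈ M := ⟨c, c.2, rfl⟩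
      let a' : T := ⟨a, a.2.1⟩
      let c' : T := ⟨c, hMT hcM⟩
      have hc'' : c' ^ (T.index * (identityComponent Q).index) =
          a' ^ (T.index * (identityComponent Q).index) := Subtype.ext hc'
      refine ⟨⟨⟨a' * c'⁻¹, ?_⟩, ?_⟩, ?_⟩
      · change (a' * c'⁻¹) ^ (T.index * (identityComponent Q).index) = 1
        rw [mul_pow, inv_pow, hc'', mul_inv_cancel]
      · exact mul_mem a.2.2 (inv_mem (hMN hcM))
      · refine QuotientGroup.eq.2 ?_
        have h5 : ((a : S) * (c : S)⁻¹)⁻¹ * a = c := by simp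
        rw [Subgroup.mem_subgroupOf]
        change ((a : S) * (c : S)⁻¹)⁻¹ * a ∈ M
        rw [h5]
        exact hcM
    exact (Nat.card_le_card_of_surjective _ hs).trans
      (Nat.card_le_card_of_injective _ Subtype.val_injective)
  · rw [Subgroup.inf_relIndex_right]
    exact Nat.le_of_dvd (Nat.pos_of_ne_zero hTfi.index_ne_zero)
      (Subgroup.relIndex_dvd_index_of_normal T N)

end NormalizerBound

/-! ### Comparing orders through functions multiplicative on a subgroup -/

section OrderOfMap

variable {p : ℕ} {S S' : Type*} [Group S] [Group S']

/-- The homomorphism of subgroups given by a function multiplicative on a subgroup. -/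
def homOfMulOn (H : Subgroup S) (K : Subgroup S') (f : S → S')
    (hmul : ∀ a ∈ H, ∀ b ∈ H, f (a * b) = f a * f b) (hf : ∀ a ∈ H, f a ∈ K) : H →* K :=
  MonoidHom.mk' (fun a => ⟨f a, hf a a.2⟩) fun a b => Subtype.ext (hmul a a.2 b b.2)

theorem IsPToral.toralOrder_le_of_injOn [Fact p.Prime] (hS : IsPToral p S') {H : Subgroup S}
    {K : Subgroup S'} (f : S → S') (hmul : ∀ a ∈ H, ∀ b ∈ H, f (a * b) = f a * f b)
    (hinj : Set.InjOn f H) (hf : ∀ a ∈ H, f a ∈ K) : toralOrder p H ≤ toralOrder p K :=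
  (hS.subgroup K).toralOrder_le (f := homOfMulOn H K f hmul hf) fun a b hab =>
    Subtype.ext (hinj a.2 b.2 (congrArg Subtype.val hab))

theorem IsPToral.surjOn_of_toralOrder_le [Fact p.Prime] (hS : IsPToral p S') {H : Subgroup S}
    {K : Subgroup S'} (f : S → S') (hmul : ∀ a ∈ H, ∀ b ∈ H, f (a * b) = f a * f b)
    (hinj : Set.InjOn f H) (hf : ∀ a ∈ H, f a ∈ K) (h : toralOrder p K ≤ toralOrder p H) :
    ∀ b ∈ K, ∃ a ∈ H, f a = b := by
  intro b hb
  obtain ⟨a, ha⟩ := (hS.subgroup K).surjective_of_toralOrder_le (f := homOfMulOn H K f hmul hf)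
    (fun a b hab => Subtype.ext (hinj a.2 b.2 (congrArg Subtype.val hab))) h ⟨b, hb⟩
  exact ⟨a, a.2, congrArg Subtype.val ha⟩

end OrderOfMap

/-! ### The groups `Inn(P)` and `Aut_S(P)` -/

section AutomorphismGroups

variable {S : Type*} [Group S] {P : Subgroup S}

theorem mem_normalizer_of_forall_mem {N : Subgroup S} (hN : ∀ n ∈ N, ∀ a ∈ P, n * a * n⁻¹ ∈ P)
    {n : S} (hn : n ∈ N) : n ∈ Subgroup.normalizer (P : Set S) := by
  refine Subgroup.mem_normalizer_iff.2 fun a => ⟨hN n hn a, fun h => ?_⟩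
  have := hN _ (inv_mem hn) _ h
  simpa [mul_assoc] using this

/-- A conjugating element automatically normalizes `P`, because `α` maps `P` onto `P`. -/
theorem mem_autBy_iff {α : MulAut P} : α ∈ autBy P ↔ ∃ g : S, ∀ a : P, (α a : S) = g * a * g⁻¹ := by
  constructor
  · rintro ⟨g, rfl⟩
    exact ⟨g, fun a => rfl⟩
  · rintro ⟨g, hg⟩
    have hgN : g ∈ Subgroup.normalizer (P : Set S) := by
      refine Subgroup.mem_normalizer_iff.2 fun a => ⟨fun ha => ?_, fun ha => ?_⟩
      · rw [← hg ⟨a, ha⟩]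
        exact (α _).2
      · obtain ⟨b, hb⟩ := α.surjective ⟨_, ha⟩
        have h1 := hg b
        rw [hb] at h1
        have h2 : a = b := by simpa using h1
        rw [h2]
        exact b.2
    refine ⟨⟨g, hgN⟩, ?_⟩
    ext a
    exact (hg a).symm

theorem mem_innerAut_iff {α : MulAut P} :
    α ∈ innerAut P ↔ ∃ g ∈ P, ∀ a : P, (α a : S) = g * a * g⁻¹ := by
  constructor
  · rintro ⟨g, rfl⟩
    exact ⟨g, g.2, fun a => rfl⟩
  · rintro ⟨g, hgP, hg⟩
    refine ⟨⟨g, hgP⟩, ?_⟩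
    ext a
    exact (hg a).symm

theorem innerAut_le_autBy : innerAut P ≤ autBy P := fun α hα => by
  obtain ⟨g, -, hg⟩ := mem_innerAut_iff.1 hα
  exact mem_autBy_iff.2 ⟨g, hg⟩

theorem isPGroup_autBy {p : ℕ} (hS : IsPGroup p S) (P : Subgroup S) : IsPGroup p (autBy P) :=
  (hS.to_subgroup _).of_surjective _ P.normalizerMonoidHom.rangeRestrict_surjective

end AutomorphismGroups

namespace FusionSystem

/-! ### Morphisms as functions `S → S`, whose values outside the subgroup are irrelevant -/

section Morphisms

variable {p : ℕ} {S : Type*} [Group S] (F : FusionSystem S)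

/-- The function `f` restricts to a morphism of `F` from `P` to `S`. -/
def IsMor (f : S → S) (P : Subgroup S) : Prop :=
  ∃ φ ∈ F.Hom P ⊤, ∀ a : P, (φ a : S) = f a

/-- The function `f` restricts to an isomorphism of `F` from `P` to `Q`. -/
structure IsIso (f : S → S) (P Q : Subgroup S) : Prop where
  isMor : F.IsMor f P
  mem_iff : ∀ b, b ∈ Q ↔ ∃ a ∈ P, f a = b

variable {F} {f g : S → S} {P Q R : Subgroup S}

theorem IsMor.congr (hf : F.IsMor f P) (h : ∀ a ∈ P, g a = f a) : F.IsMor g P := by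
  obtain ⟨φ, hφ, hφf⟩ := hf
  exact ⟨φ, hφ, fun a => by rw [hφf, h a a.2]⟩

theorem IsMor.mono (hf : F.IsMor f P) (h : R ≤ P) : F.IsMor f R := by
  obtain ⟨φ, hφ, hφf⟩ := hf
  refine ⟨φ.comp (Subgroup.inclusion h), F.comp_mem (F.conj_mem _ ⟨1, fun x => ?_⟩) hφ,
    fun a => hφf _⟩
  simp

theorem IsMor.map_mul (hf : F.IsMor f P) {a b : S} (ha : a ∈ P) (hb : b ∈ P) :
    f (a * b) = f a * f b := by
  obtain ⟨φ, -, hφ⟩ := hf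
  have := congrArg Subtype.val (_root_.map_mul φ ⟨a, ha⟩ ⟨b, hb⟩)
  rw [Subgroup.coe_mul, hφ, hφ, hφ] at this
  exact this

theorem IsMor.map_one (hf : F.IsMor f P) : f 1 = 1 := by
  have := hf.map_mul P.one_mem P.one_mem
  rw [mul_one] at this
  exact left_eq_mul.1 this

theorem IsMor.map_inv (hf : F.IsMor f P) {a : S} (ha : a ∈ P) : f a⁻¹ = (f a)⁻¹ := by
  rw [eq_inv_iff_mul_eq_one, ← hf.map_mul (inv_mem ha) ha, inv_mul_cancel, hf.map_one]

theorem IsMor.map_conj (hf : F.IsMor f P) {a b : S} (ha : a ∈ P) (hb : b ∈ P) :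
    f (a * b * a⁻¹) = f a * f b * (f a)⁻¹ := by
  rw [hf.map_mul (mul_mem ha hb) (inv_mem ha), hf.map_mul ha hb, hf.map_inv ha]

theorem IsMor.map_zpow (hf : F.IsMor f P) {a : S} (ha : a ∈ P)
    (k : ℤ) : f (a ^ k) = f a ^ k := by
  obtain ⟨φ, -, hφ⟩ := hf
  have h1 := hφ (⟨a, ha⟩ ^ k)
  rw [_root_.map_zpow, Subgroup.coe_zpow, hφ] at h1
  exact h1.symm

theorem IsMor.injOn (hf : F.IsMor f P) : Set.InjOn f P := by
  obtain ⟨φ, hφ, hφf⟩ := hf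
  intro a ha b hb hab
  have h1 : φ ⟨a, ha⟩ = φ ⟨b, hb⟩ := Subtype.ext (by rw [hφf, hφf]; exact hab)
  exact congrArg Subtype.val (F.injective_of_mem hφ h1)

theorem isMor_conj (F : FusionSystem S) (g : S) (P : Subgroup S) :
    F.IsMor (fun a => g * a * g⁻¹) P :=
  ⟨homOfMulOn P ⊤ (fun a => g * a * g⁻¹) (fun a _ b _ => by simp [mul_assoc])
    fun _ _ => Subgroup.mem_top _, F.conj_mem _ ⟨g, fun _ => rfl⟩, fun _ => rfl⟩

theorem isMor_id (F : FusionSystem S) (P : Subgroup S) : F.IsMor id P :=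
  (F.isMor_conj 1 P).congr fun a _ => by simp

theorem exists_isMor_of_mem_hom {φ : P →* Q} (hφ : φ ∈ F.Hom P Q) :
    ∃ f, F.IsMor f P ∧ ∀ a : P, f a = φ a := by
  classical
  refine ⟨fun s => if h : s ∈ P then φ ⟨s, h⟩ else 1,
    ⟨(Subgroup.inclusion le_top).comp φ, F.comp_mem hφ (F.conj_mem _ ⟨1, fun x => ?_⟩),
      fun a => ?_⟩, fun a => ?_⟩
  · simp
  · simp
  · simp

theorem IsMor.exists_isIso (hf : F.IsMor f P) : ∃ Q, F.IsIso f P Q := by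
  have hf' := hf
  obtain ⟨φ, hφ, h⟩ := hf
  refine ⟨homImage φ, hf', fun b => ⟨?_, ?_⟩⟩
  · rintro ⟨_, ⟨a, rfl⟩, rfl⟩
    exact ⟨a, a.2, (h a).symm⟩
  · rintro ⟨a, ha, rfl⟩
    exact ⟨φ ⟨a, ha⟩, ⟨_, rfl⟩, h _⟩

theorem IsIso.map_mem (hf : F.IsIso f P Q) {a : S} (ha : a ∈ P) : f a ∈ Q :=
  (hf.mem_iff _).2 ⟨a, ha, rfl⟩

theorem IsIso.eq_homImage (hf : F.IsIso f P Q) {φ : P →* (⊤ : Subgroup S)}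
    (hφ : ∀ a : P, (φ a : S) = f a) : homImage φ = Q := by
  ext b
  rw [hf.mem_iff]
  constructor
  · rintro ⟨_, ⟨a, rfl⟩, rfl⟩
    exact ⟨a, a.2, (hφ a).symm⟩
  · rintro ⟨a, ha, rfl⟩
    exact ⟨φ ⟨a, ha⟩, ⟨_, rfl⟩, hφ _⟩

theorem IsIso.exists_mulEquiv (hf : F.IsIso f P Q) :
    ∃ e : P ≃* Q, e.toMonoidHom ∈ F.Hom P Q ∧ e.symm.toMonoidHom ∈ F.Hom Q P ∧
      ∀ a : P, (e a : S) = f a := by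
  obtain ⟨φ, hφ, h⟩ := hf.isMor
  obtain ⟨R, hR, e, he, he', rfl⟩ := F.factor hφ
  have hRQ : R = Q := by
    ext b
    rw [hf.mem_iff]
    constructor
    · intro hb
      obtain ⟨a, ha⟩ := e.surjective ⟨b, hb⟩
      exact ⟨a, a.2, by rw [← h]; exact congrArg Subtype.val ha⟩
    · rintro ⟨a, ha, rfl⟩
      rw [← h ⟨a, ha⟩]
      exact (e _).2
  subst hRQ
  exact ⟨e, he, he', h⟩

theorem IsIso.exists_symm (hf : F.IsIso f P Q) :
    ∃ g, F.IsIso g Q P ∧ (∀ a ∈ P, g (f a) = a) ∧ ∀ b ∈ Q, f (g b) = b := by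
  obtain ⟨e, he, he', h⟩ := hf.exists_mulEquiv
  obtain ⟨g, hg, hge⟩ := exists_isMor_of_mem_hom he'
  have h1 : ∀ a ∈ P, g (f a) = a := fun a ha => by
    have := hge (e ⟨a, ha⟩)
    rw [h] at this
    rw [this]
    exact congrArg Subtype.val (e.symm_apply_apply ⟨a, ha⟩)
  have h2 : ∀ b ∈ Q, f (g b) = b := fun b hb => by
    obtain ⟨a, ha, rfl⟩ := (hf.mem_iff b).1 hb
    rw [h1 a ha]
  refine ⟨g, ⟨hg, fun a => ⟨fun ha => ⟨f a, hf.map_mem ha, h1 a ha⟩, ?_⟩⟩, h1, h2⟩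
  rintro ⟨b, hb, rfl⟩
  obtain ⟨a, ha, rfl⟩ := (hf.mem_iff b).1 hb
  rw [h1 a ha]
  exact ha

theorem IsMor.comp (hf : F.IsMor f P) (hg : F.IsMor g Q) (h : ∀ a ∈ P, f a ∈ Q) :
    F.IsMor (fun a => g (f a)) P := by
  obtain ⟨R, hR⟩ := hf.exists_isIso
  have hRQ : R ≤ Q := fun b hb => by
    obtain ⟨a, ha, rfl⟩ := (hR.mem_iff b).1 hb
    exact h a ha
  obtain ⟨e, he, -, hef⟩ := hR.exists_mulEquiv
  obtain ⟨φ, hφ, hφg⟩ := hg.mono hRQ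
  exact ⟨φ.comp e.toMonoidHom, F.comp_mem he hφ, fun a => (hφg (e a)).trans (by rw [hef])⟩

theorem IsIso.trans (hf : F.IsIso f P Q) (hg : F.IsIso g Q R) :
    F.IsIso (fun a => g (f a)) P R := by
  refine ⟨hf.isMor.comp hg.isMor fun a ha => hf.map_mem ha, fun c => ?_⟩
  rw [hg.mem_iff]
  constructor
  · rintro ⟨b, hb, rfl⟩
    obtain ⟨a, ha, rfl⟩ := (hf.mem_iff b).1 hb
    exact ⟨a, ha, rfl⟩
  · rintro ⟨a, ha, rfl⟩
    exact ⟨f a, hf.map_mem ha, rfl⟩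

theorem IsIso.congr (hf : F.IsIso f P Q) (h : ∀ a ∈ P, g a = f a) : F.IsIso g P Q := by
  refine ⟨hf.isMor.congr h, fun b => ?_⟩
  rw [hf.mem_iff]
  exact exists_congr fun a => and_congr_right fun ha => by rw [h a ha]

/-- By the factorization axiom, membership in a morphism set depends only on the underlying map and
not on the chosen target. -/
theorem IsMor.mem_hom (hf : F.IsMor f P) (φ : P →* Q) (h : ∀ a : P, (φ a : S) = f a) :
    φ ∈ F.Hom P Q := by
  obtain ⟨R, hR⟩ := hf.exists_isIso
  obtain ⟨e, he, -, hef⟩ := hR.exists_mulEquiv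
  have hRQ : R ≤ Q := fun b hb => by
    obtain ⟨a, ha, rfl⟩ := (hR.mem_iff b).1 hb
    rw [← h ⟨a, ha⟩]
    exact (φ _).2
  have h1 : φ = (Subgroup.inclusion hRQ).comp e.toMonoidHom := by
    ext a
    rw [h]
    exact (hef a).symm
  rw [h1]
  exact F.comp_mem he (F.conj_mem _ ⟨1, fun x => by simp⟩)

theorem isConjugate_iff : F.IsConjugate P Q ↔ ∃ f, F.IsIso f P Q := by
  constructor
  · rintro ⟨e, he, he'⟩
    obtain ⟨f, hf, hfe⟩ := exists_isMor_of_mem_hom he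
    refine ⟨f, hf, fun b => ⟨fun hb => ?_, ?_⟩⟩
    · obtain ⟨a, ha⟩ := e.surjective ⟨b, hb⟩
      exact ⟨a, a.2, (hfe a).trans (congrArg Subtype.val ha)⟩
    · rintro ⟨a, ha, rfl⟩
      rw [hfe ⟨a, ha⟩]
      exact (e _).2
  · rintro ⟨f, hf⟩
    obtain ⟨e, he, he', -⟩ := hf.exists_mulEquiv
    exact ⟨e, he, he'⟩

theorem mem_aut_iff {α : MulAut P} : α ∈ F.aut P ↔ ∃ f, F.IsMor f P ∧ ∀ a : P, (α a : S) = f a := by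
  constructor
  · rintro ⟨h, -⟩
    obtain ⟨f, hf, hfa⟩ := exists_isMor_of_mem_hom h
    exact ⟨f, hf, fun a => (hfa a).symm⟩
  · rintro ⟨f, hf, h⟩
    have hiso : F.IsIso f P P := ⟨hf, fun b => ⟨fun hb => ?_, ?_⟩⟩
    · obtain ⟨g, hg, hgf, -⟩ := hiso.exists_symm
      refine ⟨hf.mem_hom _ h, hg.isMor.mem_hom _ fun a => ?_⟩
      obtain ⟨b, rfl⟩ := α.surjective a
      rw [h, hgf b b.2]
      exact congrArg Subtype.val (α.symm_apply_apply b)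
    · obtain ⟨a, ha⟩ := α.surjective ⟨b, hb⟩
      exact ⟨a, a.2, by rw [← h, ha]⟩
    · rintro ⟨a, ha, rfl⟩
      rw [← h ⟨a, ha⟩]
      exact (α _).2

theorem exists_isIso_of_mem_aut {α : MulAut P} (hα : α ∈ F.aut P) :
    ∃ u, F.IsIso u P P ∧ ∀ a : P, (α a : S) = u a := by
  obtain ⟨u, hu, hαu⟩ := mem_aut_iff.1 hα
  refine ⟨u, ⟨hu, fun b => ⟨fun hb => ?_, ?_⟩⟩, hαu⟩
  · obtain ⟨a, ha⟩ := α.surjective ⟨b, hb⟩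
    exact ⟨a, a.2, by rw [← hαu, ha]⟩
  · rintro ⟨a, ha, rfl⟩
    rw [← hαu ⟨a, ha⟩]
    exact (α ⟨a, ha⟩).2

theorem autBy_le_aut : autBy P ≤ F.aut P := fun α hα => by
  obtain ⟨g, hg⟩ := mem_autBy_iff.1 hα
  exact mem_aut_iff.2 ⟨_, F.isMor_conj g P, hg⟩

theorem isConjugateElement_iff {x y : S} :
    F.IsConjugateElement x y ↔ ∃ f, F.IsMor f (Subgroup.zpowers x) ∧ f x = y := by
  constructor
  · rintro ⟨φ, hφ, h⟩
    obtain ⟨f, hf, hfφ⟩ := exists_isMor_of_mem_hom hφ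
    exact ⟨f, hf, (hfφ ⟨x, Subgroup.mem_zpowers x⟩).trans h⟩
  · rintro ⟨f, hf, rfl⟩
    have hmem : ∀ a ∈ Subgroup.zpowers x, f a ∈ Subgroup.zpowers (f x) := by
      obtain ⟨φ, hφ, h⟩ := hf
      rintro _ ⟨k, rfl⟩
      have h1 := h (⟨x, Subgroup.mem_zpowers x⟩ ^ k)
      rw [map_zpow, Subgroup.coe_zpow, h] at h1
      exact ⟨k, h1⟩
    exact ⟨homOfMulOn _ _ f (fun a ha b hb => hf.map_mul ha hb) hmem,
      hf.mem_hom _ fun a => rfl, rfl⟩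

end Morphisms

/-! ### The saturation axioms in terms of functions and indices -/

section Axioms

variable {p : ℕ} {S : Type*} [Group S] {F : FusionSystem S} {f g : S → S} {P Q R : Subgroup S}

theorem fullyCentralized_iff : F.FullyCentralized p P ↔ ∀ f Q, F.IsIso f P Q →
    toralOrder p (Subgroup.centralizer (Q : Set S)) ≤
      toralOrder p (Subgroup.centralizer (P : Set S)) :=
  ⟨fun h f Q hf => h Q (isConjugate_iff.2 ⟨f, hf⟩),
    fun h Q hQ => let ⟨f, hf⟩ := isConjugate_iff.1 hQ; h f Q hf⟩

theorem fullyNormalized_iff : F.FullyNormalized p P ↔ ∀ f Q, F.IsIso f P Q →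
    toralOrder p (Subgroup.normalizer (Q : Set S)) ≤
      toralOrder p (Subgroup.normalizer (P : Set S)) :=
  ⟨fun h f Q hf => h Q (isConjugate_iff.2 ⟨f, hf⟩),
    fun h Q hQ => let ⟨f, hf⟩ := isConjugate_iff.1 hQ; h f Q hf⟩

theorem FullyCentralized.of_isIso (hP : F.FullyCentralized p P) (hf : F.IsIso f P Q)
    (h : toralOrder p (Subgroup.centralizer (P : Set S)) ≤
      toralOrder p (Subgroup.centralizer (Q : Set S))) : F.FullyCentralized p Q :=
  fullyCentralized_iff.2 fun _ R hg => (fullyCentralized_iff.1 hP _ R (hf.trans hg)).trans h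

theorem FullyNormalized.of_isIso (hP : F.FullyNormalized p P) (hf : F.IsIso f P Q)
    (h : toralOrder p (Subgroup.normalizer (P : Set S)) ≤
      toralOrder p (Subgroup.normalizer (Q : Set S))) : F.FullyNormalized p Q :=
  fullyNormalized_iff.2 fun _ R hg => (fullyNormalized_iff.1 hP _ R (hf.trans hg)).trans h

theorem IsIso.conj_mem_normalizer (hf : F.IsIso f P Q) {n : S}
    (hn : n ∈ Subgroup.normalizer (P : Set S)) {h : S}
    (hh : ∀ a ∈ P, f (n * a * n⁻¹) = h * f a * h⁻¹) : h ∈ Subgroup.normalizer (Q : Set S) := by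
  rw [Subgroup.mem_normalizer_iff] at hn
  refine Subgroup.mem_normalizer_iff.2 fun b => ⟨fun hb => ?_, fun hb => ?_⟩
  · obtain ⟨a, ha, rfl⟩ := (hf.mem_iff b).1 hb
    rw [← hh a ha]
    exact hf.map_mem ((hn a).1 ha)
  · obtain ⟨a, ha, hab⟩ := (hf.mem_iff _).1 hb
    have h2 : n * (n⁻¹ * a * n) * n⁻¹ = a := by simp [mul_assoc]
    have ha' : n⁻¹ * a * n ∈ P := (hn _).2 (by rwa [h2])
    have h1 := hh _ ha'
    rw [h2, hab] at h1
    have h3 : b = f (n⁻¹ * a * n) := by simpa using h1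
    rw [h3]
    exact hf.map_mem ha'

/-- `N` may be any subgroup between `P` and `N_φ`. The element `h` need not be assumed to normalize
`Q`; this is automatic. -/
theorem extensionAxiom_iff : F.ExtensionAxiom p ↔
    ∀ (f : S → S) (P Q N : Subgroup S), F.IsIso f P Q → F.FullyCentralized p Q → P ≤ N →
      (∀ n ∈ N, (∀ a ∈ P, n * a * n⁻¹ ∈ P) ∧ ∃ h : S, ∀ a ∈ P, f (n * a * n⁻¹) = h * f a * h⁻¹) →
      ∃ g, F.IsMor g N ∧ ∀ a ∈ P, g a = f a := by
  constructor
  · intro H f P Q N hf hQ hPN hN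
    obtain ⟨φ, hφ, hφf⟩ := hf.isMor
    rw [← hf.eq_homImage hφf] at hQ
    obtain ⟨ψ, hψ, hψφ⟩ := H P φ hφ hQ
    have hNe : N ≤ extensionDomain φ := by
      intro n hn
      have hnP : n ∈ Subgroup.normalizer (P : Set S) :=
        mem_normalizer_of_forall_mem (fun n hn => (hN n hn).1) hn
      obtain ⟨h, hh⟩ := (hN n hn).2
      refine ⟨hnP, h, ?_, fun x y hxy => ?_⟩
      · rw [hf.eq_homImage hφf]
        exact hf.conj_mem_normalizer hnP hh
      · rw [hφf, hφf, hxy]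
        exact hh x x.2
    obtain ⟨g, hg, hgψ⟩ := exists_isMor_of_mem_hom hψ
    refine ⟨g, hg.mono hNe, fun a ha => ?_⟩
    rw [hgψ ⟨a, le_extensionDomain φ ha⟩, ← hφf ⟨a, ha⟩]
    exact congrArg Subtype.val (DFunLike.congr_fun hψφ ⟨a, ha⟩)
  · intro H P φ hφ hQ
    obtain ⟨f, hf, hfφ⟩ := exists_isMor_of_mem_hom hφ
    obtain ⟨Q, hfQ⟩ := hf.exists_isIso
    rw [hfQ.eq_homImage fun a => (hfφ a).symm] at hQ
    obtain ⟨g, hg, hgf⟩ := H f P Q (extensionDomain φ) hfQ hQ (le_extensionDomain φ) (by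
      rintro n ⟨hn, h, -, hh⟩
      have hn' : ∀ a ∈ P, n * a * n⁻¹ ∈ P := fun a ha => (Subgroup.mem_normalizer_iff.1 hn a).1 ha
      refine ⟨hn', h, fun a ha => ?_⟩
      have := hh ⟨a, ha⟩ ⟨_, hn' a ha⟩ rfl
      rwa [← hfφ, ← hfφ] at this)
    obtain ⟨ψ, hψ, hψg⟩ := hg
    refine ⟨ψ, hψ, ?_⟩
    ext a
    rw [← hfφ, ← hgf a a.2]
    exact hψg (Subgroup.inclusion (le_extensionDomain φ) a)

theorem continuityAxiom_iff : F.ContinuityAxiom ↔ ∀ (P : ℕ → Subgroup S), Monotone P →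
    ∀ f : S → S, (∀ n, F.IsMor f (P n)) → F.IsMor f (⨆ n, P n) := by
  constructor
  · intro H P hP f hf
    have hmul : ∀ a ∈ ⨆ n, P n, ∀ b ∈ ⨆ n, P n, f (a * b) = f a * f b := by
      intro a ha b hb
      obtain ⟨i, hi⟩ := (Subgroup.mem_iSup_of_directed hP.directed_le).1 ha
      obtain ⟨j, hj⟩ := (Subgroup.mem_iSup_of_directed hP.directed_le).1 hb
      exact (hf (max i j)).map_mul (hP (le_max_left i j) hi) (hP (le_max_right i j) hj)
    refine ⟨homOfMulOn _ ⊤ f hmul fun _ _ => Subgroup.mem_top _,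
      H P hP _ fun n => (hf n).mem_hom _ fun a => rfl, fun a => rfl⟩
  · intro H P hP φ hφ
    classical
    let f : S → S := fun s => if h : s ∈ ⨆ n, P n then φ ⟨s, h⟩ else 1
    have hfφ : ∀ a : (⨆ n, P n : Subgroup S), f a = φ a := fun a => by simp [f]
    refine (H P hP f fun n => ⟨_, hφ n, fun a => ?_⟩).mem_hom φ fun a => (hfφ a).symm
    exact (hfφ (Subgroup.inclusion (le_iSup P n) a)).symm

/-- `Out_F(P)` is finite and `Aut_S(P)` has index prime to `p` in `Aut_F(P)`. -/
def HasSylowAut (p : ℕ) (F : FusionSystem S) (P : Subgroup S) : Prop :=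
  (innerAut P).relIndex (F.aut P) ≠ 0 ∧ ¬ p ∣ (autBy P).relIndex (F.aut P)

/-- Indices are unchanged on passing to quotients by `Inn(P) ≤ Aut_S(P)`, and `Aut_S(P)` is a
`p`-group. Working with indices avoids the outer automorphism groups. -/
theorem hasSylowAut_iff [Fact p.Prime] (hS : IsPGroup p S) :
    F.HasSylowAut p P ↔ Finite (F.out P) ∧
      ∃ R : Sylow p (F.out P), (R : Subgroup (F.out P)) = (outBy P).subgroupOf (F.out P) := by
  have hker : (QuotientGroup.mk' (innerAut P)).ker = innerAut P := QuotientGroup.ker_mk' _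
  have h1 : (innerAut P).relIndex (F.aut P) = Nat.card (F.out P) := by
    conv_lhs => rw [← hker]
    exact Subgroup.relIndex_ker _ _
  have h2 : ((outBy P).subgroupOf (F.out P)).index = (autBy P).relIndex (F.aut P) := by
    change ((autBy P).map (QuotientGroup.mk' (innerAut P))).relIndex
      ((F.aut P).map (QuotientGroup.mk' (innerAut P))) = _
    rw [Subgroup.relIndex_map_map, hker, sup_eq_left.2 innerAut_le_autBy,
      sup_eq_left.2 (innerAut_le_autBy.trans autBy_le_aut)]
  have hp : IsPGroup p ((outBy P).subgroupOf (F.out P)) :=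
    ((isPGroup_autBy hS P).map _).of_injective
      ((Subgroup.subgroupOfEquivOfLe (Subgroup.map_mono autBy_le_aut)).toMonoidHom)
      (MulEquiv.injective _)
  rw [HasSylowAut, h1, ← h2]
  constructor
  · rintro ⟨h3, h4⟩
    have hfin : Finite (F.out P) := Nat.finite_of_card_ne_zero h3
    exact ⟨hfin, hp.toSylow h4, rfl⟩
  · rintro ⟨hfin, R, hR⟩
    refine ⟨Nat.card_pos.ne', ?_⟩
    rw [← hR]
    exact R.not_dvd_index

theorem sylowAxiom_iff [Fact p.Prime] (hS : IsPGroup p S) : F.SylowAxiom p ↔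
    ∀ P : Subgroup S, F.FullyNormalized p P → F.FullyCentralized p P ∧ F.HasSylowAut p P :=
  forall₂_congr fun _ _ => and_congr_right fun _ => (hasSylowAut_iff hS).symm

/-- Conjugates of `P` have the same number of components, so both the ranks and the numbers of
components of their normalizers are bounded, and a maximal order is attained. -/
theorem exists_fullyNormalized [Fact p.Prime] (hS : IsPToral p S) (F : FusionSystem S)
    (P : Subgroup S) : ∃ f Q, F.IsIso f P Q ∧ F.FullyNormalized p Q := by
  obtain ⟨B, hB⟩ := hS.exists_index_normalizer_le (identityComponent P).index
  let O : Set (ℕ ×ₗ ℕ) := {o | ∃ f Q, F.IsIso f P Q ∧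
    toralOrder p (Subgroup.normalizer (Q : Set S)) = o}
  have hO : O.Finite := by
    refine (((Set.finite_Iic (toralRank p S)).prod (Set.finite_Iic B)).preimage
      (f := (ofLex : ℕ ×ₗ ℕ → ℕ × ℕ)) ofLex.injective.injOn).subset ?_
    rintro _ ⟨f, Q, hf, rfl⟩
    refine ⟨hS.toralRank_le (Subgroup.subtype_injective _), hB Q ?_⟩
    obtain ⟨e, -, -, -⟩ := hf.exists_mulEquiv
    have h1 := le_antisymm
      ((hS.subgroup P).toralOrder_le (f := e.symm.toMonoidHom) e.symm.injective)
      ((hS.subgroup Q).toralOrder_le (f := e.toMonoidHom) e.injective)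
    exact congrArg (fun o => (ofLex o).2) h1
  have hne : O.Nonempty := ⟨_, id, P, ⟨F.isMor_id P, fun b => by simp⟩, rfl⟩
  obtain ⟨_, ⟨f, Q, hf, rfl⟩, hmax⟩ := Set.exists_max_image O id hO hne
  exact ⟨f, Q, hf, fullyNormalized_iff.2 fun g R hg => hmax _ ⟨_, R, hf.trans hg, rfl⟩⟩

end Axioms

end FusionSystem

namespace FusionSystem

/-! ### Transferring axiom (I) between conjugate subgroups -/

section Transfer

variable {p : ℕ} {S : Type*} [Group S] {F : FusionSystem S} {f g : S → S} {P Q : Subgroup S}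

theorem map_aut_congr (e : P ≃* Q) (hf : F.IsIso f P Q) (he : ∀ a : P, (e a : S) = f a) :
    (F.aut P).map (MulAut.congr e).toMonoidHom = F.aut Q := by
  obtain ⟨k, hk, hkf, hfk⟩ := hf.exists_symm
  have hek : ∀ b : Q, (e.symm b : S) = k b := fun b => by
    obtain ⟨a, rfl⟩ := e.surjective b
    rw [he, hkf a a.2, e.symm_apply_apply]
  ext β
  constructor
  · rintro ⟨α, hα, rfl⟩
    obtain ⟨u, hu, hαu⟩ := mem_aut_iff.1 hα
    have huP : ∀ a ∈ P, u a ∈ P := fun a ha => by rw [← hαu ⟨a, ha⟩]; exact (α _).2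
    refine mem_aut_iff.2 ⟨fun b => f (u (k b)), (hk.isMor.comp hu fun b hb => hk.map_mem hb).comp
      hf.isMor fun b hb => huP _ (hk.map_mem hb), fun b => ?_⟩
    change ((e (α (e.symm b)) : Q) : S) = _
    rw [he, hαu, hek]
  · intro hβ
    obtain ⟨u, hu, hβu⟩ := mem_aut_iff.1 hβ
    have huQ : ∀ a ∈ Q, u a ∈ Q := fun a ha => by rw [← hβu ⟨a, ha⟩]; exact (β _).2
    refine ⟨MulAut.congr e.symm β, mem_aut_iff.2 ⟨fun a => k (u (f a)),
      (hf.isMor.comp hu fun b hb => hf.map_mem hb).comp hk.isMor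
        fun b hb => huQ _ (hf.map_mem hb), fun a => ?_⟩, ?_⟩
    · change ((e.symm (β (e a)) : P) : S) = _
      rw [hek, hβu, he]
    · ext b
      change ((e (e.symm (β (e (e.symm b)))) : Q) : S) = β b
      simp

theorem comap_innerAut_congr {S S' : Type*} [Group S] [Group S'] {P : Subgroup S}
    {Q : Subgroup S'} (e : P ≃* Q) :
    (innerAut Q).comap (MulAut.congr e).toMonoidHom = innerAut P := by
  ext α
  constructor
  · rintro ⟨q, hq⟩
    refine ⟨e.symm q, ?_⟩
    ext a
    have h1 : q * e a * q⁻¹ = e (α (e.symm (e a))) := DFunLike.congr_fun hq (e a)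
    rw [e.symm_apply_apply] at h1
    have h2 : α a = e.symm q * a * (e.symm q)⁻¹ := e.injective (by simp [← h1])
    rw [h2]
    rfl
  · rintro ⟨q, rfl⟩
    refine ⟨e q, ?_⟩
    ext b
    change ((e q * b * (e q)⁻¹ : Q) : S') = (e (q * e.symm b * q⁻¹) : Q)
    simp

theorem FullyCentralized.of_isIso_normalizer [Fact p.Prime] (hS : IsPToral p S)
    (hN : F.IsIso g (Subgroup.normalizer (P : Set S)) (Subgroup.normalizer (Q : Set S)))
    (hg : F.IsIso g P Q) (hQ : F.FullyCentralized p Q) : F.FullyCentralized p P := by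
  obtain ⟨k, hk, hkg, hgk⟩ := hN.exists_symm
  have hkQ : F.IsIso k Q P := by
    refine ⟨hk.isMor.mono Subgroup.le_normalizer, fun a => ⟨fun ha => ?_, ?_⟩⟩
    · exact ⟨g a, hg.map_mem ha, hkg a (Subgroup.le_normalizer ha)⟩
    · rintro ⟨b, hb, rfl⟩
      obtain ⟨a, ha, rfl⟩ := (hg.mem_iff b).1 hb
      rw [hkg a (Subgroup.le_normalizer ha)]
      exact ha
  have hCN : Subgroup.centralizer (Q : Set S) ≤ Subgroup.normalizer (Q : Set S) :=
    Subgroup.centralizer_le_normalizer _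
  refine hQ.of_isIso hkQ (hS.toralOrder_le_of_injOn k
    (fun a ha b hb => hk.isMor.map_mul (hCN ha) (hCN hb)) (hk.isMor.injOn.mono hCN) fun c hc => ?_)
  refine Subgroup.mem_centralizer_iff.2 fun a ha => ?_
  obtain ⟨b, hb, rfl⟩ := (hkQ.mem_iff a).1 ha
  have hb' := Subgroup.le_normalizer (H := Q) hb
  rw [← hk.isMor.map_mul hb' (hCN hc), ← hk.isMor.map_mul (hCN hc) hb',
    Subgroup.mem_centralizer_iff.1 hc b hb]

/-- An isomorphism of normalizers taking `P` to `Q` carries `Aut_S(P)` onto `Aut_S(Q)`, besides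
carrying `Aut_F(P)` onto `Aut_F(Q)`. -/
theorem HasSylowAut.of_isIso_normalizer
    (hN : F.IsIso g (Subgroup.normalizer (P : Set S)) (Subgroup.normalizer (Q : Set S)))
    (hg : F.IsIso g P Q) (hQ : F.HasSylowAut p Q) : F.HasSylowAut p P := by
  obtain ⟨e, -, -, he⟩ := hg.exists_mulEquiv
  have hP : ∀ a ∈ P, a ∈ Subgroup.normalizer (P : Set S) := fun a ha => Subgroup.le_normalizer ha
  have hauto : (autBy Q).comap (MulAut.congr e).toMonoidHom = autBy P := by
    ext α
    rw [Subgroup.mem_comap, mem_autBy_iff]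
    constructor
    · rintro ⟨m, hm⟩
      have hα' := (mem_autBy_iff (α := (MulAut.congr e).toMonoidHom α)).2 ⟨m, hm⟩
      obtain ⟨⟨m, hmN⟩, hm⟩ := hα'
      obtain ⟨n, hn, rfl⟩ := (hN.mem_iff m).1 hmN
      refine mem_autBy_iff.2 ⟨n, fun a => ?_⟩
      have h1 : g n * (e a : S) * (g n)⁻¹ = (e (α (e.symm (e a))) : Q) :=
        congrArg Subtype.val (DFunLike.congr_fun hm (e a))
      rw [e.symm_apply_apply, he, he, ← hN.isMor.map_conj hn (hP a a.2)] at h1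
      exact (hN.isMor.injOn (mul_mem (mul_mem hn (hP a a.2)) (inv_mem hn))
        (hP _ (α a).2) h1).symm
    · rintro ⟨n, rfl⟩
      refine ⟨g n, fun b => ?_⟩
      obtain ⟨a, rfl⟩ := e.surjective b
      change ((e (P.normalizerMonoidHom n (e.symm (e a))) : Q) : S) = _
      rw [e.symm_apply_apply, he, he, ← hN.isMor.map_conj n.2 (hP a a.2)]
      rfl
  rw [HasSylowAut, ← map_aut_congr e hg he, ← Subgroup.relIndex_comap, ← Subgroup.relIndex_comap,
    comap_innerAut_congr, hauto] at hQ
  exact hQ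

/-- If `ExtensionAxiom` holds, a fully normalized subgroup inherits the properties in `SylowAxiom` from
any of its conjugates. -/
theorem FullyNormalized.of_isIso_hasSylowAut [Fact p.Prime] (hS : IsPToral p S)
    (hF : F.ExtensionAxiom p) (hP : F.FullyNormalized p P) (hf : F.IsIso f P Q)
    (hQ : F.FullyCentralized p Q) (hQ' : F.HasSylowAut p Q) :
    F.FullyCentralized p P ∧ F.HasSylowAut p P := by
  obtain ⟨e, -, -, he⟩ := hf.exists_mulEquiv
  -- The `p`-group `Aut_S(P)`, transported to `Q`, is conjugated into `Aut_S(Q)`. After composing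
  -- with `γ⁻¹`, the isomorphism satisfies the extension condition on all of `N_S(P)`.
  obtain ⟨γ, hγ, hγA⟩ := exists_conj_le_of_isPGroup
    ((isPGroup_autBy hS.isPGroup P).map (MulAut.congr e).toMonoidHom)
    ((Subgroup.map_mono autBy_le_aut).trans (map_aut_congr e hf he).le) hQ'.2
  obtain ⟨u, huQ, hγu⟩ := exists_isIso_of_mem_aut (inv_mem hγ)
  have hfu := hf.trans huQ
  have hext : ∀ n ∈ Subgroup.normalizer (P : Set S), (∀ a ∈ P, n * a * n⁻¹ ∈ P) ∧
      ∃ h : S, ∀ a ∈ P, u (f (n * a * n⁻¹)) = h * u (f a) * h⁻¹ := by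
    intro n hn
    refine ⟨fun a ha => (Subgroup.mem_normalizer_iff.1 hn a).1 ha, ?_⟩
    obtain ⟨h, hh⟩ := mem_autBy_iff.1 (hγA _ ⟨P.normalizerMonoidHom ⟨n, hn⟩, ⟨_, rfl⟩, rfl⟩)
    refine ⟨h, fun a ha => ?_⟩
    have h1 := hh (γ⁻¹ (e ⟨a, ha⟩))
    have h2 : (γ⁻¹ * (MulAut.congr e).toMonoidHom (P.normalizerMonoidHom ⟨n, hn⟩) * γ)
        (γ⁻¹ (e ⟨a, ha⟩)) = γ⁻¹ (e (P.normalizerMonoidHom ⟨n, hn⟩ ⟨a, ha⟩)) := by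
      change γ⁻¹ (e (P.normalizerMonoidHom ⟨n, hn⟩ (e.symm (γ (γ⁻¹ (e ⟨a, ha⟩)))))) = _
      rw [MulAut.apply_inv_self, e.symm_apply_apply]
    rw [h2, hγu, hγu, he, he] at h1
    exact h1
  obtain ⟨g, hg, hgf⟩ := extensionAxiom_iff.1 hF _ P Q _ hfu hQ Subgroup.le_normalizer hext
  have hgPQ : F.IsIso g P Q := hfu.congr hgf
  have hgN : ∀ n ∈ Subgroup.normalizer (P : Set S), g n ∈ Subgroup.normalizer (Q : Set S) :=
    fun n hn => hgPQ.conj_mem_normalizer hn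
      fun a ha => hg.map_conj hn (Subgroup.le_normalizer (H := P) ha)
  -- The extension embeds `N_S(P)` in `N_S(Q)`; since `P` is fully normalized, it is onto.
  have hsurj := hS.surjOn_of_toralOrder_le g (fun a ha b hb => hg.map_mul ha hb) hg.injOn hgN
    (fullyNormalized_iff.1 hP _ _ hgPQ)
  have hN : F.IsIso g (Subgroup.normalizer (P : Set S)) (Subgroup.normalizer (Q : Set S)) :=
    ⟨hg, fun b => ⟨hsurj b, by rintro ⟨a, ha, rfl⟩; exact hgN a ha⟩⟩
  exact ⟨hQ.of_isIso_normalizer hS hN hgPQ, hQ'.of_isIso_normalizer hN hgPQ⟩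

end Transfer

/-! ### Morphisms of `C_F(x)` as morphisms of `F` on `P⟨x⟩` fixing `x` -/

section Centralizer

variable {p : ℕ} {S : Type*} [Group S] {F : FusionSystem S} {x : S}

open Classical in
/-- The retraction of `S` onto the set `C_S(x)` which is `1` outside `C_S(x)`. -/
noncomputable def toCentralizer (x : S) (s : S) : elemCentralizer x :=
  if h : s ∈ elemCentralizer x then ⟨s, h⟩ else 1

theorem coe_toCentralizer {s : S} (h : s ∈ elemCentralizer x) : (toCentralizer x s : S) = s := by
  rw [toCentralizer, dif_pos h]

theorem toCentralizer_coe (s : elemCentralizer x) : toCentralizer x s = s :=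
  Subtype.ext (coe_toCentralizer s.2)

theorem toCentralizer_mul {s t : S} (hs : s ∈ elemCentralizer x) (ht : t ∈ elemCentralizer x) :
    toCentralizer x (s * t) = toCentralizer x s * toCentralizer x t :=
  Subtype.ext (by
    rw [Subgroup.coe_mul, coe_toCentralizer hs, coe_toCentralizer ht,
      coe_toCentralizer (mul_mem hs ht)])

theorem mem_elemCentralizer_iff {s : S} : s ∈ elemCentralizer x ↔ s * x = x * s :=
  Subgroup.mem_centralizer_singleton_iff

theorem zpow_commute (s : elemCentralizer x) (k : ℤ) : Commute (s : S) (x ^ k) :=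
  (show Commute (s : S) x from mem_elemCentralizer_iff.1 s.2).zpow_right k

theorem mem_joinElem {P : Subgroup (elemCentralizer x)} {s : S} :
    s ∈ joinElem P ↔ ∃ a ∈ P, ∃ k : ℤ, s = a * x ^ k := by
  constructor
  · let K : Subgroup S :=
      { carrier := {s | ∃ a ∈ P, ∃ k : ℤ, s = a * x ^ k}
        one_mem' := ⟨1, one_mem _, 0, by simp⟩
        mul_mem' := by
          rintro _ _ ⟨a, ha, k, rfl⟩ ⟨b, hb, l, rfl⟩
          refine ⟨a * b, mul_mem ha hb, k + l, ?_⟩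
          rw [zpow_add, Subgroup.coe_mul, mul_assoc, ← mul_assoc (x ^ k), ← (zpow_commute b k).eq]
          simp only [mul_assoc]
        inv_mem' := by
          rintro _ ⟨a, ha, k, rfl⟩
          refine ⟨a⁻¹, inv_mem ha, -k, ?_⟩
          rw [(zpow_commute a k).eq, mul_inv_rev, zpow_neg, Subgroup.coe_inv] }
    have hle : joinElem P ≤ K := by
      refine sup_le ?_ ?_
      · rintro _ ⟨a, ha, rfl⟩
        exact ⟨a, ha, 0, by simp⟩
      · rw [Subgroup.zpowers_le]
        exact ⟨1, one_mem _, 1, by simp⟩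
    exact fun hs => hle hs
  · rintro ⟨a, ha, k, rfl⟩
    exact mul_mem (coe_mem_joinElem ⟨a, ha⟩) (zpow_mem (elem_mem_joinElem P) k)

theorem joinElem_le (P : Subgroup (elemCentralizer x)) : joinElem P ≤ elemCentralizer x :=
  sup_le (Subgroup.map_subtype_le P) (by
    rw [Subgroup.zpowers_le]
    exact mem_elemCentralizer_self x)

theorem joinElem_subgroupOf {P : Subgroup S} (hx : x ∈ P) (hP : P ≤ elemCentralizer x) :
    joinElem (P.subgroupOf (elemCentralizer x)) = P := by
  rw [joinElem, Subgroup.subgroupOf_map_subtype, inf_eq_left.2 hP, sup_eq_left,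
    Subgroup.zpowers_le]
  exact hx

theorem IsMor.mem_elemCentralizer {g : S → S} {R : Subgroup S} (hg : F.IsMor g R) (hxR : x ∈ R)
    {a : S} (ha : a ∈ R) (hax : a ∈ elemCentralizer x) : g a ∈ elemCentralizer (g x) := by
  rw [mem_elemCentralizer_iff] at hax ⊢
  rw [← hg.map_mul ha hxR, ← hg.map_mul hxR ha, hax]

theorem isMor_centralizer_iff {f : elemCentralizer x → elemCentralizer x}
    {P : Subgroup (elemCentralizer x)} : (F.centralizer x).IsMor f P ↔
      ∃ g, F.IsMor g (joinElem P) ∧ g x = x ∧ ∀ a ∈ P, g a = f a := by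
  constructor
  · rintro ⟨φ, ⟨ψ, hψ, hx, h⟩, hφ⟩
    obtain ⟨g, hg, hgψ⟩ := exists_isMor_of_mem_hom hψ
    refine ⟨g, hg, (hgψ ⟨x, elem_mem_joinElem P⟩).trans hx, fun a ha => ?_⟩
    rw [← hφ ⟨a, ha⟩, ← h ⟨a, ha⟩]
    exact hgψ ⟨a, coe_mem_joinElem ⟨a, ha⟩⟩
  · rintro ⟨g, hg, hx, h⟩
    have hgC : ∀ a ∈ joinElem P, g a ∈ joinElem (⊤ : Subgroup (elemCentralizer x)) := by
      intro a ha
      have := hg.mem_elemCentralizer (elem_mem_joinElem P) ha (joinElem_le P ha)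
      rw [hx] at this
      exact coe_mem_joinElem ⟨(⟨_, this⟩ : elemCentralizer x), Subgroup.mem_top _⟩
    have hP : ∀ a ∈ P, (a : S) ∈ joinElem P := fun a ha => coe_mem_joinElem ⟨a, ha⟩
    refine ⟨homOfMulOn P ⊤ f (fun a ha b hb => Subtype.ext ?_) fun _ _ => Subgroup.mem_top _,
      ⟨homOfMulOn _ _ g (fun a ha b hb => hg.map_mul ha hb) hgC, hg.mem_hom _ fun a => rfl, hx,
        fun a => h a a.2⟩, fun a => rfl⟩
    rw [Subgroup.coe_mul, ← h _ (mul_mem ha hb), ← h a ha, ← h b hb]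
    exact hg.map_mul (hP a ha) (hP b hb)

theorem IsIso.exists_of_centralizer {f : elemCentralizer x → elemCentralizer x}
    {P Q : Subgroup (elemCentralizer x)} (hf : (F.centralizer x).IsIso f P Q) :
    ∃ g, F.IsIso g (joinElem P) (joinElem Q) ∧ g x = x ∧ ∀ a ∈ P, g a = f a := by
  obtain ⟨g, hg, hx, h⟩ := isMor_centralizer_iff.1 hf.isMor
  have hgm : ∀ a ∈ P, ∀ k : ℤ, g (a * x ^ k) = f a * x ^ k := fun a ha k => by
    rw [hg.map_mul (coe_mem_joinElem ⟨a, ha⟩) (zpow_mem (elem_mem_joinElem P) k), h a ha,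
      hg.map_zpow (elem_mem_joinElem P), hx]
  refine ⟨g, ⟨hg, fun b => ⟨fun hb => ?_, ?_⟩⟩, hx, h⟩
  · obtain ⟨b, hbQ, k, rfl⟩ := mem_joinElem.1 hb
    obtain ⟨a, ha, rfl⟩ := (hf.mem_iff b).1 hbQ
    exact ⟨a * x ^ k, mem_joinElem.2 ⟨a, ha, k, rfl⟩, hgm a ha k⟩
  · rintro ⟨_, ha', rfl⟩
    obtain ⟨a, ha, k, rfl⟩ := mem_joinElem.1 ha'
    rw [hgm a ha k]
    exact mem_joinElem.2 ⟨f a, hf.map_mem ha, k, rfl⟩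

theorem IsIso.exists_centralizer {g : S → S} {P : Subgroup (elemCentralizer x)} {R : Subgroup S}
    (hg : F.IsIso g (joinElem P) R) (hx : g x = x) :
    ∃ f Q, (F.centralizer x).IsIso f P Q ∧ joinElem Q = R ∧ ∀ a ∈ P, (f a : S) = g a := by
  have hP : ∀ a ∈ P, (a : S) ∈ joinElem P := fun a ha => coe_mem_joinElem ⟨a, ha⟩
  have hgC : ∀ a ∈ P, g a ∈ elemCentralizer x := by
    intro a ha
    have := hg.isMor.mem_elemCentralizer (elem_mem_joinElem P) (hP a ha) a.2
    rwa [hx] at this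
  have hfa : ∀ a ∈ P, (toCentralizer x (g a) : S) = g a := fun a ha => coe_toCentralizer (hgC a ha)
  have hf : (F.centralizer x).IsMor (fun a => toCentralizer x (g a)) P :=
    isMor_centralizer_iff.2 ⟨g, hg.isMor, hx, fun a ha => (hfa a ha).symm⟩
  obtain ⟨Q, hQ⟩ := hf.exists_isIso
  refine ⟨_, Q, hQ, ?_, hfa⟩
  obtain ⟨g', hg', hx', h'⟩ := hQ.exists_of_centralizer
  have hgg : ∀ a ∈ joinElem P, g' a = g a := by
    intro s hs
    obtain ⟨a, ha, k, rfl⟩ := mem_joinElem.1 hs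
    have hk := zpow_mem (elem_mem_joinElem P) k
    rw [hg'.isMor.map_mul (hP a ha) hk, hg.isMor.map_mul (hP a ha) hk, h' a ha, hfa a ha,
      hg.isMor.map_zpow (elem_mem_joinElem P), hg'.isMor.map_zpow (elem_mem_joinElem P), hx, hx']
  ext b
  rw [hg'.mem_iff, hg.mem_iff]
  exact exists_congr fun a => and_congr_right fun ha => by rw [hgg a ha]

theorem mem_centralizer_joinElem {P : Subgroup (elemCentralizer x)} {s : S} :
    s ∈ Subgroup.centralizer (joinElem P : Set S) ↔
      s ∈ elemCentralizer x ∧ ∀ a ∈ P, (a : S) * s = s * a := by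
  rw [Subgroup.mem_centralizer_iff]
  constructor
  · intro h
    exact ⟨mem_elemCentralizer_iff.2 (h x (elem_mem_joinElem P)).symm,
      fun a ha => h a (coe_mem_joinElem ⟨a, ha⟩)⟩
  · rintro ⟨hs, h⟩ b hb
    obtain ⟨a, ha, k, rfl⟩ := mem_joinElem.1 hb
    exact (show Commute (a : S) s from h a ha).mul_left (zpow_commute ⟨s, hs⟩ k).symm

/-- The two groups coincide inside `S`: centralizing `P⟨x⟩` means lying in `C_S(x)` and centralizing
`P`. -/
theorem toralOrder_centralizer_joinElem [Fact p.Prime] (hS : IsPToral p S)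
    (P : Subgroup (elemCentralizer x)) :
    toralOrder p (Subgroup.centralizer (joinElem P : Set S)) =
      toralOrder p (Subgroup.centralizer (P : Set (elemCentralizer x))) := by
  have hC : ∀ s ∈ Subgroup.centralizer (joinElem P : Set S), s ∈ elemCentralizer x :=
    fun s hs => (mem_centralizer_joinElem.1 hs).1
  apply le_antisymm
  · refine (hS.subgroup (elemCentralizer x)).toralOrder_le_of_injOn (toCentralizer x)
      (fun a ha b hb => toCentralizer_mul (hC a ha) (hC b hb)) (fun a ha b hb hab => ?_)
      fun s hs => Subgroup.mem_centralizer_iff.2 fun a ha => Subtype.ext ?_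
    · rw [← coe_toCentralizer (hC a ha), hab, coe_toCentralizer (hC b hb)]
    · rw [Subgroup.coe_mul, Subgroup.coe_mul, coe_toCentralizer (hC s hs)]
      exact (mem_centralizer_joinElem.1 hs).2 a ha
  · refine hS.toralOrder_le_of_injOn Subtype.val (fun _ _ _ _ => rfl)
      Subtype.val_injective.injOn fun s hs => mem_centralizer_joinElem.2 ⟨s.2, fun a ha => ?_⟩
    exact congrArg Subtype.val (Subgroup.mem_centralizer_iff.1 hs a ha)

end Centralizer

end FusionSystem

/-! ### From saturated centralizers to axioms (I) and (II) -/

namespace FusionSystem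

variable {p : ℕ} {S : Type*} [Group S] {F : FusionSystem S}

/-- Each morphism of `F` sending an element `x` to `y` agrees on `x` with a morphism defined on
`C_S(x)`. -/
def IsReceptive (F : FusionSystem S) (y : S) : Prop :=
  ∀ x f, F.IsMor f (Subgroup.zpowers x) → f x = y →
    ∃ ρ, F.IsMor ρ (elemCentralizer x) ∧ ρ x = y

theorem toralOrder_centralizer_le [Fact p.Prime] (hS : IsPToral p S) {ρ : S → S}
    {P Q D : Subgroup S} (hρ : F.IsMor ρ D) (hCD : Subgroup.centralizer (P : Set S) ≤ D)
    (hPD : P ≤ D) (hPQ : F.IsIso ρ P Q) :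
    toralOrder p (Subgroup.centralizer (P : Set S)) ≤
      toralOrder p (Subgroup.centralizer (Q : Set S)) := by
  refine hS.toralOrder_le_of_injOn ρ (fun a ha b hb => hρ.map_mul (hCD ha) (hCD hb))
    (hρ.injOn.mono hCD) fun c hc => Subgroup.mem_centralizer_iff.2 fun b hb => ?_
  obtain ⟨a, ha, rfl⟩ := (hPQ.mem_iff b).1 hb
  rw [← hρ.map_mul (hPD ha) (hCD hc), ← hρ.map_mul (hCD hc) (hPD ha),
    Subgroup.mem_centralizer_iff.1 hc a ha]

theorem IsMor.isIso_of_le {f : S → S} {P R : Subgroup S} (hf : F.IsMor f P) (h : R ≤ P) :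
    ∃ Q, F.IsIso f R Q :=
  (hf.mono h).exists_isIso

theorem centralizer_le_elemCentralizer {P : Subgroup S} {x : S} (hx : x ∈ P) :
    Subgroup.centralizer (P : Set S) ≤ elemCentralizer x := fun _ hs =>
  mem_elemCentralizer_iff.2 (Subgroup.mem_centralizer_iff.1 hs x hx).symm

/-- Any `F`-conjugate `R` of `P⟨y⟩` is moved back, by a morphism defined on a whole element
centralizer containing `R` and `C_S(R)`, to some `Q⟨y⟩` with `Q` conjugate to `P` in `C_F(y)`. This
embeds `C_S(R)` in `C_S(Q⟨y⟩)`. -/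
theorem IsReceptive.fullyCentralized_joinElem [Fact p.Prime] (hS : IsPToral p S) {y : S}
    (hy : F.IsReceptive y) {P : Subgroup (elemCentralizer y)}
    (hP : (F.centralizer y).FullyCentralized p P) : F.FullyCentralized p (joinElem P) := by
  refine fullyCentralized_iff.2 fun g R hg => ?_
  obtain ⟨k, hk, hkg, -⟩ := hg.exists_symm
  have hyP := elem_mem_joinElem P
  have hgy : g y ∈ R := hg.map_mem hyP
  obtain ⟨ρ, hρ, hρy⟩ := hy (g y) k (hk.isMor.mono (by rwa [Subgroup.zpowers_le])) (hkg y hyP)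
  have hRC : R ≤ elemCentralizer (g y) := fun b hb => by
    obtain ⟨a, ha, rfl⟩ := (hg.mem_iff b).1 hb
    exact hg.isMor.mem_elemCentralizer hyP ha (joinElem_le P ha)
  obtain ⟨R', hR'⟩ := hρ.isIso_of_le hRC
  obtain ⟨f, Q, hf, rfl, -⟩ := (hg.trans hR').exists_centralizer hρy
  calc toralOrder p (Subgroup.centralizer (R : Set S))
      ≤ toralOrder p (Subgroup.centralizer (joinElem Q : Set S)) :=
        toralOrder_centralizer_le hS hρ (centralizer_le_elemCentralizer hgy) hRC hR'
    _ = _ := toralOrder_centralizer_joinElem hS Q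
    _ ≤ _ := fullyCentralized_iff.1 hP f Q hf
    _ = _ := (toralOrder_centralizer_joinElem hS P).symm

theorem FullyCentralized.of_joinElem [Fact p.Prime] (hS : IsPToral p S) {y : S}
    {P : Subgroup (elemCentralizer y)} (hP : F.FullyCentralized p (joinElem P)) :
    (F.centralizer y).FullyCentralized p P := by
  refine fullyCentralized_iff.2 fun f Q hf => ?_
  obtain ⟨g, hg, -, -⟩ := hf.exists_of_centralizer
  rw [← toralOrder_centralizer_joinElem hS, ← toralOrder_centralizer_joinElem hS]
  exact fullyCentralized_iff.1 hP g _ hg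

/-- `Aut_S(P)` is detected in the centralizer of `y ∈ Z(P)` if it fixes `y` and the stabilizer of
`y` in `Aut_F(P)` has index prime to `p`. -/
theorem HasSylowAut.of_centralizer [Fact p.Prime] {y : S} {P : Subgroup S}
    (hyP : y ∈ P) (hN : Subgroup.normalizer (P : Set S) ≤ elemCentralizer y)
    (hst : ¬ p ∣ (MulAction.stabilizer (MulAut P) (⟨y, hyP⟩ : P)).relIndex (F.aut P))
    (h : (F.centralizer y).HasSylowAut p (P.subgroupOf (elemCentralizer y))) :
    F.HasSylowAut p P := by
  have hPC : P ≤ elemCentralizer y := Subgroup.le_normalizer.trans hN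
  have hj := joinElem_subgroupOf hyP hPC
  let e : P.subgroupOf (elemCentralizer y) ≃* P := Subgroup.subgroupOfEquivOfLe hPC
  have he : ∀ a : P.subgroupOf (elemCentralizer y), (e a : S) = a := fun a => rfl
  have hes : ∀ a : P, ((e.symm a : P.subgroupOf (elemCentralizer y)) : S) = a := fun a => rfl
  -- Since `y ∈ P`, the automorphisms of `P` in `C_F(y)` are those in `F` fixing `y`. The index of
  -- `Aut_S(P)` in `Aut_F(P)` thus factors through the stabilizer of `y`.
  have hmap : ((F.centralizer y).aut (P.subgroupOf (elemCentralizer y))).map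
      (MulAut.congr e).toMonoidHom =
        MulAction.stabilizer (MulAut P) (⟨y, hyP⟩ : P) ⊓ F.aut P := by
    ext β
    constructor
    · rintro ⟨α, hα, rfl⟩
      obtain ⟨f, hf, hfα⟩ := mem_aut_iff.1 hα
      obtain ⟨g, hg, hgy, hgf⟩ := isMor_centralizer_iff.1 hf
      rw [hj] at hg
      have key : ∀ a : P, (((MulAut.congr e).toMonoidHom α a : P) : S) = g a := fun a => by
        change ((α (e.symm a) : P.subgroupOf (elemCentralizer y)) : S) = g a
        rw [hfα, ← hgf _ (e.symm a).2, hes]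
      exact ⟨MulAction.mem_stabilizer_iff.2 (Subtype.ext ((key ⟨y, hyP⟩).trans hgy)),
        mem_aut_iff.2 ⟨g, hg, key⟩⟩
    · rintro ⟨hβ, hβ'⟩
      obtain ⟨g, hg, hgβ⟩ := mem_aut_iff.1 hβ'
      have hgy : g y = y := by
        rw [← hgβ ⟨y, hyP⟩]
        exact congrArg Subtype.val (MulAction.mem_stabilizer_iff.1 hβ)
      refine ⟨MulAut.congr e.symm β, mem_aut_iff.2 ⟨fun a => toCentralizer y (g a),
        isMor_centralizer_iff.2 ⟨g, by rwa [hj], hgy, fun a ha => ?_⟩, fun a => Subtype.ext ?_⟩, ?_⟩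
      · rw [coe_toCentralizer]
        rw [← hgβ ⟨a, ha⟩]
        exact hPC (β _).2
      · change ((β (e a) : P) : S) = _
        rw [coe_toCentralizer]
        · exact hgβ _
        · change g (e a) ∈ _
          rw [← hgβ]
          exact hPC (β _).2
      · ext a
        rfl
  have hauto : (autBy P).comap (MulAut.congr e).toMonoidHom =
      autBy (P.subgroupOf (elemCentralizer y)) := by
    ext α
    rw [Subgroup.mem_comap]
    constructor
    · rintro ⟨n, hn⟩
      refine mem_autBy_iff.2 ⟨⟨n, hN n.2⟩, fun a => Subtype.ext ?_⟩
      exact (congrArg Subtype.val (DFunLike.congr_fun hn (e a))).symm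
    · intro h
      obtain ⟨n, hn⟩ := mem_autBy_iff.1 h
      exact mem_autBy_iff.2 ⟨n, fun a => congrArg Subtype.val (hn (e.symm a))⟩
  have hA : autBy P ≤ MulAction.stabilizer (MulAut P) (⟨y, hyP⟩ : P) ⊓ F.aut P := by
    refine le_inf ?_ autBy_le_aut
    rintro _ ⟨n, rfl⟩
    refine MulAction.mem_stabilizer_iff.2 (Subtype.ext ?_)
    change (n : S) * y * (n : S)⁻¹ = y
    rw [mem_elemCentralizer_iff.1 (hN n.2), mul_inv_cancel_right]
  rw [HasSylowAut, ← comap_innerAut_congr e, ← hauto, Subgroup.relIndex_comap,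
    Subgroup.relIndex_comap, hmap] at h
  constructor
  · rw [← Subgroup.relIndex_mul_relIndex _ _ _ (innerAut_le_autBy.trans hA) inf_le_right,
      Subgroup.inf_relIndex_right]
    exact mul_ne_zero h.1 fun h0 => hst (h0 ▸ dvd_zero p)
  · rw [← Subgroup.relIndex_mul_relIndex _ _ _ hA inf_le_right, Subgroup.inf_relIndex_right]
    exact fun hd => ((Nat.Prime.dvd_mul Fact.out).1 hd).elim h.2 hst

theorem hasSylowAut_of_subsingleton [Fact p.Prime] {P : Subgroup S} [Subsingleton P] :
    F.HasSylowAut p P := by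
  have h : ∀ A : Subgroup (MulAut P), A.relIndex (F.aut P) = 1 := fun A => by
    refine Subgroup.relIndex_eq_one.2 fun α _ => ?_
    rw [show α = 1 from MulEquiv.ext fun a => Subsingleton.elim _ _]
    exact one_mem A
  rw [HasSylowAut, h, h]
  exact ⟨one_ne_zero, (Fact.out : p.Prime).one_lt.ne' ∘ Nat.dvd_one.1⟩

theorem fullyCentralized_of_eq_bot {P : Subgroup S} (hP : P = ⊥) : F.FullyCentralized p P := by
  refine fullyCentralized_iff.2 fun f Q hf => ?_
  have : Q = P := by
    ext b
    rw [hf.mem_iff, hP]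
    simp only [Subgroup.mem_bot, exists_eq_left, hf.isMor.map_one]
    exact eq_comm
  rw [this]

/-- Each element of order `p` is conjugate to an element `y` for which each morphism to `y` extends
to centralizers and `C_F(y)` is saturated. -/
def IsLocallySaturated (p : ℕ) (F : FusionSystem S) : Prop :=
  ∀ x : S, orderOf x = p → ∃ y f, F.IsMor f (Subgroup.zpowers x) ∧ f x = y ∧ F.IsReceptive y ∧
    (F.centralizer y).IsSaturated p

/-- A central `x` of order `p` fixed by `Aut_S(P)` gives `N_S(P) ≤ C_S(x)`, so receptivity carries
`N_S(P)` along with `P`. As `P` is fully normalized, its image `Q` has an isomorphic normalizer,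
contained in `C_S(y)`; axiom (I) for `Q` in `C_F(y)` lifts to `F` and returns to `P`. -/
theorem IsLocallySaturated.sylowAxiom [Fact p.Prime] (hS : IsPToral p S)
    (hF : F.IsLocallySaturated p) : F.SylowAxiom p := by
  refine (sylowAxiom_iff hS.isPGroup).2 fun P hP => ?_
  by_cases hPt : P = ⊥
  · have : Subsingleton P := by rw [hPt]; infer_instance
    exact ⟨fullyCentralized_of_eq_bot hPt, hasSylowAut_of_subsingleton⟩
  have : Nontrivial P := (Subgroup.nontrivial_iff_ne_bot P).2 hPt
  obtain ⟨x, hxc, hxp, hxA, hst⟩ := (hS.subgroup P).exists_fixed_orderOf_eq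
    (isPGroup_autBy hS.isPGroup P) (autBy_le_aut (F := F))
  obtain ⟨y, u, hu, huy, hy, hsat⟩ := hF x (by rw [Subgroup.orderOf_coe, hxp])
  obtain ⟨ρ, hρ, hρy⟩ := hy x u hu huy
  have hNC : Subgroup.normalizer (P : Set S) ≤ elemCentralizer (x : S) := fun n hn => by
    have h1 : n * x * n⁻¹ = x := congrArg Subtype.val (hxA _ ⟨⟨n, hn⟩, rfl⟩)
    exact mem_elemCentralizer_iff.2 (mul_inv_eq_iff_eq_mul.1 h1)
  have hPC : P ≤ elemCentralizer (x : S) := Subgroup.le_normalizer.trans hNC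
  obtain ⟨Q, hQ⟩ := hρ.isIso_of_le hPC
  have hρN : ∀ n ∈ Subgroup.normalizer (P : Set S), ρ n ∈ Subgroup.normalizer (Q : Set S) :=
    fun n hn => hQ.conj_mem_normalizer hn fun a ha => hρ.map_conj (hNC hn) (hPC ha)
  have hle := fullyNormalized_iff.1 hP _ _ hQ
  have hge := hS.toralOrder_le_of_injOn ρ (fun a ha b hb => hρ.map_mul (hNC ha) (hNC hb))
    (hρ.injOn.mono hNC) hρN
  have hsurj := hS.surjOn_of_toralOrder_le ρ (fun a ha b hb => hρ.map_mul (hNC ha) (hNC hb))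
    (hρ.injOn.mono hNC) hρN hle
  have hN : F.IsIso ρ (Subgroup.normalizer (P : Set S)) (Subgroup.normalizer (Q : Set S)) :=
    ⟨hρ.mono hNC, fun b => ⟨hsurj b, by rintro ⟨a, ha, rfl⟩; exact hρN a ha⟩⟩
  have hyQ : y ∈ Q := hρy ▸ hQ.map_mem x.2
  have hNQC : Subgroup.normalizer (Q : Set S) ≤ elemCentralizer y := fun m hm => by
    obtain ⟨n, hn, rfl⟩ := (hN.mem_iff m).1 hm
    rw [← hρy]
    exact hρ.mem_elemCentralizer (mem_elemCentralizer_self _) (hNC hn) (hNC hn)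
  have hQC : Q ≤ elemCentralizer y := Subgroup.le_normalizer.trans hNQC
  have hj := joinElem_subgroupOf hyQ hQC
  have hQfn : F.FullyNormalized p Q := hP.of_isIso hQ hge
  -- A `C_F(y)`-conjugate `R` of `Q` contains `y`, so `R⟨y⟩ = R` is an `F`-conjugate of `Q`; and
  -- `N_S(Q)` already lies in `C_S(y)`.
  have hQE : (F.centralizer y).FullyNormalized p (Q.subgroupOf (elemCentralizer y)) := by
    refine fullyNormalized_iff.2 fun f R hf => ?_
    obtain ⟨g, hg, -, -⟩ := hf.exists_of_centralizer
    rw [hj] at hg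
    have hxR : ∃ r ∈ R, (r : S) = y := by
      have h1 : (⟨y, mem_elemCentralizer_self y⟩ : elemCentralizer y) ∈
          Q.subgroupOf (elemCentralizer y) := hyQ
      obtain ⟨g', hg', hgy', hgf'⟩ := isMor_centralizer_iff.1 hf.isMor
      exact ⟨_, hf.map_mem h1, by rw [← hgf' _ h1]; exact hgy'⟩
    have hRj : joinElem R = R.map (elemCentralizer y).subtype := by
      rw [joinElem, sup_eq_left, Subgroup.zpowers_le]
      exact hxR
    calc toralOrder p (Subgroup.normalizer (R : Set (elemCentralizer y)))
        ≤ toralOrder p (Subgroup.normalizer (joinElem R : Set S)) := by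
          refine hS.toralOrder_le_of_injOn Subtype.val (fun _ _ _ _ => rfl)
            Subtype.val_injective.injOn fun n hn => ?_
          rw [hRj]
          refine Subgroup.mem_normalizer_iff.2 fun a => ⟨?_, ?_⟩
          · rintro ⟨r, hr, rfl⟩
            exact ⟨_, (Subgroup.mem_normalizer_iff.1 hn r).1 hr, rfl⟩
          · rintro ⟨r, hr, hra⟩
            refine ⟨n⁻¹ * r * n, (Subgroup.mem_normalizer_iff.1 hn _).2 ?_, ?_⟩
            · simpa [mul_assoc] using hr
            · change (n : S)⁻¹ * r * n = a
              rw [show (r : S) = n * a * (n : S)⁻¹ from hra]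
              simp [mul_assoc]
      _ ≤ toralOrder p (Subgroup.normalizer (Q : Set S)) := fullyNormalized_iff.1 hQfn g _ hg
      _ ≤ _ := by
          refine (hS.subgroup (elemCentralizer y)).toralOrder_le_of_injOn (toCentralizer y)
            (fun a ha b hb => toCentralizer_mul (hNQC ha) (hNQC hb)) (fun a ha b hb hab => ?_)
            fun n hn => Subgroup.mem_normalizer_iff.2 fun a => ?_
          · rw [← coe_toCentralizer (hNQC ha), hab, coe_toCentralizer (hNQC hb)]
          · rw [Subgroup.mem_subgroupOf, Subgroup.mem_subgroupOf, Subgroup.coe_mul,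
              Subgroup.coe_mul, Subgroup.coe_inv, coe_toCentralizer (hNQC hn)]
            exact Subgroup.mem_normalizer_iff.1 hn a
  obtain ⟨hfc, hsyl⟩ := (sylowAxiom_iff (hS.subgroup _).isPGroup).1 hsat.sylowAxiom _ hQE
  have hQfc := hy.fullyCentralized_joinElem hS hfc
  rw [hj] at hQfc
  refine ⟨hQfc.of_isIso_normalizer hS hN hQ, HasSylowAut.of_isIso_normalizer hN hQ
    (HasSylowAut.of_centralizer hyQ hNQC ?_ hsyl)⟩
  obtain ⟨e, -, -, he⟩ := hQ.exists_mulEquiv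
  have hex : e x = ⟨y, hyQ⟩ := Subtype.ext ((he x).trans hρy)
  rw [← map_aut_congr e hQ he, ← Subgroup.relIndex_comap]
  convert hst using 2
  congr 1
  ext α
  rw [Subgroup.mem_comap, MulAction.mem_stabilizer_iff, MulAction.mem_stabilizer_iff, ← hex]
  change e (α (e.symm (e x))) = e x ↔ α x = x
  rw [e.symm_apply_apply, e.injective.eq_iff]

/-- Choose `x'` central of order `p` in the target `Q`, fixed by `Aut_S(Q)`, and let `x` be its
preimage. Then `N ≤ C_S(x)` and `N_S(Q) ≤ C_S(x')`. Morphisms `ρ` and `ρ'` move `x` and `x'` to the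
same `y`, which turns `f` into a morphism of `C_F(y)`; its extension is pulled back along `ρ'`. -/
theorem IsLocallySaturated.extensionAxiom [Fact p.Prime] (hS : IsPToral p S)
    (hF : F.IsLocallySaturated p) : F.ExtensionAxiom p := by
  refine extensionAxiom_iff.2 fun f P Q N hf hQ hPN hN => ?_
  by_cases hPt : P = ⊥
  · refine ⟨id, F.isMor_id N, fun a ha => ?_⟩
    rw [hPt, Subgroup.mem_bot] at ha
    rw [ha, hf.isMor.map_one]
    rfl
  have hQt : Nontrivial Q := by
    have : Nontrivial P := (Subgroup.nontrivial_iff_ne_bot P).2 hPt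
    obtain ⟨e, -, -, -⟩ := hf.exists_mulEquiv
    exact e.symm.toEquiv.nontrivial
  obtain ⟨x', hxc, hxp, hxA, -⟩ := (hS.subgroup Q).exists_fixed_orderOf_eq
    (isPGroup_autBy hS.isPGroup Q) (autBy_le_aut (F := F))
  have hNQ : Subgroup.normalizer (Q : Set S) ≤ elemCentralizer (x' : S) := fun n hn => by
    have h1 : n * x' * n⁻¹ = x' := congrArg Subtype.val (hxA _ ⟨⟨n, hn⟩, rfl⟩)
    exact mem_elemCentralizer_iff.2 (mul_inv_eq_iff_eq_mul.1 h1)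
  have hQC : Q ≤ elemCentralizer (x' : S) := Subgroup.le_normalizer.trans hNQ
  obtain ⟨x, hxP, hfx⟩ := (hf.mem_iff _).1 x'.2
  have hNP : ∀ n ∈ N, n ∈ Subgroup.normalizer (P : Set S) := fun n hn =>
    mem_normalizer_of_forall_mem (fun n hn => (hN n hn).1) hn
  -- `c n` induces on `Q` the automorphism corresponding under `f` to conjugation by `n`. It fixes
  -- `x'`, so `n` centralizes `x`.
  choose! c hc using fun n hn => (hN n hn).2
  have hcN : ∀ n ∈ N, c n ∈ Subgroup.normalizer (Q : Set S) := fun n hn =>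
    hf.conj_mem_normalizer (hNP n hn) (hc n hn)
  have hNC : N ≤ elemCentralizer x := fun n hn => by
    have h1 := hc n hn x hxP
    rw [hfx, mem_elemCentralizer_iff.1 (hNQ (hcN n hn)), mul_inv_cancel_right, ← hfx] at h1
    have h2 := hf.isMor.injOn ((hN n hn).1 x hxP) hxP h1
    exact mem_elemCentralizer_iff.2 (mul_inv_eq_iff_eq_mul.1 h2)
  have hPC : P ≤ elemCentralizer x := hPN.trans hNC
  obtain ⟨y, u, hu, huy, hy, hsat⟩ := hF x' (by rw [Subgroup.orderOf_coe, hxp])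
  obtain ⟨ρ', hρ', hρy'⟩ := hy x' u hu huy
  obtain ⟨ρ, hρ, hρy⟩ := hy x (fun a => u (f a))
    ((hf.isMor.mono (by rwa [Subgroup.zpowers_le])).comp hu (by
      rintro _ ⟨k, rfl⟩
      change f (x ^ k) ∈ _
      rw [hf.isMor.map_zpow hxP, hfx]
      exact ⟨k, rfl⟩)) (by rw [hfx, huy])
  obtain ⟨P₁, hP₁⟩ := hρ.isIso_of_le hPC
  obtain ⟨Q₁, hQ₁⟩ := hρ'.isIso_of_le hQC
  obtain ⟨N₁, hN₁⟩ := hρ.isIso_of_le hNC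
  obtain ⟨k, hk, hkρ, -⟩ := hP₁.exists_symm
  have hψ := (hk.trans hf).trans hQ₁
  have hψρ : ∀ a ∈ P, ρ' (f (k (ρ a))) = ρ' (f a) := fun a ha => by rw [hkρ a ha]
  have hψy : ρ' (f (k y)) = y := by rw [← hρy, hψρ x hxP, hfx, hρy', hρy]
  have hyP₁ : y ∈ P₁ := hρy ▸ hP₁.map_mem hxP
  have hρC : ∀ a ∈ elemCentralizer x, ρ a ∈ elemCentralizer y := fun a ha => by
    rw [← hρy]
    exact hρ.mem_elemCentralizer (mem_elemCentralizer_self _) ha ha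
  have hρC' : ∀ a ∈ elemCentralizer (x' : S), ρ' a ∈ elemCentralizer y := fun a ha => by
    rw [← hρy']
    exact hρ'.mem_elemCentralizer (mem_elemCentralizer_self _) ha ha
  have hP₁C : P₁ ≤ elemCentralizer y := fun b hb => by
    obtain ⟨a, ha, rfl⟩ := (hP₁.mem_iff b).1 hb
    exact hρC a (hPC ha)
  have hN₁C : N₁ ≤ elemCentralizer y := fun b hb => by
    obtain ⟨a, ha, rfl⟩ := (hN₁.mem_iff b).1 hb
    exact hρC a (hNC ha)
  have hyN₁ : y ∈ N₁ := hρy ▸ hN₁.map_mem (hPN hxP)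
  have hjP := joinElem_subgroupOf hyP₁ hP₁C
  have hjN := joinElem_subgroupOf hyN₁ hN₁C
  rw [← hjP] at hψ
  obtain ⟨f₂, Q₂, hf₂, hjQ, hf₂ψ⟩ := hψ.exists_centralizer hψy
  have hCQ := centralizer_le_elemCentralizer x'.2
  have hQ₁fc : F.FullyCentralized p Q₁ := hQ.of_isIso hQ₁
    (toralOrder_centralizer_le hS hρ' hCQ hQC hQ₁)
  have hQ₂fc : (F.centralizer y).FullyCentralized p Q₂ :=
    FullyCentralized.of_joinElem hS (by rwa [hjQ])
  -- Because `Q` is fully centralized, `ρ'` maps `C_S(Q)` onto `C_S(Q₁)`.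
  have hCsurj := hS.surjOn_of_toralOrder_le (H := Subgroup.centralizer (Q : Set S))
    (K := Subgroup.centralizer (Q₁ : Set S)) ρ'
    (fun a ha b hb => hρ'.map_mul (hCQ ha) (hCQ hb)) (hρ'.injOn.mono hCQ)
    (fun s hs => Subgroup.mem_centralizer_iff.2 fun b hb => by
      obtain ⟨a, ha, rfl⟩ := (hQ₁.mem_iff b).1 hb
      rw [← hρ'.map_mul (hQC ha) (hCQ hs), ← hρ'.map_mul (hCQ hs) (hQC ha),
        Subgroup.mem_centralizer_iff.1 hs a ha])
    (fullyCentralized_iff.1 hQ _ _ hQ₁)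
  have hconj : ∀ n ∈ N, ∀ a ∈ P, ρ n * ρ a * (ρ n)⁻¹ = ρ (n * a * n⁻¹) := fun n hn a ha =>
    (hρ.map_conj (hNC hn) (hPC ha)).symm
  have hconj' : ∀ n ∈ N, ∀ a ∈ P, ρ' (f (n * a * n⁻¹)) = ρ' (c n) * ρ' (f a) * (ρ' (c n))⁻¹ :=
    fun n hn a ha => by
      rw [hc n hn a ha, hρ'.map_conj (hNQ (hcN n hn)) (hQC (hf.map_mem ha))]
  obtain ⟨g₂, hg₂, hg₂f⟩ := extensionAxiom_iff.1 hsat.extensionAxiom f₂ _ Q₂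
    (N₁.subgroupOf (elemCentralizer y)) hf₂ hQ₂fc (fun a ha => by
      obtain ⟨b, hb, hba⟩ := (hP₁.mem_iff a).1 ha
      exact (hN₁.mem_iff a).2 ⟨b, hPN hb, hba⟩) (by
    intro m hm
    obtain ⟨n, hn, hnm⟩ := (hN₁.mem_iff m).1 hm
    have key : ∀ a ∈ P₁.subgroupOf (elemCentralizer y), ∃ b ∈ P, ρ b = a ∧
        ((m * a * m⁻¹ : elemCentralizer y) : S) = ρ (n * b * n⁻¹) := by
      intro a ha
      obtain ⟨b, hb, hba⟩ := (hP₁.mem_iff a).1 ha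
      refine ⟨b, hb, hba, ?_⟩
      rw [← hconj n hn b hb, hba, hnm]
      rfl
    have key' : ∀ a ∈ P₁.subgroupOf (elemCentralizer y),
        m * a * m⁻¹ ∈ P₁.subgroupOf (elemCentralizer y) := by
      intro a ha
      obtain ⟨b, hb, -, h2⟩ := key a ha
      rw [Subgroup.mem_subgroupOf, h2]
      exact hP₁.map_mem ((hN n hn).1 b hb)
    refine ⟨key', ⟨ρ' (c n), hρC' _ (hNQ (hcN n hn))⟩, fun a ha => Subtype.ext ?_⟩
    obtain ⟨b, hb, hba, h2⟩ := key a ha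
    rw [hf₂ψ _ (key' a ha), h2, hψρ _ ((hN n hn).1 b hb), hconj' n hn b hb, Subgroup.coe_mul,
      Subgroup.coe_mul, hf₂ψ a ha, ← hba, hψρ b hb]
    rfl)
  obtain ⟨g₃, hg₃, hg₃y, hg₃g⟩ := isMor_centralizer_iff.1 hg₂
  rw [hjN] at hg₃
  have hg₃ρ : ∀ a ∈ P, g₃ (ρ a) = ρ' (f a) := by
    intro a ha
    have h1 : (⟨ρ a, hρC a (hPC ha)⟩ : elemCentralizer y) ∈ P₁.subgroupOf (elemCentralizer y) :=
      hP₁.map_mem ha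
    have h2 := hg₃g ⟨ρ a, hρC a (hPC ha)⟩ (hN₁.map_mem (hPN ha))
    rw [hg₂f _ h1, hf₂ψ _ h1, hψρ a ha] at h2
    exact h2
  obtain ⟨D, hD⟩ := hρ'.exists_isIso
  obtain ⟨κ, hκ, hκρ, -⟩ := hD.exists_symm
  refine ⟨fun n => κ (g₃ (ρ n)), ((hρ.mono hNC).comp hg₃ fun n hn => hN₁.map_mem hn).comp hκ.isMor
    fun n hn => ?_, fun a ha => ?_⟩
  · have hρn := hN₁.map_mem hn
    -- `g₃ (ρ n)` and `ρ' (c n)` act identically on `Q₁`, so they differ by an element of `C_S(Q₁)`,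
    -- which is in the image of `ρ'`. Hence `g₃ (ρ n)` lies where `ρ'` can be inverted.
    have hcen : (ρ' (c n))⁻¹ * g₃ (ρ n) ∈ Subgroup.centralizer (Q₁ : Set S) := by
      refine Subgroup.mem_centralizer_iff.2 fun b hb => ?_
      obtain ⟨q, hq, rfl⟩ := (hQ₁.mem_iff b).1 hb
      obtain ⟨a, ha, rfl⟩ := (hf.mem_iff q).1 hq
      have h1 := hg₃.map_conj hρn (hN₁.map_mem (hPN ha))
      rw [hconj n hn a ha, hg₃ρ _ ((hN n hn).1 a ha), hg₃ρ a ha, hconj' n hn a ha] at h1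
      have h2 : ρ' (f a) = (ρ' (c n))⁻¹ * (g₃ (ρ n) * ρ' (f a) * (g₃ (ρ n))⁻¹) * ρ' (c n) := by
        rw [← h1]
        simp [mul_assoc]
      conv_lhs => rw [h2]
      simp [mul_assoc]
    obtain ⟨d, hd, hdc⟩ := hCsurj _ hcen
    refine (hD.mem_iff _).2 ⟨c n * d, mul_mem (hNQ (hcN n hn)) (hCQ hd), ?_⟩
    rw [hρ'.map_mul (hNQ (hcN n hn)) (hCQ hd), hdc, mul_inv_cancel_left]
  · change κ (g₃ (ρ a)) = f a
    rw [hg₃ρ a ha, hκρ _ (hQC (hf.map_mem ha))]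

end FusionSystem

/-! ### From a saturated `F` to saturated centralizers -/

namespace FusionSystem

variable {p : ℕ} {S : Type*} [Group S] {F : FusionSystem S}

theorem IsMor.isIso_zpowers {f : S → S} {x : S} (hf : F.IsMor f (Subgroup.zpowers x)) :
    F.IsIso f (Subgroup.zpowers x) (Subgroup.zpowers (f x)) := by
  refine ⟨hf, fun b => ⟨?_, ?_⟩⟩
  · rintro ⟨k, rfl⟩
    exact ⟨x ^ k, ⟨k, rfl⟩, hf.map_zpow (Subgroup.mem_zpowers x) k⟩
  · rintro ⟨_, ⟨k, rfl⟩, rfl⟩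
    exact ⟨k, (hf.map_zpow (Subgroup.mem_zpowers x) k).symm⟩

/-- `C_S(x)` acts trivially on `⟨x⟩`, so it lies in `N_φ` for every morphism `φ` on `⟨x⟩`, with
conjugating element 1. -/
theorem ExtensionAxiom.isReceptive (hF : F.ExtensionAxiom p) {y : S}
    (hy : F.FullyCentralized p (Subgroup.zpowers y)) : F.IsReceptive y := by
  rintro x f hf rfl
  have hcomm : ∀ n ∈ elemCentralizer x, ∀ a ∈ Subgroup.zpowers x, n * a * n⁻¹ = a := by
    rintro n hn _ ⟨k, rfl⟩
    exact mul_inv_eq_iff_eq_mul.2 (zpow_commute ⟨n, hn⟩ k).eq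
  obtain ⟨ρ, hρ, hρf⟩ := extensionAxiom_iff.1 hF f _ _ (elemCentralizer x) hf.isIso_zpowers hy
    (by rw [Subgroup.zpowers_le]; exact mem_elemCentralizer_self x) fun n hn =>
      ⟨fun a ha => by rwa [hcomm n hn a ha], 1, fun a ha => by rw [hcomm n hn a ha]; simp⟩
  exact ⟨ρ, hρ, hρf x (Subgroup.mem_zpowers x)⟩

/-- Axiom (II) in `F` is applied to the morphism on `P⟨x⟩`, whose image is fully centralized in `F`
by receptivity. As `x` commutes with everything involved, the condition on `N` passes to `N⟨x⟩`. -/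
theorem ExtensionAxiom.centralizer [Fact p.Prime] (hS : IsPToral p S) (hF : F.ExtensionAxiom p)
    {x : S} (hx : F.IsReceptive x) : (F.centralizer x).ExtensionAxiom p := by
  refine extensionAxiom_iff.2 fun f P Q N hf hQ hPN hN => ?_
  obtain ⟨g, hg, hgx, hgf⟩ := hf.exists_of_centralizer
  have hxP := elem_mem_joinElem P
  obtain ⟨g', hg', hgg⟩ := extensionAxiom_iff.1 hF g _ _ (joinElem N) hg
    (hx.fullyCentralized_joinElem hS hQ) (by
      intro s hs
      obtain ⟨a, ha, k, rfl⟩ := mem_joinElem.1 hs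
      exact mem_joinElem.2 ⟨a, hPN ha, k, rfl⟩) (by
    intro s hs
    obtain ⟨n, hn, k, rfl⟩ := mem_joinElem.1 hs
    obtain ⟨hnP, h, hh⟩ := hN n hn
    have key : ∀ a ∈ P, ∀ l : ℤ, (n : S) * x ^ k * (a * x ^ l) * ((n : S) * x ^ k)⁻¹ =
        (n * a * n⁻¹ : elemCentralizer x) * x ^ l := by
      intro a ha l
      have h1 : x ^ k * ((a : S) * x ^ l) * (x ^ k)⁻¹ = a * x ^ l := by
        rw [mul_inv_eq_iff_eq_mul]
        exact ((zpow_commute a k).symm.mul_right (Commute.zpow_zpow_self x k l)).eq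
      calc (n : S) * x ^ k * (a * x ^ l) * ((n : S) * x ^ k)⁻¹
          = n * (x ^ k * (a * x ^ l) * (x ^ k)⁻¹) * (n : S)⁻¹ := by simp [mul_assoc]
        _ = n * a * (x ^ l * (n : S)⁻¹) := by rw [h1]; simp [mul_assoc]
        _ = n * a * ((n : S)⁻¹ * x ^ l) := by rw [(zpow_commute n l).inv_left.eq]
        _ = _ := by simp [mul_assoc]
    have hgm : ∀ a ∈ P, ∀ l : ℤ, g (a * x ^ l) = f a * x ^ l := fun a ha l => by
      rw [hg.isMor.map_mul (coe_mem_joinElem ⟨a, ha⟩) (zpow_mem hxP l), hgf a ha,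
        hg.isMor.map_zpow hxP, hgx]
    refine ⟨fun b hb => ?_, h, fun b hb => ?_⟩
    · obtain ⟨a, ha, l, rfl⟩ := mem_joinElem.1 hb
      rw [key a ha l]
      exact mem_joinElem.2 ⟨_, hnP a ha, l, rfl⟩
    · obtain ⟨a, ha, l, rfl⟩ := mem_joinElem.1 hb
      rw [key a ha l, hgm _ (hnP a ha), hgm a ha, hh a ha, Subgroup.coe_mul, Subgroup.coe_mul,
        Subgroup.coe_inv, mul_assoc, (zpow_commute h l).inv_left.eq]
      simp only [mul_assoc])
  have hgx' : g' x = x := by rw [hgg x hxP, hgx]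
  have hmem : ∀ n ∈ N, g' n ∈ elemCentralizer x := fun n hn => by
    have := hg'.mem_elemCentralizer (elem_mem_joinElem N) (coe_mem_joinElem ⟨n, hn⟩) n.2
    rwa [hgx'] at this
  refine ⟨fun n => toCentralizer x (g' n), isMor_centralizer_iff.2 ⟨g', hg', hgx', fun n hn => ?_⟩,
    fun a ha => Subtype.ext ?_⟩
  · rw [coe_toCentralizer (hmem n hn)]
  · rw [coe_toCentralizer (hmem a (hPN ha)), hgg a (coe_mem_joinElem ⟨a, ha⟩), hgf a ha]

theorem ContinuityAxiom.centralizer (hF : F.ContinuityAxiom) (x : S) :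
    (F.centralizer x).ContinuityAxiom := by
  refine continuityAxiom_iff.2 fun P hP f hf => ?_
  choose g hg hgx hgf using fun n => isMor_centralizer_iff.1 (hf n)
  have hgm : ∀ n, ∀ a ∈ P n, ∀ k : ℤ, g n (a * x ^ k) = f a * x ^ k := fun n a ha k => by
    rw [(hg n).map_mul (coe_mem_joinElem ⟨a, ha⟩) (zpow_mem (elem_mem_joinElem _) k), hgf n a ha,
      (hg n).map_zpow (elem_mem_joinElem _), hgx]
  have hjoin : Monotone fun n => joinElem (P n) := fun m n hmn s hs => by
    obtain ⟨a, ha, k, rfl⟩ := mem_joinElem.1 hs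
    exact mem_joinElem.2 ⟨a, hP hmn ha, k, rfl⟩
  have hgle : ∀ m n, m ≤ n → ∀ s ∈ joinElem (P m), g n s = g m s := by
    intro m n hmn s hs
    obtain ⟨a, ha, k, rfl⟩ := mem_joinElem.1 hs
    rw [hgm m a ha, hgm n a (hP hmn ha)]
  classical
  -- The extension to each `P n` joined with `x` is forced by `f` and by fixing `x`, so the choice
  -- of `n` does not matter.
  let G : S → S := fun s => if h : ∃ n, s ∈ joinElem (P n) then g h.choose s else 1
  have hG : ∀ m, ∀ s ∈ joinElem (P m), G s = g m s := by
    intro m s hs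
    have h : ∃ n, s ∈ joinElem (P n) := ⟨m, hs⟩
    simp only [G, dif_pos h]
    rw [← hgle _ _ (le_max_left h.choose m) s h.choose_spec, hgle _ _ (le_max_right _ m) s hs]
  have hGm := continuityAxiom_iff.1 hF _ hjoin G fun n => (hg n).congr (hG n)
  refine isMor_centralizer_iff.2 ⟨G, hGm.mono ?_, ?_, fun a ha => ?_⟩
  · intro s hs
    obtain ⟨a, ha, k, rfl⟩ := mem_joinElem.1 hs
    obtain ⟨n, hn⟩ := (Subgroup.mem_iSup_of_directed hP.directed_le).1 ha
    exact Subgroup.mem_iSup_of_mem n (mem_joinElem.2 ⟨a, hn, k, rfl⟩)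
  · rw [hG 0 x (elem_mem_joinElem _), hgx]
  · obtain ⟨n, hn⟩ := (Subgroup.mem_iSup_of_directed hP.directed_le).1 ha
    rw [hG n a (coe_mem_joinElem ⟨a, hn⟩), hgf n a hn]

/-- Pairs formed by an automorphism of `P ≤ C_S(x)` and an automorphism in `F` of a subgroup `Q` that
correspond to each other under an isomorphism `θ : P⟨x⟩ → Q`, where the second one fixes `θ(x)`. -/
def compatibleAut (F : FusionSystem S) {x : S} {P : Subgroup (elemCentralizer x)} {Q : Subgroup S}
    (θ : joinElem P → Q) : Subgroup (MulAut Q × MulAut P) where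
  carrier := {τ | τ.1 ∈ F.aut Q ∧ τ.1 (θ ⟨x, elem_mem_joinElem P⟩) = θ ⟨x, elem_mem_joinElem P⟩ ∧
    ∀ a : P, τ.1 (θ ⟨a, coe_mem_joinElem a⟩) = θ ⟨τ.2 a, coe_mem_joinElem (τ.2 a)⟩}
  one_mem' := ⟨one_mem _, rfl, fun _ => rfl⟩
  mul_mem' := by
    rintro σ τ ⟨h1, h2, h3⟩ ⟨h1', h2', h3'⟩
    refine ⟨mul_mem h1 h1', ?_, fun a => ?_⟩
    · change σ.1 (τ.1 _) = _
      rw [h2', h2]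
    · change σ.1 (τ.1 _) = _
      rw [h3', h3]
      rfl
  inv_mem' := by
    rintro τ ⟨h1, h2, h3⟩
    refine ⟨inv_mem h1, τ.1.injective ?_, fun a => τ.1.injective ?_⟩
    · change τ.1 (τ.1⁻¹ _) = _
      rw [MulAut.apply_inv_self, h2]
    · change τ.1 (τ.1⁻¹ _) = _
      rw [MulAut.apply_inv_self, h3]
      change _ = θ ⟨(τ.2 (τ.2⁻¹ a) : P), _⟩
      simp only [MulAut.apply_inv_self]

section CompatibleAut

variable {x : S} {P : Subgroup (elemCentralizer x)} {Q : Subgroup S} {θ : S → S}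

/-- An automorphism of `P` in `C_F(x)` extends to `P⟨x⟩` fixing `x`, and `θ` transports the
extension to `Q`. Subgroups of `Aut(P)` and of `Aut(Q)` can thus be compared by pulling both back to
one group. -/
theorem range_snd_compatibleAut (hθ : F.IsIso θ (joinElem P) Q) :
    ((MonoidHom.snd _ _).comp
      (F.compatibleAut fun a : joinElem P => (⟨θ a, hθ.map_mem a.2⟩ : Q)).subtype).range =
        (F.centralizer x).aut P := by
  obtain ⟨k, hk, hkθ, -⟩ := hθ.exists_symm
  ext β
  constructor
  · rintro ⟨⟨⟨α, β⟩, h1, h2, h3⟩, rfl⟩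
    obtain ⟨w, hw, hαw⟩ := exists_isIso_of_mem_aut h1
    have hkw : ∀ a : P, k (w (θ a)) = (β a : elemCentralizer x) := fun a => by
      have h4 := congrArg Subtype.val (h3 a)
      rw [hαw] at h4
      change w (θ a) = θ (β a : elemCentralizer x) at h4
      rw [h4, hkθ _ (coe_mem_joinElem (β a))]
    refine mem_aut_iff.2 ⟨fun a => toCentralizer x (k (w (θ a))), isMor_centralizer_iff.2
      ⟨fun a => k (w (θ a)), ((hθ.trans hw).trans hk).isMor, ?_, fun a ha => ?_⟩, fun a => ?_⟩
    · have h4 := congrArg Subtype.val h2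
      rw [hαw] at h4
      change w (θ x) = θ x at h4
      change k (w (θ x)) = x
      rw [h4, hkθ _ (elem_mem_joinElem P)]
    · change k (w (θ a)) = _
      rw [hkw ⟨a, ha⟩, toCentralizer_coe]
    · change ((β a : P) : elemCentralizer x) = toCentralizer x (k (w (θ a)))
      rw [hkw a, toCentralizer_coe]
  · intro hβ
    obtain ⟨f, hf, hβf⟩ := exists_isIso_of_mem_aut hβ
    obtain ⟨g, hg, hgx, hgf⟩ := hf.exists_of_centralizer
    have hiso := (hk.trans hg).trans hθ
    obtain ⟨α, -, -, hα⟩ := hiso.exists_mulEquiv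
    have hαθ : ∀ a (ha : a ∈ joinElem P), ((α ⟨θ a, hθ.map_mem ha⟩ : Q) : S) = θ (g a) :=
      fun a ha => by rw [hα]; change θ (g (k (θ a))) = _; rw [hkθ a ha]
    refine ⟨⟨(α, β), mem_aut_iff.2 ⟨_, hiso.isMor, hα⟩, Subtype.ext ?_, fun a => Subtype.ext ?_⟩,
      rfl⟩
    · refine (hαθ x (elem_mem_joinElem P)).trans ?_
      rw [hgx]
    · refine (hαθ a (coe_mem_joinElem a)).trans ?_
      rw [hgf a a.2, ← hβf]

theorem relIndex_aut_centralizer (hθ : F.IsIso θ (joinElem P) Q) (A : Subgroup (MulAut P)) :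
    A.relIndex ((F.centralizer x).aut P) = (A.comap ((MonoidHom.snd _ _).comp
      (F.compatibleAut fun a : joinElem P => (⟨θ a, hθ.map_mem a.2⟩ : Q)).subtype)).index := by
  rw [Subgroup.index_comap, range_snd_compatibleAut hθ]

end CompatibleAut

/-- Any subgroup is conjugate in `C_F(x)` to one which has the properties in `SylowAxiom`. -/
theorem IsSaturated.exists_isIso_centralizer [Fact p.Prime] (hS : IsPToral p S)
    (hF : F.IsSaturated p) {x : S} (hx : F.IsReceptive x) (P : Subgroup (elemCentralizer x)) :
    ∃ f P', (F.centralizer x).IsIso f P P' ∧ (F.centralizer x).FullyCentralized p P' ∧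
      (F.centralizer x).HasSylowAut p P' := by
  obtain ⟨θ, Q, hθ, hQ⟩ := exists_fullyNormalized hS F (joinElem P)
  obtain ⟨hQc, hQs⟩ := (sylowAxiom_iff hS.isPGroup).1 hF.sylowAxiom Q hQ
  have hxP := elem_mem_joinElem P
  let L := F.compatibleAut fun a : joinElem P => (⟨θ a, hθ.map_mem a.2⟩ : Q)
  let u : L →* MulAut Q := (MonoidHom.fst _ _).comp L.subtype
  let s : L →* MulAut P := (MonoidHom.snd _ _).comp L.subtype
  have hu : u.range ≤ F.aut Q := by
    rintro _ ⟨τ, rfl⟩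
    exact τ.2.1
  -- `γ` is chosen so that the preimage in `L` of the `γ`-conjugate of `Aut_S(Q)` has index prime to
  -- `p`. Replacing `θ` by its composite with `γ⁻¹` then makes the preimage of `Aut_S(Q)` large.
  obtain ⟨γ, hγ, hγA⟩ := exists_conj_not_dvd_index u hu hQs.2
  obtain ⟨v, hv, hγv⟩ := exists_isIso_of_mem_aut (inv_mem hγ)
  have hθv := hθ.trans hv
  obtain ⟨k, hk, hkθ, -⟩ := hθv.exists_symm
  have hx'Q : v (θ x) ∈ Q := hθv.map_mem hxP
  -- Receptivity brings `v (θ x)` back to `x` on its whole centralizer, so the composite from `P⟨x⟩`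
  -- fixes `x` and defines the conjugate `P'`.
  obtain ⟨ρ, hρ, hρx⟩ := hx (v (θ x)) k (hk.isMor.mono (by rwa [Subgroup.zpowers_le]))
    (hkθ x hxP)
  have hQC : Q ≤ elemCentralizer (v (θ x)) := fun b hb => by
    obtain ⟨a, ha, rfl⟩ := (hθv.mem_iff b).1 hb
    exact hθv.isMor.mem_elemCentralizer hxP ha (joinElem_le P ha)
  obtain ⟨R, hR⟩ := hρ.isIso_of_le hQC
  obtain ⟨f, P', hf, rfl, hfg⟩ := (hθv.trans hR).exists_centralizer hρx
  refine ⟨f, P', hf, FullyCentralized.of_joinElem hS (hQc.of_isIso hR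
    (toralOrder_centralizer_le hS hρ (centralizer_le_elemCentralizer hx'Q) hQC hR)), ?_⟩
  obtain ⟨e, -, -, he⟩ := hf.exists_mulEquiv
  have heg : ∀ a : P, ((e a : elemCentralizer x) : S) = ρ (v (θ a)) := fun a => by
    rw [he, hfg a a.2]
  rw [HasSylowAut, ← map_aut_congr e hf he, ← Subgroup.relIndex_comap, ← Subgroup.relIndex_comap,
    comap_innerAut_congr, relIndex_aut_centralizer hθ, relIndex_aut_centralizer hθ]
  constructor
  · have h1 : ((innerAut Q).comap u).index ≠ 0 := by
      rw [Subgroup.index_comap]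
      exact fun h0 => hQs.1 (Subgroup.relIndex_eq_zero_of_le_right hu h0)
    -- Conjugation by `c * x ^ l` on `P` is conjugation by `c`, since `x` centralizes `P`.
    have hle : (innerAut Q).comap u ≤ (innerAut P).comap s := by
      rintro ⟨⟨α, β⟩, hαβ⟩ hα
      obtain ⟨q, hq, hqα⟩ := mem_innerAut_iff.1 (show α ∈ innerAut Q from hα)
      obtain ⟨b, hb, rfl⟩ := (hθ.mem_iff q).1 hq
      obtain ⟨c, hc, l, rfl⟩ := mem_joinElem.1 hb
      refine mem_innerAut_iff.2 ⟨c, hc, fun a => Subtype.ext ?_⟩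
      have h2 := congrArg Subtype.val (hαβ.2.2 a)
      rw [hqα] at h2
      change θ (c * x ^ l) * θ a * (θ (c * x ^ l))⁻¹ = θ (β a : elemCentralizer x) at h2
      have ha := coe_mem_joinElem a
      rw [← hθ.isMor.map_conj hb ha] at h2
      have h3 := hθ.isMor.injOn (mul_mem (mul_mem hb ha) (inv_mem hb)) (coe_mem_joinElem (β a)) h2
      change ((β a : elemCentralizer x) : S) = c * a * (c : S)⁻¹
      rw [← h3]
      have h4 : x ^ l * (a : S) * (x ^ l)⁻¹ = a :=
        mul_inv_eq_iff_eq_mul.2 (zpow_commute (a : elemCentralizer x) l).symm.eq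
      calc (c : S) * x ^ l * a * ((c : S) * x ^ l)⁻¹
          = c * (x ^ l * a * (x ^ l)⁻¹) * (c : S)⁻¹ := by simp [mul_assoc]
        _ = _ := by rw [h4]
    exact fun h0 => h1 (by
      have := Subgroup.index_dvd_of_le hle
      rwa [show ((innerAut P).comap s).index = 0 from h0, zero_dvd_iff] at this)
  · refine fun hd => hγA (hd.trans (Subgroup.index_dvd_of_le ?_))
    rintro ⟨⟨α, β⟩, hαβ⟩ hα
    obtain ⟨t, ht⟩ := mem_autBy_iff.1
      (show (MulAut.conj γ⁻¹) α ∈ autBy Q from hα)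
    have hθγ : ∀ a (ha : a ∈ joinElem P), γ⁻¹ (⟨θ a, hθ.map_mem ha⟩ : Q) =
        ⟨v (θ a), hθv.map_mem ha⟩ := fun a ha => Subtype.ext (hγv _)
    have hconj : ∀ a (ha : a ∈ joinElem P), ((γ⁻¹ (α ⟨θ a, hθ.map_mem ha⟩) : Q) : S) =
        t * v (θ a) * t⁻¹ := fun a ha => by
      have h1 := ht (γ⁻¹ (⟨θ a, hθ.map_mem ha⟩ : Q))
      have h2 : (MulAut.conj γ⁻¹) α (γ⁻¹ (⟨θ a, hθ.map_mem ha⟩ : Q)) =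
          γ⁻¹ (α ⟨θ a, hθ.map_mem ha⟩) := by
        rw [MulAut.conj_apply, inv_inv]
        change γ⁻¹ (α (γ (γ⁻¹ _))) = _
        rw [MulAut.apply_inv_self]
      rw [h2, hθγ a ha] at h1
      exact h1
    -- `α` fixes `θ x`, so the element `t` inducing its conjugate centralizes `v (θ x)`. Hence `ρ t`
    -- is defined as a morphism value, lies in `C_S(x)`, and induces on `P'` the automorphism
    -- corresponding to `β`.
    have htx : t ∈ elemCentralizer (v (θ x)) := by
      have h1 := hconj x hxP
      have h2 : α (⟨θ x, hθ.map_mem hxP⟩ : Q) = ⟨θ x, hθ.map_mem hxP⟩ := hαβ.2.1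
      rw [h2, hθγ x hxP] at h1
      exact mem_elemCentralizer_iff.2 (mul_inv_eq_iff_eq_mul.1 h1.symm)
    have hρt : ρ t ∈ elemCentralizer x := by
      have := hρ.mem_elemCentralizer (mem_elemCentralizer_self _) htx htx
      rwa [hρx] at this
    change (MulAut.congr e) β ∈ autBy P'
    refine mem_autBy_iff.2 ⟨⟨ρ t, hρt⟩, fun b => Subtype.ext ?_⟩
    obtain ⟨a, rfl⟩ := e.surjective b
    change ((e (β (e.symm (e a))) : elemCentralizer x) : S) =
      ρ t * (e a : elemCentralizer x) * (ρ t)⁻¹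
    have ha := coe_mem_joinElem a
    have h3 : α (⟨θ a, hθ.map_mem ha⟩ : Q) = ⟨θ (β a : elemCentralizer x),
      hθ.map_mem (coe_mem_joinElem (β a))⟩ := hαβ.2.2 a
    have h1 := hconj a ha
    rw [h3, hθγ _ (coe_mem_joinElem (β a))] at h1
    change v (θ (β a : elemCentralizer x)) = _ at h1
    rw [e.symm_apply_apply, heg, heg, h1, hρ.map_conj htx (hQC (hθv.map_mem ha))]

/-- Axiom (II) in `C_F(x)`, already established, spreads axiom (I) from one good conjugate to every
fully normalized one. -/
theorem IsSaturated.centralizer [Fact p.Prime] (hS : IsPToral p S) (hF : F.IsSaturated p) {x : S}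
    (hx : F.IsReceptive x) : (F.centralizer x).IsSaturated p := by
  have hC := hS.subgroup (elemCentralizer x)
  have hext := hF.extensionAxiom.centralizer hS hx
  refine ⟨(sylowAxiom_iff hC.isPGroup).2 fun P hP => ?_, hext, hF.continuityAxiom.centralizer x⟩
  obtain ⟨f, P', hf, hP', hP''⟩ := hF.exists_isIso_centralizer hS hx P
  exact hP.of_isIso_hasSylowAut hC hext hf hP' hP''

theorem IsSaturated.exists_fullyCentralized_zpowers [Fact p.Prime] (hS : IsPToral p S)
    (hF : F.IsSaturated p) {x : S} (hx : orderOf x = p) :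
    ∃ y, orderOf y = p ∧ F.FullyCentralized p (Subgroup.zpowers y) ∧
      F.IsConjugateElement x y := by
  obtain ⟨f, Q, hf, hQ⟩ := exists_fullyNormalized hS F (Subgroup.zpowers x)
  have hQ' : Q = Subgroup.zpowers (f x) := by
    ext b
    rw [hf.mem_iff, hf.isMor.isIso_zpowers.mem_iff]
  have hfx : f x ^ p = 1 := by
    have := hf.isMor.map_zpow (Subgroup.mem_zpowers x) p
    rw [zpow_natCast, zpow_natCast, ← hx, pow_orderOf_eq_one, hf.isMor.map_one] at this
    rw [← hx]
    exact this.symm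
  refine ⟨f x, orderOf_eq_prime hfx fun h => ?_, ?_, isConjugateElement_iff.2 ⟨f, hf.isMor, rfl⟩⟩
  · have h1 := hf.isMor.injOn (Subgroup.mem_zpowers x) (one_mem _) (h.trans hf.isMor.map_one.symm)
    rw [h1, orderOf_one] at hx
    exact (Fact.out : p.Prime).ne_one hx.symm
  · rw [← hQ']
    exact ((sylowAxiom_iff hS.isPGroup).1 hF.sylowAxiom Q hQ).1

end FusionSystem

/-! ### The equivalence -/

theorem mainTheorem2 (p : ℕ) [Fact p.Prime] {S : Type*} [Group S] (hS : IsDiscretePToral p S)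
    (F : FusionSystem S) :
    F.IsSaturated p ↔
      F.ContinuityAxiom ∧
      ∃ X : Set S, (∀ x ∈ X, orderOf x = p) ∧
        (∀ x : S, orderOf x = p → ∃ y ∈ X, F.IsConjugateElement x y) ∧
        (∀ x y : S, F.IsConjugateElement x y → y ∈ X →
          ∃ ρ ∈ F.Hom (elemCentralizer x) (elemCentralizer y),
            (ρ ⟨x, mem_elemCentralizer_self x⟩ : S) = y) ∧
        ∀ x ∈ X, (F.centralizer x).IsSaturated p := by
  have hS' := IsPToral.of_isDiscretePToral hS
  constructor
  · intro hF
    refine ⟨hF.continuityAxiom,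
      {x | orderOf x = p ∧ F.FullyCentralized p (Subgroup.zpowers x)}, fun x hx => hx.1,
      fun x hx => ?_, fun x y hxy hy => ?_,
      fun x hx => hF.centralizer hS' (hF.extensionAxiom.isReceptive hx.2)⟩
    · obtain ⟨y, hy, hyc, hxy⟩ := hF.exists_fullyCentralized_zpowers hS' hx
      exact ⟨y, ⟨hy, hyc⟩, hxy⟩
    · obtain ⟨f, hf, hfx⟩ := FusionSystem.isConjugateElement_iff.1 hxy
      obtain ⟨ρ, hρ, rfl⟩ := hF.extensionAxiom.isReceptive hy.2 x f hf hfx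
      exact ⟨homOfMulOn _ _ ρ (fun a ha b hb => hρ.map_mul ha hb)
        fun a ha => hρ.mem_elemCentralizer (mem_elemCentralizer_self x) ha ha,
        hρ.mem_hom _ fun a => rfl, rfl⟩
  · rintro ⟨hcont, X, -, hconj, hρ, hsat⟩
    have hloc : F.IsLocallySaturated p := by
      intro x hx
      obtain ⟨y, hy, hxy⟩ := hconj x hx
      obtain ⟨f, hf, hfx⟩ := FusionSystem.isConjugateElement_iff.1 hxy
      -- Condition (ii) is what makes `y` receptive.
      refine ⟨y, f, hf, hfx, fun x' f' hf' hfx' => ?_, hsat y hy⟩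
      obtain ⟨ρ, hρ, hρy⟩ := hρ x' y (FusionSystem.isConjugateElement_iff.2 ⟨f', hf', hfx'⟩) hy
      obtain ⟨r, hr, hrρ⟩ := FusionSystem.exists_isMor_of_mem_hom hρ
      exact ⟨r, hr, (hrρ ⟨x', mem_elemCentralizer_self x'⟩).trans hρy⟩
    exact ⟨hloc.sylowAxiom hS', hloc.extensionAxiom hS', hcont⟩
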